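/- Throughout, $T^m_{\mathbb C}=(\mathbb C^\times)^m\supset T^m=(S^1)^m$, $\mathfrak g=\mathbb R^m$ is the Lie algebra of $T^m$ (identified with its dual by the standard pairing), and $\exp(v)=(e^{2\pi i v_1},\dots,e^{2\pi i v_m})$, so that $\ker\exp=\mathbb Z^m$; $v_p=\frac{d}{dt}|_{t=0}\exp(tv)\cdot p$. Let $(M,\omega,g,J,\Omega_\gamma)$ be a toric almost Calabi–Yau manifold of complex dimension $m$. That is: $M$ is a smooth toric variety (a Hausdorff complex manifold with a holomorphic action of $T^m_{\mathbb C}$ and a base point in a free open dense orbit, covered by equivariant affine toric charts) whose fan has finitely many one-dimensional cones, with primitive generators $\lambda_1,\dots,\lambda_d\in\mathbb Z^m$; $\omega$ is a $T^m$-invariant Kähler form, $g(X,Y)=\omega(X,JY)$; $\mu:M\to\mathbb R^m$ is a ($T^m$-invariant) moment map, $d\langle\mu,v\rangle=\omega(\cdot,v_p)$, whose image $\Delta=\mu(M)$ satisfies $\overline\Delta=\{y\mid\langle y,\lambda_i\rangle\ge\kappa_i,\ i=1,\dots,d\}$ for some constants $\kappa_i$; $\gamma\in\mathbb Z^m$ satisfies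 $\langle\gamma,\lambda_i\rangle=1$ for all $i$, and $\Omega_\gamma$ is the nowhere vanishing holomorphic $(m,0)$-form which, in logarithmic coordinates $z$ on the open orbit, equals $e^{\gamma_1z^1+\dots+\gamma_mz^m}dz^1\wedge\dots\wedge dz^m$. Let $\psi$ be the function on $M$ with $e^{2m\psi}\frac{\omega^m}{m!}=(-1)^{m(m-1)/2}\left(\frac i2\right)^m\Omega_\gamma\wedge\overline{\Omega_\gamma}$. Let $\sigma$ be the anti-holomorphic involution of $M$ that fixes the base point and satisfies $\sigma(u\cdot p)=\bar u\cdot\sigma(p)$ for $u\in T^m_{\mathbb C}$, and $M^\sigma$ its fixed point set. Let $\zeta_1,\dots,\zeta_n\in\mathfrak g$ be linearly independent ($n\ge 0$), $c_1,\dots,c_n\in\mathbb R$, and put $V_\zeta=\mathrm{Span}_{\mathbb R}\{\zeta_1,\dots,\zeta_n\}$, $$M^\sigma_{\zeta,c}=\{p\in M^\sigma\mid\langle\mu(p),\zeta_i\rangle=c_i,\ i=1,\dots,n\}.$$ Assume that every $y\in\Delta$ with $\langle y,\zeta_i\rangle=c_i$ for all $i$ is $\zeta$-regular, i.e. $V_\zeta\cap\mathrm{Span}_{\mathbb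 R}\{\lambda_i\mid\langle y,\lambda_i\rangle=\kappa_i\}=\{0\}$. Then $M^\sigma_{\zeta,c}$ is an embedded real $(m-n)$-dimensional submanifold of $M$. Define $F$ by (I) $F:L=M^\sigma_{\zeta,c}\times U\to M$, $F(p,v)=\exp(v)\cdot p$, where $U$ is any open ball in $V_\zeta$ centred at $0$; or (II) if $V_\zeta$ has a basis which generates $V_\zeta\cap\mathbb Z^m$ over $\mathbb Z$: $F:L=M^\sigma_{\zeta,c}\times T_\zeta\to M$, $F(p,[v])=\exp(v)\cdot p$, where $T_\zeta=V_\zeta/(V_\zeta\cap\mathbb Z^m)$. In both cases: $F$ is a Lagrangian immersion (an immersion with $\dim_{\mathbb R}L=m$ and $F^*\omega=0$). Its Lagrangian angle $\theta:L\to\mathbb R/\pi\mathbb Z$, i.e. the argument modulo $\pi$ of the function $h$ in $F^*\Omega_\gamma=h\,dx^1\wedge\dots\wedge dx^m$ for any local coordinates $x$ on $L$, is $$\theta(p,v)=2\pi\langle\gamma,v\rangle+\frac{\pi}{2}n\ \bmod\pi ,\qquad\text{resp.}\qquad \theta(p,[v])=2\pi\langle\gamma,v\rangle+\frac{\pi}{2}n\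 \bmod\pi .$$ And $F$ is weighted Hamiltonian stationary: $\Delta_f\theta=0$ on $(L,F^*g)$ for $f=-mF^*\psi$, where $\Delta_fu=\Delta u+\langle\nabla u,\nabla f\rangle$, applied to local real-valued lifts of $\theta$. In case (II), moreover, $F$ is $T_\zeta$-invariant: $F(p,[w]+[v])=\exp(w)\cdot F(p,[v])$ for $v,w\in V_\zeta$. -/

import Mathlib

open scoped Manifold ContDiff Topology

noncomputable section

namespace ToricCY

/-! ### Lagrangian immersions into almost Calabi-Yau manifolds

`M` is a complex manifold of complex dimension `m`, modelled on `Fin m → ℂ`; the same charts make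
it a real manifold of dimension `2 * m`. -/

/-- The model space of a complex manifold of complex dimension `m`. -/
abbrev CE (m : ℕ) : Type := Fin m → ℂ

section Ambient

variable {m : ℕ} {M : Type*} [TopologicalSpace M] [ChartedSpace (CE m) M]

/-- The complex structure `J` of the real tangent space. -/
def cplxStr (p : M) (X : TangentSpace 𝓘(ℝ, CE m) p) : TangentSpace 𝓘(ℝ, CE m) p :=
  let v : CE m := X
  (Complex.I • v : CE m)

variable (m M) in
/-- Fields of real bilinear forms on the tangent spaces. -/
abbrev BilinField : Type _ :=
  ∀ p : M, TangentSpace 𝓘(ℝ, CE m) p →L[ℝ] TangentSpace 𝓘(ℝ, CE m) p →L[ℝ] ℝ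

variable (m M) in
/-- Fields of complex multilinear alternating `m`-forms, i.e. forms of type `(m, 0)`. -/
abbrev TopFormField : Type _ :=
  ∀ p : M, (TangentSpace 𝓘(ℂ, CE m) p) [⋀^Fin m]→L[ℂ] ℂ

/-- The coefficient `ω(a, b)` of a field of bilinear forms in the chart `e`, for constant vectors
`a`, `b` of the model space. -/
def coeff (omega : BilinField m M) (e : OpenPartialHomeomorph M (CE m)) (a b z : CE m) : ℝ :=
  omega (e.symm z) (mfderiv 𝓘(ℝ, CE m) 𝓘(ℝ, CE m) e.symm z a)
    (mfderiv 𝓘(ℝ, CE m) 𝓘(ℝ, CE m) e.symm z b)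

/-- The coefficient `h` of `Ω = h dz¹ ∧ ⋯ ∧ dzᵐ` in the chart `e`. -/
def topCoeff (Ω : TopFormField m M) (e : OpenPartialHomeomorph M (CE m)) (z : CE m) : ℂ :=
  Ω (e.symm z) (fun i => mfderiv 𝓘(ℂ, CE m) 𝓘(ℂ, CE m) e.symm z (Pi.single i (1 : ℂ) : CE m))

/-- `ω` is a Kähler form: a smooth, closed, alternating real 2-form which is compatible with `J`
and for which `g(X, Y) = ω(X, JY)` is positive definite. -/
structure IsKahlerForm (omega : BilinField m M) : Prop where
  alternating : ∀ (p : M) (X : TangentSpace 𝓘(ℝ, CE m) p), omega p X X = 0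
  smooth : ∀ e ∈ atlas (CE m) M, ∀ a b : CE m, ContDiffOn ℝ ∞ (coeff omega e a b) e.target
  closed : ∀ e ∈ atlas (CE m) M, ∀ z ∈ e.target, ∀ a b c : CE m,
    fderiv ℝ (coeff omega e b c) z a + fderiv ℝ (coeff omega e c a) z b
      + fderiv ℝ (coeff omega e a b) z c = 0
  compatible : ∀ (p : M) (X Y : TangentSpace 𝓘(ℝ, CE m) p),
    omega p (cplxStr p X) (cplxStr p Y) = omega p X Y
  positive : ∀ (p : M) (X : TangentSpace 𝓘(ℝ, CE m) p), X ≠ 0 → 0 < omega p X (cplxStr p X)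

/-- `Ω` is a holomorphic `(m, 0)`-form. -/
def IsHolomorphicForm (Ω : TopFormField m M) : Prop :=
  ∀ e ∈ atlas (CE m) M, DifferentiableOn ℂ (topCoeff Ω e) e.target

/-- The Kähler metric `g(X, Y) = ω(X, JY)`. -/
def kahlerMetric (omega : BilinField m M) (p : M) (X Y : TangentSpace 𝓘(ℝ, CE m) p) : ℝ :=
  omega p X (cplxStr p Y)

/-- The `2m`-form `ω^m / m!`, evaluated on `2m` tangent vectors. -/
def omegaPow (omega : BilinField m M) (p : M) (v : Fin (2 * m) → TangentSpace 𝓘(ℝ, CE m) p) : ℝ :=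
  1 / (2 ^ m * (m.factorial : ℝ)) * ∑ s : Equiv.Perm (Fin (2 * m)),
    ((Equiv.Perm.sign s : ℤ) : ℝ) *
      ∏ k : Fin m, omega p (v (s ⟨2 * k.val, by omega⟩)) (v (s ⟨2 * k.val + 1, by omega⟩))

/-- The `2m`-form `Ω ∧ Ω̄`, evaluated on `2m` tangent vectors. -/
def topWedge (Ω : TopFormField m M) (p : M)
    (v : Fin (2 * m) → TangentSpace 𝓘(ℝ, CE m) p) : ℂ :=
  1 / (m.factorial : ℂ) ^ 2 * ∑ s : Equiv.Perm (Fin (2 * m)),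
    ((Equiv.Perm.sign s : ℤ) : ℂ) *
      (Ω p (fun k : Fin m => v (s ⟨k.val, by omega⟩)) *
        (starRingEnd ℂ) (Ω p (fun k : Fin m => v (s ⟨m + k.val, by omega⟩))))

/-- The function `ψ` of an almost Calabi-Yau manifold:
`e^{2mψ} ω^m / m! = (-1)^{m(m-1)/2} (i/2)^m Ω ∧ Ω̄`. -/
def IsConformalPotential (omega : BilinField m M) (Ω : TopFormField m M) (ψ : M → ℝ) : Prop :=
  ∀ (p : M) (v : Fin (2 * m) → TangentSpace 𝓘(ℝ, CE m) p),
    ((Real.exp (2 * m * ψ p) * omegaPow omega p v : ℝ) : ℂ) =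
      (-1) ^ (m * (m - 1) / 2) * (Complex.I / 2) ^ m * topWedge Ω p v

end Ambient

section Weighted

/-! ### The weighted Laplacian

`L` is a real manifold without boundary, modelled on `E`, with a Riemannian metric `h`. Everything
is computed in the preferred chart `φ` around the point at which the operator is evaluated. -/

variable {E H : Type*} [NormedAddCommGroup E] [NormedSpace ℝ E] [FiniteDimensional ℝ E]
  [TopologicalSpace H]
  (I : ModelWithCorners ℝ E H) {L : Type*} [TopologicalSpace L] [ChartedSpace H L]
  (h : ∀ x : L, TangentSpace I x → TangentSpace I x → ℝ)

/-- The matrix `h_{ij}` of the metric in the chart around `x`, as a function on the model space. -/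
def gram (x : L) (y : E) :
    Matrix (Fin (Module.finrank ℝ E)) (Fin (Module.finrank ℝ E)) ℝ :=
  Matrix.of fun i j => h ((extChartAt I x).symm y)
    (mfderiv 𝓘(ℝ, E) I (extChartAt I x).symm y (Module.finBasis ℝ E i : E))
    (mfderiv 𝓘(ℝ, E) I (extChartAt I x).symm y (Module.finBasis ℝ E j : E))

/-- `∂_i u` in the chart around `x`. -/
def partialDeriv (x : L) (u : L → ℝ) (i : Fin (Module.finrank ℝ E)) (y : E) : ℝ :=
  fderiv ℝ (u ∘ (extChartAt I x).symm) y (Module.finBasis ℝ E i)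

/-- `Δu = (det h)^{-1/2} ∑_i ∂_i ((det h)^{1/2} ∑_j h^{ij} ∂_j u)`, at the point `x`. -/
def laplacian (u : L → ℝ) (x : L) : ℝ :=
  (Real.sqrt (gram I h x (extChartAt I x x)).det)⁻¹ *
    ∑ i, fderiv ℝ (fun y : E => Real.sqrt (gram I h x y).det *
      ∑ j, (gram I h x y)⁻¹ i j * partialDeriv I x u j y)
        (extChartAt I x x) (Module.finBasis ℝ E i)

/-- `⟨∇u, ∇f⟩ = ∑_{i,j} h^{ij} ∂_i u ∂_j f`, at the point `x`. -/
def gradInner (u f : L → ℝ) (x : L) : ℝ :=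
  ∑ i, ∑ j, (gram I h x (extChartAt I x x))⁻¹ i j *
    partialDeriv I x u i (extChartAt I x x) * partialDeriv I x f j (extChartAt I x x)

/-- The weighted Laplacian `Δ_f u = Δu + ⟨∇u, ∇f⟩`. -/
def weightedLaplacian (f u : L → ℝ) (x : L) : ℝ :=
  laplacian I h u x + gradInner I h u f x

variable {m : ℕ} {M : Type*} [TopologicalSpace M] [ChartedSpace (CE m) M]

/-- The pulled back metric `F^*g`. -/
def inducedMetric (omega : BilinField m M) (F : L → M) (x : L) (X Y : TangentSpace I x) : ℝ :=
  kahlerMetric omega (F x) (mfderiv I 𝓘(ℝ, CE m) F x X) (mfderiv I 𝓘(ℝ, CE m) F x Y)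

/-- `F : L → M` is a Lagrangian immersion: an immersion of a manifold of real dimension `m` with
`F^*ω = 0`. -/
structure IsLagrangianImmersion (omega : BilinField m M) (F : L → M) : Prop where
  immersion : Manifold.IsImmersion I 𝓘(ℝ, CE m) ∞ F
  finrank_eq : Module.finrank ℝ E = m
  pullback_eq_zero : ∀ (x : L) (X Y : TangentSpace I x),
    omega (F x) (mfderiv I 𝓘(ℝ, CE m) F x X) (mfderiv I 𝓘(ℝ, CE m) F x Y) = 0

/-- `θ : L → ℝ/πℤ` is the Lagrangian angle of `F`: for every basis `b` of a tangent space `T_x L`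
(the coordinate frame of some chart), `(F^*Ω)(b_1, …, b_m)` is nonzero and `θ(x)` is its argument
modulo `π`. -/
def IsLagrangianAngle (Ω : TopFormField m M) (F : L → M) (θ : L → AddCircle Real.pi) : Prop :=
  ∀ (x : L) (b : Module.Basis (Fin m) ℝ (TangentSpace I x)),
    Ω (F x) (fun i => mfderiv I 𝓘(ℝ, CE m) F x (b i)) ≠ 0 ∧
    θ x = (Complex.arg (Ω (F x) (fun i => mfderiv I 𝓘(ℝ, CE m) F x (b i))) :
      AddCircle Real.pi)

/-- `F`, with Lagrangian angle `θ`, is weighted Hamiltonian stationary: `Δ_f θ = 0` for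
`f = -m F^*ψ`. Here `Δ_f` is applied to a smooth real-valued lift `u` of `θ` near the point (two
such lifts differ by a constant near the point). -/
def IsWeightedHamiltonianStationary (omega : BilinField m M) (ψ : M → ℝ) (F : L → M)
    (θ : L → AddCircle Real.pi) : Prop :=
  ∀ x : L, ∃ W ∈ 𝓝 x, ∃ u : L → ℝ, ContMDiffOn I 𝓘(ℝ, ℝ) ∞ u W ∧
    (∀ y ∈ W, (u y : AddCircle Real.pi) = θ y) ∧
    weightedLaplacian I (inducedMetric I omega F) (fun y => -(m : ℝ) * ψ (F y)) u x = 0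

end Weighted

section Toric

/-! ### Toric almost Calabi-Yau manifolds

The Lie algebra of `T^m` is `𝔤 = ℝ^m`, with integral lattice `ℤ^m`; its dual is identified with
`ℝ^m` by the standard inner product. The complex torus is `(ℂ^×)^m = (Fin m → ℂˣ)`. -/

/-- The Lie algebra of the torus `T^m` (and its dual). -/
abbrev LieT (m : ℕ) : Type := EuclideanSpace ℝ (Fin m)

/-- An integral vector as an element of `𝔤`, or of its dual. -/
def intVec {m : ℕ} (a : Fin m → ℤ) : LieT m := WithLp.toLp 2 fun i => (a i : ℝ)

/-- The exponential map `(e^{z_1}, …, e^{z_m})` of the complex torus. -/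
def expC {m : ℕ} (z : CE m) : Fin m → ℂˣ :=
  fun j => Units.mk0 (Complex.exp (z j)) (Complex.exp_ne_zero _)

/-- The exponential map `exp : 𝔤 → T^m`, with kernel `ℤ^m`. -/
def expT {m : ℕ} (v : LieT m) : Fin m → ℂˣ :=
  expC fun j => 2 * Real.pi * Complex.I * (v j : ℂ)

variable {m : ℕ} {M : Type*} [TopologicalSpace M] [ChartedSpace (CE m) M]
  [MulAction (Fin m → ℂˣ) M]

variable (m) in
/-- An affine toric chart of `M` with respect to the base point `base` of the open orbit: an
equivariant biholomorphic map from an open subset of `M` onto the smooth affine toric variety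
`{z ∈ ℂ^m | z_j ≠ 0 for j ∉ k}`. Its cone in the fan of `M` is generated by the vectors
`β_j`, `j ∈ k`, of the `ℤ`-basis `β` of `ℤ^m`. -/
structure ToricChart (base : M) where
  β : Fin m → Fin m → ℤ
  unimodular : IsUnit (Matrix.of β).det
  k : Set (Fin m)
  φ : OpenPartialHomeomorph M (CE m)
  mem_maximalAtlas : φ ∈ IsManifold.maximalAtlas 𝓘(ℂ, CE m) ∞ M
  target_eq : φ.target = {z | ∀ j, j ∉ k → z j ≠ 0}
  symm_one : φ.symm (fun _ => 1) = base
  symm_smul : ∀ (s : Fin m → ℂˣ), ∀ z ∈ φ.target,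
    φ.symm (fun j => (s j : ℂ) * z j) = (fun i => ∏ j, s j ^ β j i) • φ.symm z

variable (m M) in
/-- A smooth toric variety: a complex manifold with a holomorphic action of `(ℂ^×)^m`, covered by
affine toric charts (so that the orbit of `base` is free, open and dense). -/
structure ToricManifold where
  base : M
  holomorphic_smul : ContMDiff (𝓘(ℂ, CE m).prod 𝓘(ℂ, CE m)) 𝓘(ℂ, CE m) ∞
    (fun q : CE m × M => expC q.1 • q.2)
  exists_chart : ∀ p : M, ∃ C : ToricChart m base, p ∈ C.φ.source

/-- The set of primitive generators `λ_i` of the one-dimensional cones of the fan. -/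
def ToricManifold.rays (X : ToricManifold m M) : Set (Fin m → ℤ) :=
  {l | ∃ C : ToricChart m X.base, ∃ j ∈ C.k, C.β j = l}

/-- The tangent vector `v_p = d/dt|_{t=0} exp(tv)·p` generated by `v ∈ 𝔤`. -/
def fundVec (v : LieT m) (p : M) : TangentSpace 𝓘(ℝ, CE m) p :=
  (mfderiv 𝓘(ℝ, ℝ) 𝓘(ℝ, CE m) (fun t : ℝ => expT (t • v) • p) 0 (1 : ℝ) : CE m)

variable (m M) in
/-- A toric Kähler manifold: `ω` is invariant under the real torus, `μ` is a moment map, the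
closure of the moment polytope `Δ = μ(M)` is the intersection of the finitely many half-spaces
`⟨y, λ_i⟩ ≥ κ_i`, and `σ` is the anti-holomorphic involution of the toric variety, characterized
by `σ(u·p) = ū·σ(p)` and by fixing the base point. -/
structure ToricKahlerManifold extends ToricManifold m M where
  omega : BilinField m M
  isKahler : IsKahlerForm omega
  omega_invariant : ∀ (v : LieT m) (p : M) (X Y : TangentSpace 𝓘(ℝ, CE m) p),
    omega (expT v • p) (mfderiv 𝓘(ℝ, CE m) 𝓘(ℝ, CE m) (fun q : M => expT v • q) p X)
      (mfderiv 𝓘(ℝ, CE m) 𝓘(ℝ, CE m) (fun q : M => expT v • q) p Y) = omega p X Y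
  μ : M → LieT m
  μ_smooth : ContMDiff 𝓘(ℝ, CE m) 𝓘(ℝ, LieT m) ∞ μ
  μ_invariant : ∀ (v : LieT m) (p : M), μ (expT v • p) = μ p
  μ_moment : ∀ (v : LieT m) (p : M) (X : TangentSpace 𝓘(ℝ, CE m) p),
    mfderiv 𝓘(ℝ, CE m) 𝓘(ℝ, ℝ) (fun q : M => inner ℝ (μ q) v) p X = omega p X (fundVec v p)
  rays_finite : toToricManifold.rays.Finite
  κ : (Fin m → ℤ) → ℝ
  closure_polytope : closure (Set.range μ) =
    {y | ∀ l ∈ toToricManifold.rays, κ l ≤ inner ℝ y (intVec l)}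
  σ : M → M
  σ_smooth : ContMDiff 𝓘(ℝ, CE m) 𝓘(ℝ, CE m) ∞ σ
  σ_antiholomorphic : ∀ (p : M) (X : TangentSpace 𝓘(ℝ, CE m) p),
    mfderiv 𝓘(ℝ, CE m) 𝓘(ℝ, CE m) σ p (cplxStr p X) =
      -cplxStr (σ p) (mfderiv 𝓘(ℝ, CE m) 𝓘(ℝ, CE m) σ p X)
  σ_involutive : Function.Involutive σ
  σ_smul : ∀ (u : Fin m → ℂˣ) (p : M), σ (u • p) = (fun j => star (u j)) • σ p
  σ_base : σ base = base

variable (m M) in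
/-- A toric almost Calabi-Yau manifold: `γ ∈ ℤ^m` satisfies `⟨γ, λ_i⟩ = 1` for all `i`, and
`Ω = Ω_γ` is the nowhere vanishing holomorphic `(m, 0)`-form on `M` which on the open orbit, in
logarithmic coordinates `z`, is `e^{γ_1 z^1 + ⋯ + γ_m z^m} dz^1 ∧ ⋯ ∧ dz^m`. -/
structure ToricAlmostCalabiYau extends ToricKahlerManifold m M where
  γ : Fin m → ℤ
  γ_ray : ∀ l ∈ toToricManifold.rays, ∑ i, γ i * l i = 1
  Ω : TopFormField m M
  Ω_holomorphic : IsHolomorphicForm Ω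
  Ω_ne_zero : ∀ p, Ω p ≠ 0
  Ω_orbit : ∀ (z : CE m) (a : Fin m → CE m),
    Ω (expC z • base) (fun i =>
        mfderiv 𝓘(ℂ, CE m) 𝓘(ℂ, CE m) (fun z : CE m => expC z • base) z (a i)) =
      Complex.exp (∑ i, (γ i : ℂ) * z i) * (Matrix.of a).det

variable {n : ℕ}

/-- `V_ζ`, the real span of `ζ_1, …, ζ_n` in `𝔤`. -/
abbrev V (ζ : Fin n → LieT m) : Submodule ℝ (LieT m) := Submodule.span ℝ (Set.range ζ)

namespace ToricKahlerManifold

variable (X : ToricKahlerManifold m M)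

/-- `𝔷_y`, the real span of the `λ_i` with `⟨y, λ_i⟩ = κ_i`. -/
def facetSpan (y : LieT m) : Submodule ℝ (LieT m) :=
  Submodule.span ℝ (intVec '' {l | l ∈ X.rays ∧ inner ℝ y (intVec l) = X.κ l})

/-- `y` is a `ζ`-regular point: `V_ζ ∩ 𝔷_y = {0}`. -/
def IsRegularPoint (ζ : Fin n → LieT m) (y : LieT m) : Prop :=
  V ζ ⊓ X.facetSpan y = ⊥

/-- `Δ_{ζ,c}`, the points `y` of the moment polytope with `⟨y, ζ_i⟩ = c_i`. -/
def slicePolytope (ζ : Fin n → LieT m) (c : Fin n → ℝ) : Set (LieT m) :=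
  {y | y ∈ Set.range X.μ ∧ ∀ i, inner ℝ y (ζ i) = c i}

/-- `M^σ_{ζ,c}`, the points `p` of the real form with `⟨μ(p), ζ_i⟩ = c_i`. -/
def realSlice (ζ : Fin n → LieT m) (c : Fin n → ℝ) : Set M :=
  {p | X.σ p = p ∧ ∀ i, inner ℝ (X.μ p) (ζ i) = c i}

end ToricKahlerManifold

/-! ### The torus `T_ζ` -/

variable (m) in
/-- The integral lattice `ℤ^m` of `𝔤`. -/
def intLattice : AddSubgroup (LieT m) where
  carrier := {v | ∃ a : Fin m → ℤ, intVec a = v}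
  add_mem' := by
    rintro _ _ ⟨a, rfl⟩ ⟨b, rfl⟩
    exact ⟨a + b, by ext i; simp [intVec]⟩
  zero_mem' := ⟨0, by ext i; simp [intVec]⟩
  neg_mem' := by
    rintro _ ⟨a, rfl⟩
    exact ⟨-a, by ext i; simp [intVec]⟩

/-- `V_ζ ∩ ℤ^m`, as a subgroup of `V_ζ`. -/
def lattice (ζ : Fin n → LieT m) : AddSubgroup (V ζ) :=
  (intLattice m).comap (V ζ).subtype.toAddMonoidHom

/-- `T_ζ = V_ζ / (V_ζ ∩ ℤ^m)`. -/
abbrev Torus (ζ : Fin n → LieT m) : Type := V ζ ⧸ lattice ζ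

/-- The special condition: some basis of `V_ζ` generates `V_ζ ∩ ℤ^m` over `ℤ`. -/
def SpecialCondition (ζ : Fin n → LieT m) : Prop :=
  ∃ v : Module.Basis (Fin n) ℝ (V ζ), AddSubgroup.closure (Set.range v) = lattice ζ

theorem lattice_eq_zero {ζ : Fin n → LieT m} {v : V ζ} (hv : v ∈ lattice ζ) (h : ‖v‖ < 1) :
    v = 0 := by
  obtain ⟨a, ha⟩ := hv
  have ha' : intVec a = (v : LieT m) := ha
  apply Subtype.ext
  rw [← ha']
  ext i
  have h1 : ‖(v : LieT m) i‖ < 1 := (PiLp.norm_apply_le (v : LieT m) i).trans_lt h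
  rw [← ha'] at h1
  have h2 : |((a i : ℤ) : ℝ)| < 1 := h1
  have h3 : a i = 0 := by
    rw [← Int.abs_lt_one_iff]
    exact_mod_cast h2
  simp [intVec, h3]

theorem lattice_discrete (ζ : Fin n → LieT m) : IsDiscrete (lattice ζ : Set (V ζ)) := by
  rw [isDiscrete_iff_discreteTopology]
  refine discreteTopology_iff_isOpen_singleton_zero.mpr ⟨Metric.ball 0 1, Metric.isOpen_ball, ?_⟩
  ext v
  simp only [Set.mem_preimage, Metric.mem_ball, dist_zero_right, Set.mem_singleton_iff]
  refine ⟨fun h => Subtype.ext (lattice_eq_zero v.2 h), ?_⟩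
  rintro rfl
  simp

theorem isLocalHomeomorph_mk (ζ : Fin n → LieT m) :
    IsLocalHomeomorph (QuotientAddGroup.mk : V ζ → Torus ζ) :=
  ((lattice ζ).isAddQuotientCoveringMap_of_comm (lattice_discrete ζ)).isCoveringMap
    |>.isLocalHomeomorph

/-- The manifold structure of `T_ζ` for which `V_ζ → T_ζ` is a local diffeomorphism. -/
instance torusChartedSpace (ζ : Fin n → LieT m) : ChartedSpace (V ζ) (Torus ζ) :=
  (isLocalHomeomorph_mk ζ).chartedSpace Quotient.mk_surjective

instance torusIsManifold (ζ : Fin n → LieT m) : IsManifold 𝓘(ℝ, V ζ) ∞ (Torus ζ) := by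
  apply isManifold_of_contDiffOn
  rintro e e' ⟨q, rfl⟩ ⟨q', rfl⟩
  have hg : Function.Surjective (QuotientAddGroup.mk : V ζ → Torus ζ) := Quotient.mk_surjective
  generalize hg.hasRightInverse.choose q = a
  generalize hg.hasRightInverse.choose q' = b
  simp only [modelWithCornersSelf_coe, modelWithCornersSelf_coe_symm, Function.comp_id,
    Function.id_comp, Set.range_id, Set.inter_univ, Set.preimage_id, chartAt_self_eq,
    OpenPartialHomeomorph.trans_refl]
  set e := (isLocalHomeomorph_mk ζ).localInverseAt a
  set e' := (isLocalHomeomorph_mk ζ).localInverseAt b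
  have key : ∀ w ∈ (e.symm.trans e').source, (e.symm.trans e') w - w ∈ lattice ζ := by
    intro w hw
    rw [OpenPartialHomeomorph.trans_source] at hw
    have h1 : QuotientAddGroup.mk (e' (e.symm w)) = e.symm w :=
      (isLocalHomeomorph_mk ζ).apply_localInverseAt_of_mem hw.2
    have h2 : e.symm w = QuotientAddGroup.mk w :=
      congrFun ((isLocalHomeomorph_mk ζ).localInverseAt_symm a) w
    have h3 : (QuotientAddGroup.mk w : Torus ζ) = QuotientAddGroup.mk (e' (e.symm w)) := by
      rw [h1, h2]
    have h4 := QuotientAddGroup.eq.mp h3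
    rw [neg_add_eq_sub] at h4
    exact h4
  intro w hw
  have ho := (e.symm.trans e').open_source.mem_nhds hw
  have hc : ContinuousAt (fun y => (e.symm.trans e') y - y) w :=
    ((e.symm.trans e').continuousAt hw).sub continuousAt_id
  have hn := hc (Metric.ball_mem_nhds _ one_pos)
  apply ContDiffAt.contDiffWithinAt
  apply ContDiffAt.congr_of_eventuallyEq
    (contDiffAt_id.add (contDiffAt_const (c := (e.symm.trans e') w - w)))
  filter_upwards [ho, hn] with y hy1 hy2
  have h5 := lattice_eq_zero ((lattice ζ).sub_mem (key y hy1) (key w hw))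
    (by simpa [dist_eq_norm] using hy2)
  have h6 := sub_eq_zero.mp h5
  rw [← h6]
  simp

theorem expT_add (v w : LieT m) : expT (v + w) = expT v * expT w := by
  funext j
  ext
  simp [expT, expC, mul_add, Complex.exp_add]

theorem expT_intVec (a : Fin m → ℤ) : expT (intVec a) = 1 := by
  funext j
  ext
  simp only [expT, expC, intVec, Units.val_mk0, Pi.one_apply, Units.val_one]
  rw [Complex.exp_eq_one_iff]
  exact ⟨a j, by push_cast; ring⟩

/-- The model of `M^σ_{ζ,c} × U` and `M^σ_{ζ,c} × T_ζ`. -/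
abbrev modelL (ζ : Fin n → LieT m) : ModelWithCorners ℝ
    (EuclideanSpace ℝ (Fin (m - n)) × V ζ)
    (ModelProd (EuclideanSpace ℝ (Fin (m - n))) (V ζ)) :=
  𝓘(ℝ, EuclideanSpace ℝ (Fin (m - n))).prod 𝓘(ℝ, V ζ)

/-- The map `F_{ζ,c}(p, v) = exp(v)·p` on `M^σ_{ζ,c} × U`, for an open subset `U` of `V_ζ`. -/
def mapU (X : ToricKahlerManifold m M) (ζ : Fin n → LieT m) (c : Fin n → ℝ)
    (U : TopologicalSpace.Opens (V ζ)) (q : X.realSlice ζ c × U) : M :=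
  expT ((q.2 : V ζ) : LieT m) • (q.1 : M)

/-- The map `F_{ζ,c}(p, [v]) = exp(v)·p` on `M^σ_{ζ,c} × T_ζ`. -/
def mapT (X : ToricKahlerManifold m M) (ζ : Fin n → LieT m) (c : Fin n → ℝ)
    (q : X.realSlice ζ c × Torus ζ) : M :=
  Quotient.liftOn' q.2 (fun v : V ζ => expT (v : LieT m) • (q.1 : M)) (by
    intro v w hvw
    obtain ⟨a, ha⟩ := QuotientAddGroup.leftRel_apply.mp hvw
    have hw : (w : LieT m) = v + intVec a := by
      have : intVec a = ((-v + w : V ζ) : LieT m) := ha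
      rw [this]; simp
    simp only [hw, expT_add, expT_intVec, mul_one])

/-- The open ball of radius `r` in `V_ζ` centred at `0`. -/
def ballU (ζ : Fin n → LieT m) (r : ℝ) : TopologicalSpace.Opens (V ζ) :=
  ⟨Metric.ball 0 r, Metric.isOpen_ball⟩

end Toric

end ToricCY

end

/-! Everything is computed at a real point in a toric chart, where `σ` is complex conjugation, the
torus acts diagonally and the vector field of `v` has coordinates `2πi v_j z_j`. Hence at a real
point `J` carries orbit directions to real directions. The real part is isotropic: over the open
orbit, `J` maps its tangent vectors to orbit directions, torus orbits are isotropic because `μ` is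
invariant, and `ω` is `J`-invariant; the remaining real points are limits (`coeff_real_eq_zero`).

Regularity enters only as injectivity of the infinitesimal action of `V_ζ` along the slice. If the
field of `v` vanishes at `z`, then `v` is a combination of the lattice vectors `β_j` with `z_j = 0`.
The function `⟨μ, β_j⟩` is minimal where `z_j = 0`, and the description of the closed polytope then
places `β_j` in `facetSpan` (`intVec_mem_facetSpan`). Consequently the matrix `ω(J ζ_i, ζ_j)` at a
real point is negative definite and its columns come from real vectors, so the equations `Im z_j =
0` and `⟨μ, ζ_i⟩ = c_i` are independent. This makes the slice a submanifold.

The differential of `(p, v) ↦ exp(v)·p` is the action of `exp(v)` applied to vectors `r + w_p`, with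
`r` tangent to the slice and `w ∈ V_ζ` (`ToricChart.frame`). Three observations about these vectors
give the theorem. First, `ω` vanishes on pairs `(r, r)`, `(w_p, w_p)` and `(r, w_p)`, the last
because `⟨μ, w⟩` is constant on the slice. Second, `g(r, w_p) = ω(r, J w_p) = 0`, since `J w_p` is
real; the induced metric is therefore a block metric, and by invariance of `ω` and `J` it does not
depend on `v`. Third, `Ω` has a real coefficient at real points, and the frame has `m - n` real and
`n` imaginary vectors, which yields a real multiple of `i^n`; the action of `exp(v)` multiplies this
by `e^{2πi⟨γ, v⟩}` (`arg_orbitMap`).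

The function `ψ` is torus invariant because `ω^m` and `Ω ∧ Ω̄` are. So in product charts the angle
is affine in `v`, while metric and weight depend on the slice coordinate alone. The field `√det h ·
∇θ` then points along `V_ζ` with coefficients constant in that direction: it is divergence free and
orthogonal to `∇f` (`weightedLaplacian_eq_zero`). The ball and the torus `T_ζ` are treated together
through `IsOrbitMap`. -/

noncomputable section

namespace ToricCY

/-! ### Inverse function theorem and immersions. -/

section DiffTop

/-- The inverse function theorem, with smoothness of the inverse on the whole target. -/
theorem exists_openPartialHomeomorph_contDiffOn {E F : Type*} [NormedAddCommGroup E]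
    [NormedSpace ℝ E] [CompleteSpace E] [NormedAddCommGroup F] [NormedSpace ℝ F]
    {g : E → F} {U : Set E} (hU : IsOpen U) (hg : ContDiffOn ℝ ∞ g U) {a : E} (ha : a ∈ U)
    {g' : E ≃L[ℝ] F} (hg' : HasFDerivAt g (g' : E →L[ℝ] F) a) :
    ∃ χ : OpenPartialHomeomorph E F, a ∈ χ.source ∧ χ.source ⊆ U ∧ (∀ x, χ x = g x) ∧
      ContDiffOn ℝ ∞ χ χ.source ∧ ContDiffOn ℝ ∞ χ.symm χ.target := by
  have hat : ContDiffAt ℝ ∞ g a := hg.contDiffAt (hU.mem_nhds ha)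
  have hne : (∞ : WithTop ℕ∞) ≠ 0 := by simp
  set χ₀ := hat.toOpenPartialHomeomorph g hg' hne
  have hcont : ContinuousOn (fderiv ℝ g) U := hg.continuousOn_fderiv_of_isOpen hU (by simp)
  -- Invertibility of the derivative is an open condition. On `W` the local inverse is smooth at
  -- every point of its domain, not only at the image of `a`.
  set W := U ∩ fderiv ℝ g ⁻¹' (Set.range ((↑) : (E ≃L[ℝ] F) → E →L[ℝ] F))
  have hW : IsOpen W := hcont.isOpen_inter_preimage hU ContinuousLinearEquiv.isOpen
  have haW : a ∈ W := ⟨ha, g', hg'.fderiv.symm⟩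
  refine ⟨χ₀.restrOpen W hW, ?_, ?_, fun x => rfl, ?_, ?_⟩
  · exact ⟨hat.mem_toOpenPartialHomeomorph_source hg' hne, haW⟩
  · intro x hx
    exact hx.2.1
  · intro x hx
    exact (hg.contDiffAt (hU.mem_nhds hx.2.1)).contDiffWithinAt
  · intro y hy
    have hx := (χ₀.restrOpen W hW).map_target hy
    obtain ⟨hxU, e, he⟩ := hx.2
    have hxd : ContDiffAt ℝ ∞ g ((χ₀.restrOpen W hW).symm y) := hg.contDiffAt (hU.mem_nhds hxU)
    have hd : HasFDerivAt g (e : E →L[ℝ] F) ((χ₀.restrOpen W hW).symm y) := by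
      rw [he]
      exact (hxd.differentiableAt (by simp)).hasFDerivAt
    exact ((χ₀.restrOpen W hW).contDiffAt_symm hy hd hxd).contDiffWithinAt

/-- The toric charts are holomorphic, while `μ`, `σ` and `F` are only smooth over the reals; this
allows the same charts to serve for both structures. -/
theorem contDiffGroupoid_real_of_complex {E : Type*} [NormedAddCommGroup E] [NormedSpace ℂ E]
    {e : OpenPartialHomeomorph E E} (h : e ∈ contDiffGroupoid ∞ 𝓘(ℂ, E)) :
    e ∈ contDiffGroupoid ∞ 𝓘(ℝ, E) := by
  have h' := (mem_groupoid_of_pregroupoid.mp h)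
  refine mem_groupoid_of_pregroupoid.mpr ?_
  simp only [contDiffPregroupoid, modelWithCornersSelf_coe, modelWithCornersSelf_coe_symm,
    Function.comp_id, Function.id_comp, Set.range_id, Set.inter_univ, Set.preimage_id] at h' ⊢
  exact ⟨h'.1.restrict_scalars ℝ, h'.2.restrict_scalars ℝ⟩

theorem isManifold_real {E : Type*} [NormedAddCommGroup E] [NormedSpace ℂ E] {M : Type*}
    [TopologicalSpace M] [ChartedSpace E M] [IsManifold 𝓘(ℂ, E) ∞ M] :
    IsManifold 𝓘(ℝ, E) ∞ M where
  compatible := fun he he' => contDiffGroupoid_real_of_complex (HasGroupoid.compatible he he')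

theorem mem_maximalAtlas_real {E : Type*} [NormedAddCommGroup E] [NormedSpace ℂ E] {M : Type*}
    [TopologicalSpace M] [ChartedSpace E M]
    {e : OpenPartialHomeomorph M E} (he : e ∈ IsManifold.maximalAtlas 𝓘(ℂ, E) ∞ M) :
    e ∈ IsManifold.maximalAtlas 𝓘(ℝ, E) ∞ M := fun e' he' =>
  ⟨contDiffGroupoid_real_of_complex (he e' he').1, contDiffGroupoid_real_of_complex (he e' he').2⟩

/-- An injective linear map extends to an isomorphism from the product with a complement. -/
theorem exists_equiv_of_injective {E E' F : Type*} [NormedAddCommGroup E] [NormedSpace ℝ E]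
    [FiniteDimensional ℝ E] [NormedAddCommGroup E'] [NormedSpace ℝ E'] [FiniteDimensional ℝ E']
    [NormedAddCommGroup F] [NormedSpace ℝ F] [FiniteDimensional ℝ F]
    (hdim : Module.finrank ℝ E' = Module.finrank ℝ E + Module.finrank ℝ F)
    (A : E →L[ℝ] E') (hA : Function.Injective A) :
    ∃ e : (E × F) ≃L[ℝ] E', ∀ a, e (a, 0) = A a := by
  obtain ⟨C, hC⟩ := Submodule.exists_isCompl (LinearMap.range (A : E →ₗ[ℝ] E'))
  have h1 : Module.finrank ℝ F = Module.finrank ℝ C := by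
    have h2 := Submodule.finrank_add_eq_of_isCompl hC
    have h3 := LinearMap.finrank_range_of_inj (f := (A : E →ₗ[ℝ] E')) hA
    omega
  let eF : F ≃ₗ[ℝ] C := LinearEquiv.ofFinrankEq F C h1
  let eA : E ≃ₗ[ℝ] LinearMap.range (A : E →ₗ[ℝ] E') := LinearEquiv.ofInjective _ hA
  let e : (E × F) ≃ₗ[ℝ] E' :=
    (LinearEquiv.prodCongr eA eF).trans (Submodule.prodEquivOfIsCompl _ _ hC)
  refine ⟨e.toContinuousLinearEquiv, fun a => ?_⟩
  simp [e, eA]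

/-- A surjective linear map is the second component of an isomorphism onto a product. -/
theorem exists_equiv_of_surjective {E E' F : Type*} [NormedAddCommGroup E] [NormedSpace ℝ E]
    [FiniteDimensional ℝ E] [NormedAddCommGroup E'] [NormedSpace ℝ E'] [FiniteDimensional ℝ E']
    [NormedAddCommGroup F] [NormedSpace ℝ F] [FiniteDimensional ℝ F]
    (hdim : Module.finrank ℝ E' = Module.finrank ℝ E + Module.finrank ℝ F)
    (A : E' →L[ℝ] F) (hA : Function.Surjective A) :
    ∃ e : E' ≃L[ℝ] (E × F), ∀ a, (e a).2 = A a := by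
  obtain ⟨B, hB⟩ := (A : E' →ₗ[ℝ] F).exists_rightInverse_of_surjective
    (LinearMap.range_eq_top.mpr hA)
  have hB' : ∀ b, A (B b) = b := fun b => LinearMap.congr_fun hB b
  have h1 : Module.finrank ℝ E = Module.finrank ℝ (LinearMap.ker (A : E' →ₗ[ℝ] F)) := by
    have h2 := (A : E' →ₗ[ℝ] F).finrank_range_add_finrank_ker
    have h3 : Module.finrank ℝ (LinearMap.range (A : E' →ₗ[ℝ] F)) = Module.finrank ℝ F := by
      rw [LinearMap.range_eq_top.mpr hA, finrank_top]
    omega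
  let K : E ≃ₗ[ℝ] LinearMap.ker (A : E' →ₗ[ℝ] F) := LinearEquiv.ofFinrankEq _ _ h1
  have hK : ∀ a, A (K a : E') = 0 := fun a => (K a).2
  let f : (E × F) →ₗ[ℝ] E' := LinearMap.coprod ((Submodule.subtype _).comp K.toLinearMap) B
  have hf : ∀ q, f q = (K q.1 : E') + B q.2 := fun q => by simp [f]
  have hf2 : ∀ q, A (f q) = q.2 := fun q => by rw [hf, map_add, hK, hB', zero_add]
  have hinj : Function.Injective f := by
    refine (injective_iff_map_eq_zero f).mpr fun q hq => ?_
    have h2 : q.2 = 0 := by rw [← hf2, hq, map_zero]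
    have h3 : K q.1 = 0 := by
      have := hf q
      rw [hq, h2, map_zero, add_zero] at this
      exact Subtype.ext this.symm
    exact Prod.ext (by simpa using h3) h2
  let e : (E × F) ≃ₗ[ℝ] E' := LinearMap.linearEquivOfInjective f hinj (by simp [hdim])
  refine ⟨e.symm.toContinuousLinearEquiv, fun a => ?_⟩
  have : A (f (e.symm a)) = (e.symm a).2 := hf2 _
  have h4 : f (e.symm a) = a := e.apply_symm_apply a
  rw [h4] at this
  exact this.symm

universe u

/-- A smooth map with injective derivative at a point is an immersion at this point. -/
theorem isImmersionAtOfComplement_of_injective {E H : Type*} {E' : Type u} {F : Type*}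
    [NormedAddCommGroup E] [NormedSpace ℝ E] [FiniteDimensional ℝ E]
    [NormedAddCommGroup E'] [NormedSpace ℝ E'] [FiniteDimensional ℝ E']
    [NormedAddCommGroup F] [NormedSpace ℝ F] [FiniteDimensional ℝ F]
    [TopologicalSpace H] {I : ModelWithCorners ℝ E H} [I.Boundaryless]
    {L M : Type*} [TopologicalSpace L] [ChartedSpace H L] [IsManifold I ∞ L]
    [TopologicalSpace M] [ChartedSpace E' M] [IsManifold 𝓘(ℝ, E') ∞ M]
    (hdim : Module.finrank ℝ E' = Module.finrank ℝ E + Module.finrank ℝ F)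
    {f : L → M} (hf : ContMDiff I 𝓘(ℝ, E') ∞ f) (x : L)
    (hinj : Function.Injective (mfderiv I 𝓘(ℝ, E') f x)) :
    Manifold.IsImmersionAtOfComplement F I 𝓘(ℝ, E') ∞ f x := by
  set φ := extChartAt I x
  set ψ := chartAt E' (f x)
  set g : E → E' := ψ ∘ f ∘ φ.symm
  set U : Set E := φ.target ∩ φ.symm ⁻¹' (f ⁻¹' ψ.source)
  have hgU : ContDiffOn ℝ ∞ g U := by
    have := (contMDiff_iff.mp hf).2 x (f x)
    simpa [g, U, φ, ψ] using this
  have hU : IsOpen U := by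
    have h1 : ContinuousOn (f ∘ φ.symm) φ.target :=
      hf.continuous.comp_continuousOn (continuousOn_extChartAt_symm x)
    exact h1.isOpen_inter_preimage (isOpen_extChartAt_target x) ψ.open_source
  have hxU : φ x ∈ U :=
    ⟨mem_extChartAt_target x, by simp [φ, ψ]⟩
  have hgd : HasFDerivAt g (fderiv ℝ g (φ x)) (φ x) :=
    ((hgU.contDiffAt (hU.mem_nhds hxU)).differentiableAt (by simp)).hasFDerivAt
  have hder : Function.Injective (fderiv ℝ g (φ x)) := by
    have h1 : MDifferentiableAt I 𝓘(ℝ, E') f x := hf.mdifferentiableAt (by simp)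
    have h2 : mfderiv I 𝓘(ℝ, E') f x = fderiv ℝ g (φ x) := by
      rw [h1.mfderiv, I.range_eq_univ, fderivWithin_univ]
      rfl
    rw [h2] at hinj
    exact hinj
  obtain ⟨e, he⟩ := exists_equiv_of_injective (F := F) hdim (fderiv ℝ g (φ x)) hder
  -- Thickening `g` by directions complementary to the image of its derivative produces a map with
  -- invertible derivative `e`; the local inverse of `Φ` flattens the image of `f` to `E × 0`.
  set Φ : E × F → E' := fun q => g q.1 + e (0, q.2)
  have hΦd : HasFDerivAt Φ (e : (E × F) →L[ℝ] E') (φ x, 0) := by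
    have h1 : HasFDerivAt (fun q : E × F => g q.1)
        ((fderiv ℝ g (φ x)).comp (ContinuousLinearMap.fst ℝ E F)) (φ x, 0) :=
      HasFDerivAt.comp (g := g) (f := Prod.fst) (φ x, (0 : F)) hgd hasFDerivAt_fst
    have h2 : HasFDerivAt (fun q : E × F => e (0, q.2))
        ((e : (E × F) →L[ℝ] E').comp ((ContinuousLinearMap.inr ℝ E F).comp
          (ContinuousLinearMap.snd ℝ E F))) (φ x, 0) :=
      ((e : (E × F) →L[ℝ] E').comp ((ContinuousLinearMap.inr ℝ E F).comp
          (ContinuousLinearMap.snd ℝ E F))).hasFDerivAt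
    refine (h1.add h2).congr_fderiv ?_
    ext q
    · simp [← he]
    · simp
  have hΦ : ContDiffOn ℝ ∞ Φ (U ×ˢ Set.univ) := by
    refine (hgU.comp contDiff_fst.contDiffOn fun q hq => hq.1).add ?_
    exact (e.contDiff.comp (contDiff_const.prodMk contDiff_snd)).contDiffOn
  obtain ⟨χ, hχx, hχU, hχΦ, hχ1, hχ2⟩ := exists_openPartialHomeomorph_contDiffOn
    (hU.prod isOpen_univ) hΦ (show (φ x, (0 : F)) ∈ U ×ˢ Set.univ from ⟨hxU, trivial⟩) hΦd
  set V : Set E := {a | (a, (0 : F)) ∈ χ.source}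
  have hV : IsOpen V := χ.open_source.preimage (by fun_prop : Continuous fun a : E => (a, (0 : F)))
  set s : Set L := φ.source ∩ φ ⁻¹' V
  have hs : IsOpen s := isOpen_extChartAt_preimage' x hV
  set codChart : OpenPartialHomeomorph M E' :=
    (ψ.trans χ.symm).trans e.toHomeomorph.toOpenPartialHomeomorph
  have hcs : ∀ q, q ∈ codChart.source ↔ q ∈ ψ.source ∧ ψ q ∈ χ.target := fun q => by
    simp [codChart]
  have hmaps : ∀ y ∈ s, f y ∈ codChart.source := by
    intro y hy
    have hyU := (hχU hy.2).1
    have h0 : φ.symm (φ y) = y := φ.left_inv hy.1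
    have h1 : f y ∈ ψ.source := by
      have := hyU.2
      rwa [Set.mem_preimage, h0] at this
    have h2 : ψ (f y) = χ (φ y, 0) := by
      have e0 : e (0, 0) = 0 := e.map_zero
      simp only [hχΦ, Φ, g, Function.comp_apply, h0, e0, add_zero]
    exact (hcs _).mpr ⟨h1, h2 ▸ χ.map_source hy.2⟩
  refine Manifold.IsImmersionAtOfComplement.mk_of_charts e ((chartAt H x).restr s) codChart
    ?_ (hmaps x ⟨mem_extChartAt_source x, hχx⟩) ?_ ?_ ?_ ?_
  · rw [OpenPartialHomeomorph.restr_source, hs.interior_eq]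
    exact ⟨mem_chart_source H x, mem_extChartAt_source x, hχx⟩
  · exact restr_mem_maximalAtlas _ (IsManifold.chart_mem_maximalAtlas x) hs
  · refine OpenPartialHomeomorph.mem_maximalAtlas_of_contMDiffOn _ ?_ ?_
    · intro q hq
      have hq' := (hcs q).mp hq
      have h1 : ContMDiffAt 𝓘(ℝ, E') 𝓘(ℝ, E') ∞ ψ q := contMDiffAt_of_mem_maximalAtlas
        (IsManifold.chart_mem_maximalAtlas _) hq'.1
      have h2 : ContDiffAt ℝ ∞ (e ∘ χ.symm) (ψ q) :=
        e.contDiff.contDiffAt.comp _ (hχ2.contDiffAt (χ.open_target.mem_nhds hq'.2))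
      exact (h2.contMDiffAt.comp q h1).contMDiffWithinAt
    · intro z hz
      have hz' : e.symm z ∈ χ.source ∧ χ (e.symm z) ∈ ψ.target := by
        simpa [codChart] using hz
      have h1 : ContMDiffAt 𝓘(ℝ, E') 𝓘(ℝ, E') ∞ ψ.symm (χ (e.symm z)) :=
        contMDiffAt_symm_of_mem_maximalAtlas (IsManifold.chart_mem_maximalAtlas _) hz'.2
      have h2 : ContDiffAt ℝ ∞ (χ ∘ e.symm) z :=
        (hχ1.contDiffAt (χ.open_source.mem_nhds hz'.1)).comp _ e.symm.contDiff.contDiffAt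
      exact (h1.comp z h2.contMDiffAt).contMDiffWithinAt
  · rw [OpenPartialHomeomorph.restr_source, hs.interior_eq]
    exact fun y hy => hmaps y hy.2
  · intro y hy
    have hy1 : φ.symm y ∈ ((chartAt H x).restr s).source := by
      have := (((chartAt H x).restr s).extend I).map_target hy
      rwa [OpenPartialHomeomorph.extend_source] at this
    rw [OpenPartialHomeomorph.restr_source, hs.interior_eq] at hy1
    have hy2 : y ∈ φ.target := by
      have h1 := (((chartAt H x).restr s).extend I).right_inv hy
      have h2 : φ (φ.symm y) = y := h1
      rw [← h2]
      exact φ.map_source hy1.2.1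
    have hy3 : (y, (0 : F)) ∈ χ.source := by
      have := hy1.2.2
      rwa [Set.mem_preimage, φ.right_inv hy2] at this
    have h4 : ψ (f (φ.symm y)) = χ (y, 0) := by
      have e0 : e (0, 0) = 0 := e.map_zero
      simp only [hχΦ, Φ, g, Function.comp_apply, e0, add_zero]
    change e (χ.symm (ψ (f (φ.symm y)))) = e (y, 0)
    rw [h4, χ.left_inv hy3]

theorem mfderiv_injective_of_eventually_leftInverse {E E' H : Type*}
    [NormedAddCommGroup E] [NormedSpace ℝ E] [NormedAddCommGroup E'] [NormedSpace ℝ E']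
    [TopologicalSpace H] {J : ModelWithCorners ℝ E' H} {M : Type*} [TopologicalSpace M]
    [ChartedSpace H M] {ι : E → M} {f : M → E} {y : E} (hι : MDifferentiableAt 𝓘(ℝ, E) J ι y)
    (hf : MDifferentiableAt J 𝓘(ℝ, E) f (ι y)) (h : ∀ᶠ z in 𝓝 y, f (ι z) = z) :
    Function.Injective (mfderiv 𝓘(ℝ, E) J ι y) := by
  have h1 : mfderiv 𝓘(ℝ, E) 𝓘(ℝ, E) (f ∘ ι) y = ContinuousLinearMap.id ℝ E := by
    have h2 : (f ∘ ι) =ᶠ[𝓝 y] id := h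
    rw [h2.mfderiv_eq]
    exact mfderiv_id
  rw [mfderiv_comp y hf hι] at h1
  intro a b hab
  have ha := DFunLike.congr_fun h1 a
  have hb := DFunLike.congr_fun h1 b
  have : (mfderiv J 𝓘(ℝ, E) f (ι y)) (mfderiv 𝓘(ℝ, E) J ι y a) =
    (mfderiv J 𝓘(ℝ, E) f (ι y)) (mfderiv 𝓘(ℝ, E) J ι y b) := by rw [hab]
  exact ha.symm.trans (this.trans hb)

/-! ### Slice charts and regular level sets. -/

section LevelSet

variable {E₁ : Type*} {E' : Type u} {F : Type*}
  [NormedAddCommGroup E₁] [NormedSpace ℝ E₁] [NormedAddCommGroup E'] [NormedSpace ℝ E']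
  [NormedAddCommGroup F] [NormedSpace ℝ F]
  {M : Type*} [TopologicalSpace M] [ChartedSpace E' M]

variable (E') in
/-- A smooth chart `χ` in which the subset `S` is the slice `χ₂ = 0`. -/
structure IsSliceChart (S : Set M) (χ : OpenPartialHomeomorph M (E₁ × F)) : Prop where
  contMDiffOn : ContMDiffOn 𝓘(ℝ, E') 𝓘(ℝ, E₁ × F) ∞ χ χ.source
  contMDiffOn_symm : ContMDiffOn 𝓘(ℝ, E₁ × F) 𝓘(ℝ, E') ∞ χ.symm χ.target
  mem_iff : ∀ q ∈ χ.source, q ∈ S ↔ (χ q).2 = 0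

/-- A linear isomorphism whose second component is the differential of `Φ` supplies the missing
coordinates: its first component, paired with `Φ`, has invertible derivative, and in the resulting
chart `Φ` is a coordinate. -/
theorem exists_isSliceChart [IsManifold 𝓘(ℝ, E') ∞ M] [FiniteDimensional ℝ E₁]
    [FiniteDimensional ℝ E'] [FiniteDimensional ℝ F]
    (hdim : Module.finrank ℝ E' = Module.finrank ℝ E₁ + Module.finrank ℝ F)
    {S U : Set M} (hU : IsOpen U) {p : M} (hp : p ∈ U) {Φ : M → F}
    (hΦ : ContMDiffOn 𝓘(ℝ, E') 𝓘(ℝ, F) ∞ Φ U)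
    (hsurj : Function.Surjective (mfderiv 𝓘(ℝ, E') 𝓘(ℝ, F) Φ p))
    (hmem : ∀ q ∈ U, q ∈ S ↔ Φ q = 0) :
    ∃ χ : OpenPartialHomeomorph M (E₁ × F), p ∈ χ.source ∧ IsSliceChart E' S χ := by
  set ψ := chartAt E' p
  set h : E' → F := Φ ∘ ψ.symm
  set W : Set E' := ψ.target ∩ ψ.symm ⁻¹' U
  have hW : IsOpen W := ψ.isOpen_inter_preimage_symm hU
  have hpW : ψ p ∈ W := ⟨mem_chart_target E' p, by simpa [ψ] using hp⟩
  have hψ : ψ ∈ IsManifold.maximalAtlas 𝓘(ℝ, E') ∞ M := IsManifold.chart_mem_maximalAtlas p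
  have hh : ContDiffOn ℝ ∞ h W := by
    rw [← contMDiffOn_iff_contDiffOn]
    exact hΦ.comp ((contMDiffOn_symm_of_mem_maximalAtlas hψ).mono Set.inter_subset_left)
      fun z hz => hz.2
  have hhd : HasFDerivAt h (fderiv ℝ h (ψ p)) (ψ p) :=
    ((hh.contDiffAt (hW.mem_nhds hpW)).differentiableAt (by simp)).hasFDerivAt
  have hsurj' : Function.Surjective (fderiv ℝ h (ψ p)) := by
    have h1 : MDifferentiableAt 𝓘(ℝ, E') 𝓘(ℝ, F) Φ p :=
      (hΦ.contMDiffAt (hU.mem_nhds hp)).mdifferentiableAt (by simp)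
    have h2 : mfderiv 𝓘(ℝ, E') 𝓘(ℝ, F) Φ p = fderiv ℝ h (ψ p) := by
      rw [h1.mfderiv, ModelWithCorners.range_eq_univ, fderivWithin_univ]
      rfl
    rw [h2] at hsurj
    exact hsurj
  obtain ⟨e, he⟩ := exists_equiv_of_surjective (E := E₁) hdim _ hsurj'
  have hg : ContDiffOn ℝ ∞ (fun z => ((e z).1, h z)) W :=
    (contDiff_fst.comp e.contDiff).contDiffOn.prodMk hh
  have hgd : HasFDerivAt (fun z => ((e z).1, h z)) (e : E' →L[ℝ] E₁ × F) (ψ p) := by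
    have h1 : HasFDerivAt (fun z => (e z).1)
        ((ContinuousLinearMap.fst ℝ E₁ F).comp (e : E' →L[ℝ] E₁ × F)) (ψ p) :=
      ((ContinuousLinearMap.fst ℝ E₁ F).comp (e : E' →L[ℝ] E₁ × F)).hasFDerivAt
    refine (h1.prodMk hhd).congr_fderiv ?_
    ext a
    · rfl
    · simp [he]
  obtain ⟨χ, hχx, hχU, hχΦ, hχ1, hχ2⟩ := exists_openPartialHomeomorph_contDiffOn hW hg hpW hgd
  refine ⟨ψ.trans χ, ?_, ?_, ?_, ?_⟩
  · simpa [ψ] using hχx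
  · intro q hq
    rw [OpenPartialHomeomorph.trans_source] at hq
    exact ((hχ1.contDiffAt (χ.open_source.mem_nhds hq.2)).contMDiffAt.comp q
      (contMDiffAt_of_mem_maximalAtlas hψ hq.1)).contMDiffWithinAt
  · intro z hz
    rw [OpenPartialHomeomorph.trans_target] at hz
    exact (((contMDiffAt_symm_of_mem_maximalAtlas hψ hz.2).comp z
      (hχ2.contDiffAt (χ.open_target.mem_nhds hz.1)).contMDiffAt)).contMDiffWithinAt
  · intro q hq
    rw [OpenPartialHomeomorph.trans_source] at hq
    have h1 : ψ.symm (ψ q) = q := ψ.left_inv hq.1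
    have h2 : q ∈ U := by
      have := (hχU hq.2).2
      rwa [Set.mem_preimage, h1] at this
    rw [hmem q h2, OpenPartialHomeomorph.coe_trans, Function.comp_apply, hχΦ]
    simp only [h, Function.comp_apply, h1]

open scoped Classical in
/-- The chart of `S` induced by a slice chart. -/
def IsSliceChart.chart {S : Set M} {χ : OpenPartialHomeomorph M (E₁ × F)} (hχ : IsSliceChart E' S χ)
    (p : S) : OpenPartialHomeomorph S E₁ where
  toFun q := (χ q).1
  -- Off the target the value is irrelevant; `p` serves only as some point of `S`.
  invFun a := if h : (a, (0 : F)) ∈ χ.target then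
    ⟨χ.symm (a, 0), (hχ.mem_iff _ (χ.map_target h)).mpr (by rw [χ.right_inv h])⟩ else p
  source := Subtype.val ⁻¹' χ.source
  target := {a | (a, (0 : F)) ∈ χ.target}
  map_source' q hq := by
    have h1 : ((χ q).1, (0 : F)) = χ q := Prod.ext rfl ((hχ.mem_iff _ hq).mp q.2).symm
    exact h1 ▸ χ.map_source hq
  map_target' a ha := by
    have ha' : (a, (0 : F)) ∈ χ.target := ha
    simp only [dif_pos ha']
    exact χ.map_target ha'
  left_inv' q hq := by
    have h1 : ((χ q).1, (0 : F)) = χ q := Prod.ext rfl ((hχ.mem_iff _ hq).mp q.2).symm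
    have h2 : ((χ q).1, (0 : F)) ∈ χ.target := h1 ▸ χ.map_source hq
    simp only [dif_pos h2]
    apply Subtype.ext
    simp only [h1]
    exact χ.left_inv hq
  right_inv' a ha := by
    have ha' : (a, (0 : F)) ∈ χ.target := ha
    simp only [dif_pos ha', χ.right_inv ha']
  open_source := χ.open_source.preimage continuous_subtype_val
  open_target := χ.open_target.preimage (by fun_prop : Continuous fun a : E₁ => (a, (0 : F)))
  continuousOn_toFun := continuous_fst.comp_continuousOn
    (χ.continuousOn.comp continuous_subtype_val.continuousOn fun _ h => h)
  continuousOn_invFun := by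
    rw [Topology.IsInducing.subtypeVal.continuousOn_iff]
    refine (χ.continuousOn_symm.comp (by fun_prop : Continuous fun a : E₁ =>
      (a, (0 : F))).continuousOn fun a h => h).congr fun a ha => ?_
    have ha' : (a, (0 : F)) ∈ χ.target := ha
    simp [ha']

open scoped Classical in
theorem IsSliceChart.chart_symm {S : Set M} {χ : OpenPartialHomeomorph M (E₁ × F)}
    (hχ : IsSliceChart E' S χ) (p : S) {a : E₁} (ha : a ∈ (hχ.chart p).target) :
    ((hχ.chart p).symm a : M) = χ.symm (a, 0) := by
  have ha' : (a, (0 : F)) ∈ χ.target := ha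
  change ((if h : (a, (0 : F)) ∈ χ.target then
    ⟨χ.symm (a, 0), (hχ.mem_iff _ (χ.map_target h)).mpr (by rw [χ.right_inv h])⟩ else p : S) : M) =
      _
  rw [dif_pos ha']

/-- The regular level set theorem. -/
theorem exists_chartedSpace_of_levelSet [IsManifold 𝓘(ℝ, E') ∞ M] [FiniteDimensional ℝ E₁]
    [FiniteDimensional ℝ E'] [FiniteDimensional ℝ F]
    (hdim : Module.finrank ℝ E' = Module.finrank ℝ E₁ + Module.finrank ℝ F) {S : Set M}
    (hS : ∀ p ∈ S, ∃ U : Set M, IsOpen U ∧ p ∈ U ∧ ∃ Φ : M → F,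
      ContMDiffOn 𝓘(ℝ, E') 𝓘(ℝ, F) ∞ Φ U ∧
      Function.Surjective (mfderiv 𝓘(ℝ, E') 𝓘(ℝ, F) Φ p) ∧ ∀ q ∈ U, q ∈ S ↔ Φ q = 0) :
    ∃ _ : ChartedSpace E₁ S, IsManifold 𝓘(ℝ, E₁) ∞ S ∧
      Manifold.IsSmoothEmbedding 𝓘(ℝ, E₁) 𝓘(ℝ, E') ∞ (Subtype.val : S → M) ∧
      ∀ (p : S), ∀ y ∈ (chartAt E₁ p).target, Function.Injective
        (mfderiv 𝓘(ℝ, E₁) 𝓘(ℝ, E') (fun y => ((chartAt E₁ p).symm y : M)) y) := by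
  have hex : ∀ p : S, ∃ χ : OpenPartialHomeomorph M (E₁ × F), (p : M) ∈ χ.source ∧
      IsSliceChart E' S χ := by
    rintro ⟨p, hp⟩
    obtain ⟨U, hU, hpU, Φ, hΦ, hs, hm⟩ := hS p hp
    exact exists_isSliceChart hdim hU hpU hΦ hs hm
  choose χ hχp hχ using hex
  let cs : ChartedSpace E₁ S :=
    { atlas := Set.range fun p => (hχ p).chart p
      chartAt := fun p => (hχ p).chart p
      mem_chart_source := fun p => hχp p
      chart_mem_atlas := fun p => ⟨p, rfl⟩ }
  have hman : IsManifold 𝓘(ℝ, E₁) ∞ S := by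
    apply isManifold_of_contDiffOn
    rintro _ _ ⟨p, rfl⟩ ⟨q, rfl⟩
    simp only [modelWithCornersSelf_coe, modelWithCornersSelf_coe_symm, Function.comp_id,
      Function.id_comp, Set.range_id, Set.inter_univ, Set.preimage_id]
    intro a ha
    rw [OpenPartialHomeomorph.trans_source] at ha
    have ha1 : (a, (0 : F)) ∈ (χ p).target := ha.1
    have ha2 : (χ p).symm (a, 0) ∈ (χ q).source := by
      rw [← (hχ p).chart_symm p ha.1]
      exact ha.2
    have h1 : ContMDiffAt 𝓘(ℝ, E₁ × F) 𝓘(ℝ, E₁ × F) ∞ (χ q ∘ (χ p).symm) (a, 0) :=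
      ((hχ q).contMDiffOn.contMDiffAt ((χ q).open_source.mem_nhds ha2)).comp _
        ((hχ p).contMDiffOn_symm.contMDiffAt ((χ p).open_target.mem_nhds ha1))
    have h1' : ContDiffAt ℝ ∞ (χ q ∘ (χ p).symm) (a, 0) := h1.contDiffAt
    have h2 : ContDiffAt ℝ ∞ (fun a : E₁ => ((χ q ∘ (χ p).symm) (a, 0)).1) a :=
      contDiff_fst.contDiffAt.comp a (ContDiffAt.comp (g := χ q ∘ (χ p).symm) a h1'
        (contDiff_id.prodMk contDiff_const).contDiffAt)
    refine ContDiffWithinAt.congr h2.contDiffWithinAt ?_ ?_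
    · intro b hb
      rw [OpenPartialHomeomorph.trans_source] at hb
      change (χ q (((hχ p).chart p).symm b : M)).1 = _
      rw [(hχ p).chart_symm p hb.1]
      rfl
    · change (χ q (((hχ p).chart p).symm a : M)).1 = _
      rw [(hχ p).chart_symm p ha.1]
      rfl
  refine ⟨cs, hman, ⟨?_, Topology.IsEmbedding.subtypeVal⟩, ?_⟩
  · let e : (E₁ × F) ≃L[ℝ] E' := (LinearEquiv.ofFinrankEq _ _ (by simp [hdim])).toContinuousLinearEquiv
    refine Manifold.IsImmersionOfComplement.isImmersion (F := F) fun p => ?_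
    refine Manifold.IsImmersionAtOfComplement.mk_of_charts e ((hχ p).chart p)
      ((χ p).trans e.toHomeomorph.toOpenPartialHomeomorph) (hχp p) ?_
      (IsManifold.chart_mem_maximalAtlas p) ?_ ?_ ?_
    · simpa using hχp p
    · refine OpenPartialHomeomorph.mem_maximalAtlas_of_contMDiffOn _ ?_ ?_
      · intro q hq
        have hq' : q ∈ (χ p).source := by simpa using hq
        exact (e.contDiff.contMDiff.contMDiffAt.comp q
          ((hχ p).contMDiffOn.contMDiffAt ((χ p).open_source.mem_nhds hq'))).contMDiffWithinAt
      · intro z hz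
        have hz' : e.symm z ∈ (χ p).target := by simpa using hz
        exact (((hχ p).contMDiffOn_symm.contMDiffAt ((χ p).open_target.mem_nhds hz')).comp z
          e.symm.contDiff.contMDiff.contMDiffAt).contMDiffWithinAt
    · intro q hq
      have hq' : (q : M) ∈ (χ p).source := hq
      simpa using hq'
    · intro a ha
      have ha' : a ∈ ((hχ p).chart p).target := by simpa using ha
      have ha1 : (a, (0 : F)) ∈ (χ p).target := ha'
      change e (χ p (((hχ p).chart p).symm a : M)) = e (a, 0)
      rw [(hχ p).chart_symm p ha', (χ p).right_inv ha1]
  · intro p y hy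
    have hy' : (y, (0 : F)) ∈ (χ p).target := hy
    have hev : (fun y => (((hχ p).chart p).symm y : M)) =ᶠ[𝓝 y] fun y => (χ p).symm (y, 0) := by
      filter_upwards [((hχ p).chart p).open_target.mem_nhds hy] with a ha
      exact (hχ p).chart_symm p ha
    change Function.Injective
      (mfderiv 𝓘(ℝ, E₁) 𝓘(ℝ, E') (fun y => (((hχ p).chart p).symm y : M)) y)
    rw [hev.mfderiv_eq]
    have h1 : ContMDiffAt 𝓘(ℝ, E₁ × F) 𝓘(ℝ, E') ∞ (χ p).symm (y, 0) :=
      (hχ p).contMDiffOn_symm.contMDiffAt ((χ p).open_target.mem_nhds hy')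
    have h2 : ContMDiffAt 𝓘(ℝ, E') 𝓘(ℝ, E₁ × F) ∞ (χ p) ((χ p).symm (y, 0)) :=
      (hχ p).contMDiffOn.contMDiffAt ((χ p).open_source.mem_nhds ((χ p).map_target hy'))
    have h3 : ContMDiffAt 𝓘(ℝ, E₁) 𝓘(ℝ, E') ∞ (fun a => (χ p).symm (a, 0)) y :=
      h1.comp y (contDiff_id.prodMk contDiff_const).contDiffAt.contMDiffAt
    -- The first component of the ambient slice chart is a smooth left inverse of the
    -- parametrization, whose differential is therefore injective.
    have h4 : ContMDiffAt 𝓘(ℝ, E') 𝓘(ℝ, E₁) ∞ (fun q => (χ p q).1) ((χ p).symm (y, 0)) :=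
      contDiff_fst.contMDiff.contMDiffAt.comp _ h2
    refine mfderiv_injective_of_eventually_leftInverse (h3.mdifferentiableAt (by simp))
      (h4.mdifferentiableAt (by simp)) ?_
    filter_upwards [((hχ p).chart p).open_target.mem_nhds hy] with a ha
    have ha1 : (a, (0 : F)) ∈ (χ p).target := ha
    rw [(χ p).right_inv ha1]

end LevelSet

end DiffTop

/-! ### The weighted Laplacian of a block metric. -/

section BlockLaplacian

variable {E₁ E₂ : Type*} [NormedAddCommGroup E₁] [NormedSpace ℝ E₁]
  [NormedAddCommGroup E₂] [NormedSpace ℝ E₂]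

/-- A positive definite bilinear form on a product for which the factors are orthogonal. -/
structure IsBlockPositive (β : (E₁ × E₂) →ₗ[ℝ] (E₁ × E₂) →ₗ[ℝ] ℝ) : Prop where
  pos : ∀ a, a ≠ 0 → 0 < β a a
  left : ∀ a c, β (a, 0) (0, c) = 0
  right : ∀ a c, β (0, c) (a, 0) = 0

variable {ι : Type*} [Fintype ι] [DecidableEq ι] {b : Module.Basis ι ℝ (E₁ × E₂)}
  {β : (E₁ × E₂) →ₗ[ℝ] (E₁ × E₂) →ₗ[ℝ] ℝ}

theorem IsBlockPositive.det_ne_zero (h : IsBlockPositive β) :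
    (Matrix.of fun i j => β (b i) (b j)).det ≠ 0 := by
  intro h0
  obtain ⟨c, hc, hc0⟩ := Matrix.exists_mulVec_eq_zero_iff.mpr h0
  have h1 : ∑ j, c j • b j ≠ 0 := fun h2 => hc (funext fun j =>
    Fintype.linearIndependent_iff.mp b.linearIndependent c h2 j)
  refine (h.pos _ h1).ne' ?_
  have h2 : ∀ i, β (b i) (∑ j, c j • b j) = 0 := by
    intro i
    have := congrFun hc0 i
    simp only [Matrix.mulVec, dotProduct, Matrix.of_apply, Pi.zero_apply] at this
    simp only [map_sum, map_smul, smul_eq_mul]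
    rw [← this]
    exact Finset.sum_congr rfl fun j _ => mul_comm _ _
  have h3 : β.flip (∑ j, c j • b j) = 0 := b.ext h2
  exact LinearMap.congr_fun h3 _

/-- The coefficients are those of the `β`-gradient `Q` of `l`. Since `l` kills the first factor, `Q`
is orthogonal to it, and the block structure leaves `β (Q.1, 0) (Q.1, 0) = 0`. The basis `b` need
not be adapted to the product, which is why only first components appear. -/
theorem IsBlockPositive.sum_inv_mul (h : IsBlockPositive β) {l : (E₁ × E₂) →ₗ[ℝ] ℝ}
    (hl : ∀ a, l (a, 0) = 0) :
    ∑ i, (∑ j, (Matrix.of fun i j => β (b i) (b j))⁻¹ i j * l (b j)) • (b i).1 = 0 := by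
  set g : Matrix ι ι ℝ := Matrix.of fun i j => β (b i) (b j)
  have hg : IsUnit g.det := isUnit_iff_ne_zero.mpr h.det_ne_zero
  set q : ι → ℝ := g⁻¹.mulVec fun j => l (b j)
  set Q := ∑ i, q i • b i
  have h1 : g.mulVec q = fun j => l (b j) := by
    rw [Matrix.mulVec_mulVec, Matrix.mul_nonsing_inv _ hg, Matrix.one_mulVec]
  have h2 : ∀ a, β a Q = l a := by
    have : β.flip Q = l := b.ext fun k => by
      have := congrFun h1 k
      simp only [Matrix.mulVec, dotProduct] at this
      rw [LinearMap.flip_apply, ← this]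
      simp only [Q, map_sum, map_smul, smul_eq_mul]
      exact Finset.sum_congr rfl fun j _ => mul_comm _ _
    exact fun a => LinearMap.congr_fun this a
  have h3 : β (Q.1, 0) (Q.1, 0) = 0 := by
    have h4 : β (Q.1, 0) ((Q.1, 0) + (0, Q.2)) = 0 := by
      rw [show ((Q.1, 0) + (0, Q.2) : E₁ × E₂) = Q by simp, h2, hl]
    rwa [map_add, h.left, add_zero] at h4
  have h5 : Q.1 = 0 := by
    by_contra hne
    exact (h.pos (Q.1, 0) (fun h6 => hne (congrArg Prod.fst h6))).ne' h3
  have h6 : Q.1 = ∑ i, q i • (b i).1 := by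
    simp only [Q, Prod.fst_sum, Prod.smul_fst]
  rw [← h5, h6]
  rfl

/-- Symmetry of `β` is not assumed; the transposed sum is the previous one for the flipped form,
whose Gram matrix is the transpose. -/
theorem IsBlockPositive.sum_mul_inv (h : IsBlockPositive β) {l : (E₁ × E₂) →ₗ[ℝ] ℝ}
    (hl : ∀ a, l (a, 0) = 0) :
    ∑ j, (∑ i, (Matrix.of fun i j => β (b i) (b j))⁻¹ i j * l (b i)) • (b j).1 = 0 := by
  have h' : IsBlockPositive β.flip := ⟨h.pos, fun a c => h.right a c, fun a c => h.left a c⟩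
  have h1 := h'.sum_inv_mul (b := b) hl
  have h2 : (Matrix.of fun i j => β.flip (b i) (b j)) =
    (Matrix.of fun i j => β (b i) (b j)).transpose := rfl
  rw [h2, ← Matrix.transpose_nonsing_inv] at h1
  exact h1

omit [DecidableEq ι] in
-- A divergence in a basis not adapted to the product. The field `∑ G i • b i` has no first
-- component near the point; differentiating this along `E₁` gives an endomorphism of `E₁` equal to
-- zero, and its trace is the divergence, because the `G i` have no derivative along `E₂`.
theorem sum_fderiv_eq_zero [FiniteDimensional ℝ E₁] {G : ι → (E₁ × E₂) → ℝ} {y₀ : E₁ × E₂}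
    {b : ι → E₁ × E₂}
    (hd : ∀ i, DifferentiableAt ℝ (G i) y₀) (hinv : ∀ i c, fderiv ℝ (G i) y₀ (0, c) = 0)
    (hsum : ∀ᶠ y in 𝓝 y₀, ∑ i, G i y • (b i).1 = 0) :
    ∑ i, fderiv ℝ (G i) y₀ (b i) = 0 := by
  have h1 : HasFDerivAt (fun y => ∑ i, G i y • (b i).1)
      (∑ i, (fderiv ℝ (G i) y₀).smulRight (b i).1) y₀ :=
    HasFDerivAt.fun_sum fun i _ => (hd i).hasFDerivAt.smul_const (b i).1
  have h2 : HasFDerivAt (fun y => ∑ i, G i y • (b i).1) (0 : (E₁ × E₂) →L[ℝ] E₁) y₀ :=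
    (hasFDerivAt_const (0 : E₁) y₀).congr_of_eventuallyEq hsum
  have h3 := h1.unique h2
  set A : E₁ →ₗ[ℝ] E₁ := ∑ i, LinearMap.smulRight
    ((fderiv ℝ (G i) y₀ : (E₁ × E₂) →ₗ[ℝ] ℝ).comp (LinearMap.inl ℝ E₁ E₂)) (b i).1
  have hA : A = 0 := by
    ext a
    have := DFunLike.congr_fun h3 (a, 0)
    simpa [A] using this
  have htr : LinearMap.trace ℝ E₁ A = ∑ i, fderiv ℝ (G i) y₀ ((b i).1, 0) := by
    simp only [A, map_sum, LinearMap.trace_smulRight]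
    rfl
  rw [hA, map_zero] at htr
  rw [htr]
  refine Finset.sum_congr rfl fun i _ => ?_
  have h4 : b i = ((b i).1, 0) + (0, (b i).2) := by simp
  conv_lhs => rw [h4, map_add, hinv, add_zero]

theorem fderiv_zero_snd_of_eventually {G : (E₁ × E₂) → ℝ} {U : Set (E₁ × E₂)} (hU : IsOpen U)
    {y₀ : E₁ × E₂} (hy : y₀ ∈ U) (h : ∀ y ∈ U, ∀ y' ∈ U, y.1 = y'.1 → G y = G y') (c : E₂) :
    fderiv ℝ G y₀ (0, c) = 0 := by
  by_cases hd : DifferentiableAt ℝ G y₀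
  · have h1 : HasDerivAt (fun t : ℝ => y₀ + t • ((0, c) : E₁ × E₂)) (0, c) 0 := by
      simpa using ((hasDerivAt_id (0 : ℝ)).smul_const ((0, c) : E₁ × E₂)).const_add y₀
    have h0 : y₀ + (0 : ℝ) • ((0, c) : E₁ × E₂) = y₀ := by simp
    have hd' : HasFDerivAt G (fderiv ℝ G y₀) (y₀ + (0 : ℝ) • ((0, c) : E₁ × E₂)) := by
      rw [h0]; exact hd.hasFDerivAt
    have h2 := hd'.comp_hasDerivAt (0 : ℝ) h1
    have h3 : HasDerivAt (G ∘ fun t : ℝ => y₀ + t • ((0, c) : E₁ × E₂)) 0 0 := by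
      refine (hasDerivAt_const (0 : ℝ) (G y₀)).congr_of_eventuallyEq ?_
      have h4 : ∀ᶠ t in 𝓝 (0 : ℝ), y₀ + t • ((0, c) : E₁ × E₂) ∈ U :=
        h1.continuousAt.eventually_mem (hU.mem_nhds (by rwa [h0]))
      filter_upwards [h4] with t ht
      exact h _ ht _ hy (by simp)
    exact h2.unique h3
  · rw [fderiv_zero_of_not_differentiableAt hd]
    rfl

omit [Fintype ι] in
theorem differentiableAt_inv_apply [Fintype ι] {E : Type*} [NormedAddCommGroup E] [NormedSpace ℝ E]
    {g : E → Matrix ι ι ℝ} {y₀ : E} (hg : ∀ i j, DifferentiableAt ℝ (fun y => g y i j) y₀)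
    (h0 : (g y₀).det ≠ 0) (i j : ι) :
    DifferentiableAt ℝ (fun y => (g y)⁻¹ i j) y₀ ∧
      DifferentiableAt ℝ (fun y => Real.sqrt (g y).det) y₀ := by
  have hdet : ∀ g : E → Matrix ι ι ℝ, (∀ i j, DifferentiableAt ℝ (fun y => g y i j) y₀) →
      DifferentiableAt ℝ (fun y => (g y).det) y₀ := by
    intro g hg
    simp only [Matrix.det_apply]
    refine DifferentiableAt.fun_sum fun s _ => DifferentiableAt.const_smul ?_ _
    exact (HasFDerivAt.finsetProd fun k _ => (hg (s k) k).hasFDerivAt).differentiableAt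
  refine ⟨?_, (hdet g hg).sqrt h0⟩
  have h1 : (fun y => (g y)⁻¹ i j) = fun y => ((g y).det)⁻¹ * (g y).adjugate i j := by
    funext y
    rw [Matrix.inv_def, Matrix.smul_apply, Ring.inverse_eq_inv', smul_eq_mul]
  rw [h1]
  refine ((hdet g hg).inv h0).mul ?_
  simp only [Matrix.adjugate_apply]
  refine hdet _ fun k l => ?_
  by_cases hk : k = j
  · subst hk
    simp
  · simpa [Matrix.updateRow_ne hk] using hg k l

/-- If a metric is a block metric `h₁(y₁) ⊕ h₂(y₁)` on a product chart and does not depend on the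
second variable, `f` does not depend on the second variable and `u` is an affine function of the
second variable, then `Δ_f u = 0`. -/
theorem weightedLaplacian_eq_zero [FiniteDimensional ℝ E₁] [FiniteDimensional ℝ E₂] {H : Type*}
    [TopologicalSpace H] {I : ModelWithCorners ℝ (E₁ × E₂) H} {L : Type*} [TopologicalSpace L]
    [ChartedSpace H L] {h : ∀ x : L, TangentSpace I x → TangentSpace I x → ℝ} {f u : L → ℝ} {x : L}
    {U : Set (E₁ × E₂)} (hU : IsOpen U) (hx : extChartAt I x x ∈ U)
    (β : (E₁ × E₂) → (E₁ × E₂) →ₗ[ℝ] (E₁ × E₂) →ₗ[ℝ] ℝ)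
    (hβ : ∀ y ∈ U, ∀ a b : E₁ × E₂, h ((extChartAt I x).symm y)
      (mfderiv 𝓘(ℝ, E₁ × E₂) I (extChartAt I x).symm y a)
      (mfderiv 𝓘(ℝ, E₁ × E₂) I (extChartAt I x).symm y b) = β y a b)
    (hpos : ∀ y ∈ U, IsBlockPositive (β y))
    (hinv : ∀ y ∈ U, ∀ y' ∈ U, y.1 = y'.1 → ∀ a b, β y a b = β y' a b)
    (hdiff : ∀ a b, DifferentiableAt ℝ (fun y => β y a b) (extChartAt I x x))
    {l : E₂ →L[ℝ] ℝ} {c : ℝ} (hu : ∀ y ∈ U, u ((extChartAt I x).symm y) = l y.2 + c)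
    (hf : ∀ y ∈ U, ∀ y' ∈ U, y.1 = y'.1 →
      f ((extChartAt I x).symm y) = f ((extChartAt I x).symm y')) :
    weightedLaplacian I h f u x = 0 := by
  set b := Module.finBasis ℝ (E₁ × E₂)
  set y₀ := extChartAt I x x
  set l' : (E₁ × E₂) →L[ℝ] ℝ := l.comp (ContinuousLinearMap.snd ℝ E₁ E₂)
  have hl' : ∀ a, (l' : (E₁ × E₂) →ₗ[ℝ] ℝ) (a, 0) = 0 := fun a => by simp [l']
  have hgram : ∀ y ∈ U, gram I h x y = Matrix.of fun i j => β y (b i) (b j) := by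
    intro y hy
    ext i j
    exact hβ y hy _ _
  have hpart : ∀ y ∈ U, ∀ i, partialDeriv I x u i y = l' (b i) := by
    intro y hy i
    have h1 : HasFDerivAt (u ∘ (extChartAt I x).symm) l' y := by
      refine (l'.hasFDerivAt.add_const c).congr_of_eventuallyEq ?_
      filter_upwards [hU.mem_nhds hy] with z hz
      exact hu z hz
    rw [partialDeriv, h1.fderiv]
  -- The field `√det h · ∇u` has no component in the first factor and does not vary along the
  -- second, so it is divergence free.
  have hlap : laplacian I h u x = 0 := by
    rw [laplacian]
    refine mul_eq_zero_of_right _ ?_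
    refine sum_fderiv_eq_zero (b := fun i => b i) (fun i => ?_) (fun i c => ?_) ?_
    · have hcongr : (fun y => Real.sqrt (gram I h x y).det *
          ∑ j, (gram I h x y)⁻¹ i j * partialDeriv I x u j y) =ᶠ[𝓝 y₀]
          fun y => Real.sqrt (Matrix.of fun i j => β y (b i) (b j)).det *
            ∑ j, (Matrix.of fun i j => β y (b i) (b j))⁻¹ i j * l' (b j) := by
        filter_upwards [hU.mem_nhds hx] with y hy
        simp only [hgram y hy, hpart y hy]
      refine DifferentiableAt.congr_of_eventuallyEq ?_ hcongr
      have h2 := differentiableAt_inv_apply (g := fun y => Matrix.of fun i j => β y (b i) (b j))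
        (y₀ := y₀) (fun i j => hdiff (b i) (b j)) (hpos _ hx).det_ne_zero
      exact (h2 i i).2.mul (DifferentiableAt.fun_sum fun j _ => (h2 i j).1.mul_const _)
    · refine fderiv_zero_snd_of_eventually hU hx (fun y hy y' hy' hyy => ?_) c
      have : (Matrix.of fun i j => β y (b i) (b j)) = Matrix.of fun i j => β y' (b i) (b j) := by
        ext i j
        exact hinv y hy y' hy' hyy _ _
      simp only [hgram y hy, hpart y hy, hgram y' hy', hpart y' hy', this]
    · filter_upwards [hU.mem_nhds hx] with y hy
      have h3 := (hpos y hy).sum_inv_mul (b := b) hl'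
      simp only [hgram y hy, hpart y hy, mul_smul, ← Finset.smul_sum]
      exact (congrArg _ h3).trans (smul_zero _)
  -- The gradient of `u` lies in the second factor, along which `f` is constant.
  have hgrad : gradInner I h u f x = 0 := by
    have h3 := (hpos _ hx).sum_mul_inv (b := b) hl'
    have h4 : gradInner I h u f x = fderiv ℝ (f ∘ (extChartAt I x).symm) y₀
        (∑ j, (∑ i, (gram I h x y₀)⁻¹ i j * l' (b i)) • b j) := by
      rw [gradInner, Finset.sum_comm, map_sum]
      refine Finset.sum_congr rfl fun j _ => ?_
      rw [map_smul, smul_eq_mul, Finset.sum_mul]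
      refine Finset.sum_congr rfl fun i _ => ?_
      rw [hpart _ hx]
      rfl
    rw [h4, hgram _ hx]
    set Q := ∑ j, (∑ i, (Matrix.of fun i j => β y₀ (b i) (b j))⁻¹ i j * l' (b i)) • b j
    have h5 : Q.1 = 0 := by
      rw [← h3]
      simp only [Q, Prod.fst_sum, Prod.smul_fst]
      rfl
    rw [show Q = (0, Q.2) from Prod.ext h5 rfl]
    exact fderiv_zero_snd_of_eventually hU hx hf _
  rw [weightedLaplacian, hlap, hgrad, add_zero]

end BlockLaplacian

/-- `W e^{-iα}` is the real number `r`, whose sign is unknown, so only `sin(arg W - α) = 0` follows;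
this is exactly equality modulo `π`. -/
theorem coe_arg_eq_of_eq_mul_exp {W : ℂ} (hW : W ≠ 0) {α r : ℝ}
    (h : W = r * Complex.exp (α * Complex.I)) : (W.arg : AddCircle Real.pi) = (α : ℝ) := by
  have h1 : W * Complex.exp (-(α * Complex.I)) = r := by
    rw [h, mul_assoc, ← Complex.exp_add, add_neg_cancel, Complex.exp_zero, mul_one]
  have h2 : W * Complex.exp (-(α * Complex.I)) =
      ‖W‖ * Complex.exp (((W.arg - α : ℝ) : ℂ) * Complex.I) := by
    conv_lhs => rw [← Complex.norm_mul_exp_arg_mul_I W]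
    rw [mul_assoc, ← Complex.exp_add]
    congr 2
    push_cast
    ring
  have h3 : ‖W‖ * Real.sin (W.arg - α) = 0 := by
    have := congrArg Complex.im (h2.symm.trans h1)
    rw [Complex.im_ofReal_mul, Complex.exp_ofReal_mul_I_im] at this
    simpa using this
  have h4 := (mul_eq_zero.mp h3).resolve_left (norm_ne_zero_iff.mpr hW)
  obtain ⟨k, hk⟩ := Real.sin_eq_zero_iff.mp h4
  rw [← sub_eq_zero, ← AddCircle.coe_sub, AddCircle.coe_eq_zero_iff]
  exact ⟨k, by simpa using hk⟩

/-! ### Nonvanishing of `Ω ∧ Ω̄` for a nonzero `(m, 0)`-form. -/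

section Wedge

variable {m : ℕ}

/-- The projections onto the blocks of `ℂ^m × ℂ^m`. -/
def blockProj (m : ℕ) : (Fin m ⊕ Fin m) → (CE m × CE m) →ₗ[ℂ] (Fin m ⊕ Fin m → ℂ) :=
  Sum.elim
    (fun _ => LinearMap.pi (Sum.elim
      (fun j => (LinearMap.proj j).comp (LinearMap.fst ℂ (CE m) (CE m))) (fun _ => 0)))
    (fun _ => LinearMap.pi (Sum.elim (fun _ => 0)
      (fun j => (LinearMap.proj j).comp (LinearMap.snd ℂ (CE m) (CE m)))))

/-- The product of the determinants of the two blocks of `2m` vectors of `ℂ^m × ℂ^m`. -/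
def blockDet (m : ℕ) : MultilinearMap ℂ (fun _ : Fin m ⊕ Fin m => CE m × CE m) ℂ :=
  (Matrix.detRowAlternating (n := Fin m ⊕ Fin m) (R := ℂ)).toMultilinearMap.compLinearMap
    (blockProj m)

/-- The embedding `X ↦ (X, X̄)`. -/
def conjPair (X : CE m) : CE m × CE m := (X, fun j => starRingEnd ℂ (X j))

theorem blockDet_conjPair (w : Fin m ⊕ Fin m → CE m) :
    blockDet m (fun r => conjPair (w r)) =
      (Matrix.of fun k => w (Sum.inl k)).det *
        starRingEnd ℂ (Matrix.of fun k => w (Sum.inr k)).det := by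
  have h1 : blockDet m (fun r => conjPair (w r)) = (Matrix.fromBlocks
      (Matrix.of fun k => w (Sum.inl k)) 0 0
      ((starRingEnd ℂ).mapMatrix (Matrix.of fun k => w (Sum.inr k)))).det := by
    change Matrix.det _ = _
    congr 1
    ext r c
    rcases r with r | r <;> rcases c with c | c <;> simp [blockProj, conjPair]
  rw [h1, Matrix.det_fromBlocks_zero₂₁, RingHom.map_det]

/-- On this frame only permutations preserving the two blocks contribute, each with its sign
squared. The value counts these permutations, and the identity is one of them. -/
theorem alternatization_blockDet_ne_zero :
    MultilinearMap.alternatization (blockDet m)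
      (Sum.elim (fun j => (Pi.single j 1, 0)) (fun j => (0, Pi.single j 1))) ≠ 0 := by
  set u : Fin m ⊕ Fin m → CE m × CE m :=
    Sum.elim (fun j => (Pi.single j 1, 0)) (fun j => (0, Pi.single j 1))
  have hterm : ∀ s : Equiv.Perm (Fin m ⊕ Fin m), blockDet m (fun r => u (s r)) =
      if ∀ r, (s r).isLeft = r.isLeft then ((Equiv.Perm.sign s : ℤ) : ℂ) else 0 := by
    intro s
    have h0 : blockDet m (fun r => u (s r)) =
      Matrix.det (Matrix.of fun r => blockProj m r (u (s r))) := rfl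
    rw [h0]
    split_ifs with hs
    · rw [← Matrix.det_permutation]
      congr 1
      ext r c
      have hsr := hs r
      rcases r with r | r <;> rcases hq : s _ with q | q <;> rw [hq] at hsr <;>
        rcases c with c | c <;>
        simp_all [u, blockProj, Equiv.Perm.permMatrix, PEquiv.toMatrix_apply,
          Pi.single_apply]
      all_goals exact if_congr eq_comm rfl rfl
    · push Not at hs
      obtain ⟨r, hr⟩ := hs
      refine Matrix.det_eq_zero_of_row_eq_zero r fun c => ?_
      rcases r with r | r <;> rcases hq : s _ with q | q <;> rw [hq] at hr <;>
        rcases c with c | c <;>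
        simp_all [u, blockProj]
  rw [MultilinearMap.alternatization_apply]
  have hsum : ∀ s : Equiv.Perm (Fin m ⊕ Fin m),
      Equiv.Perm.sign s • (blockDet m).domDomCongr s u =
      if ∀ r, (s r).isLeft = r.isLeft then 1 else 0 := by
    intro s
    have h1 : (blockDet m).domDomCongr s u = blockDet m (fun r => u (s r)) := rfl
    rw [h1, hterm]
    split_ifs
    · rw [Units.smul_def, zsmul_eq_mul, ← Int.cast_mul]
      rw [← Units.val_mul, Int.units_mul_self]
      simp
    · simp
  simp only [hsum, Finset.sum_boole]
  have : (1 : Equiv.Perm (Fin m ⊕ Fin m)) ∈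
      (Finset.univ.filter fun s : Equiv.Perm (Fin m ⊕ Fin m) => ∀ r, (s r).isLeft = r.isLeft) := by
    simp
  exact_mod_cast (Finset.card_pos.mpr ⟨_, this⟩).ne'

/-- The pairs `(X, X̄)` span `ℂ^m × ℂ^m` over `ℂ`. If all the sums were zero, the alternatization of
`blockDet` would vanish on such pairs and hence, by complex multilinearity, on the standard frame.
-/
theorem exists_sum_sign_det_ne_zero (m : ℕ) : ∃ w : Fin m ⊕ Fin m → CE m,
    ∑ s : Equiv.Perm (Fin m ⊕ Fin m), ((Equiv.Perm.sign s : ℤ) : ℂ) *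
      ((Matrix.of fun k => w (s (Sum.inl k))).det *
        starRingEnd ℂ (Matrix.of fun k => w (s (Sum.inr k))).det) ≠ 0 := by
  by_contra! hcon
  set A := MultilinearMap.alternatization (blockDet m)
  have hA : ∀ w : Fin m ⊕ Fin m → CE m, A (fun r => conjPair (w r)) = 0 := by
    intro w
    rw [← hcon w, MultilinearMap.alternatization_apply]
    refine Finset.sum_congr rfl fun s _ => ?_
    rw [← blockDet_conjPair (fun r => w (s r)), Units.smul_def, zsmul_eq_mul]
    rfl
  apply alternatization_blockDet_ne_zero (m := m)
  set e : Fin m ⊕ Fin m → CE m := fun r => Pi.single (Sum.elim id id r) 1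
  -- The coefficients come from `(e, 0) = ½(e, e) - (i/2)(ie, -ie)` and `(0, e) = ½(e, e) +
  -- (i/2)(ie, -ie)`.
  set d : Fin m ⊕ Fin m → ℂ := Sum.elim (fun _ => -(Complex.I / 2)) (fun _ => Complex.I / 2)
  have hu : (Sum.elim (fun j => (Pi.single j 1, 0)) (fun j => (0, Pi.single j 1)) :
      Fin m ⊕ Fin m → CE m × CE m) = (fun r => (1 / 2 : ℂ) • conjPair (e r)) +
        fun r => d r • conjPair (Complex.I • e r) := by
    funext r
    rcases r with r | r
    all_goals
      refine Prod.ext (funext fun i => ?_) (funext fun i => ?_)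
      all_goals
        by_cases hi : i = r
        · subst hi
          simp [e, d, conjPair, div_mul_eq_mul_div]
          try norm_num
        · simp [e, d, conjPair, hi]
  rw [hu]
  change A.toMultilinearMap _ = 0
  rw [MultilinearMap.map_add_univ]
  refine Finset.sum_eq_zero fun S _ => ?_
  have hS : S.piecewise (fun r => (1 / 2 : ℂ) • conjPair (e r))
      (fun r => d r • conjPair (Complex.I • e r)) =
      fun r => (if r ∈ S then (1 / 2 : ℂ) else d r) •
        conjPair (if r ∈ S then e r else Complex.I • e r) := by
    funext r
    by_cases hr : r ∈ S <;> simp [hr]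
  rw [hS, MultilinearMap.map_smul_univ]
  change _ • A _ = 0
  rw [hA, smul_zero]

theorem exists_topWedge_sum_ne_zero (D : (CE m) [⋀^Fin m]→ₗ[ℂ] ℂ) (hD : D ≠ 0) :
    ∃ v : Fin (2 * m) → CE m, ∑ s : Equiv.Perm (Fin (2 * m)), ((Equiv.Perm.sign s : ℤ) : ℂ) *
      (D (fun k : Fin m => v (s ⟨k.val, by omega⟩)) *
        (starRingEnd ℂ) (D (fun k : Fin m => v (s ⟨m + k.val, by omega⟩)))) ≠ 0 := by
  obtain ⟨w, hw⟩ := exists_sum_sign_det_ne_zero m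
  set e : Fin m ⊕ Fin m ≃ Fin (2 * m) := finSumFinEquiv.trans (finCongr (by ring))
  set b := Pi.basisFun ℂ (Fin m)
  have hDe : ∀ x, D x = D b * (Matrix.of x).det := by
    intro x
    conv_lhs => rw [D.eq_smul_basis_det b]
    rw [Pi.basisFun_det]
    rfl
  have hDb : D b ≠ 0 := fun h => hD (by ext x; rw [hDe, h, zero_mul]; rfl)
  refine ⟨w ∘ e.symm, ?_⟩
  have hsum : ∑ s : Equiv.Perm (Fin (2 * m)), ((Equiv.Perm.sign s : ℤ) : ℂ) *
      (D (fun k : Fin m => (w ∘ e.symm) (s ⟨k.val, by omega⟩)) *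
        (starRingEnd ℂ) (D (fun k : Fin m => (w ∘ e.symm) (s ⟨m + k.val, by omega⟩)))) =
      (D b * starRingEnd ℂ (D b)) *
      ∑ s : Equiv.Perm (Fin m ⊕ Fin m), ((Equiv.Perm.sign s : ℤ) : ℂ) *
      ((Matrix.of fun k => w (s (Sum.inl k))).det *
        starRingEnd ℂ (Matrix.of fun k => w (s (Sum.inr k))).det) := by
    rw [Finset.mul_sum, ← Equiv.sum_comp e.permCongr]
    refine Finset.sum_congr rfl fun s _ => ?_
    have h1 : ∀ k : Fin m, e.symm (e.permCongr s ⟨k.val, by omega⟩) = s (Sum.inl k) := by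
      intro k
      have : e.symm ⟨k.val, by omega⟩ = Sum.inl k := by
        rw [Equiv.symm_apply_eq]; ext; simp [e]
      simp [Equiv.permCongr_apply, this]
    have h2 : ∀ k : Fin m, e.symm (e.permCongr s ⟨m + k.val, by omega⟩) = s (Sum.inr k) := by
      intro k
      have : e.symm ⟨m + k.val, by omega⟩ = Sum.inr k := by
        rw [Equiv.symm_apply_eq]; ext; simp [e, add_comm]
      simp [Equiv.permCongr_apply, this]
    simp only [Function.comp_apply, h1, h2, Equiv.Perm.sign_permCongr]
    rw [hDe, hDe (fun k => w (s (Sum.inr k))), map_mul]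
    ring
  rw [hsum]
  exact mul_ne_zero (mul_ne_zero hDb ((map_ne_zero _).mpr hDb)) hw

end Wedge

/-! ### Real and complex differentials; forms in holomorphic charts. -/

theorem hasMFDerivAt_real_of_complex {E E' : Type*} [NormedAddCommGroup E] [NormedSpace ℂ E]
    [NormedAddCommGroup E'] [NormedSpace ℂ E'] {M N : Type*} [TopologicalSpace M]
    [ChartedSpace E M] [TopologicalSpace N] [ChartedSpace E' N] {f : M → N} {x : M}
    (hf : MDifferentiableAt 𝓘(ℂ, E) 𝓘(ℂ, E') f x) :
    HasMFDerivAt 𝓘(ℝ, E) 𝓘(ℝ, E') f x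
      (let A : E →L[ℂ] E' := mfderiv 𝓘(ℂ, E) 𝓘(ℂ, E') f x
       (ContinuousLinearMap.restrictScalars ℝ A : E →L[ℝ] E')) := by
  have h := hf.hasMFDerivAt
  refine ⟨h.1, ?_⟩
  have h2 := h.2
  exact HasFDerivWithinAt.restrictScalars ℝ h2

theorem mfderiv_real_apply {E E' : Type*} [NormedAddCommGroup E] [NormedSpace ℂ E]
    [NormedAddCommGroup E'] [NormedSpace ℂ E'] {M N : Type*} [TopologicalSpace M]
    [ChartedSpace E M] [TopologicalSpace N] [ChartedSpace E' N] {f : M → N} {x : M}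
    (hf : MDifferentiableAt 𝓘(ℂ, E) 𝓘(ℂ, E') f x) (a : E) :
    (mfderiv 𝓘(ℝ, E) 𝓘(ℝ, E') f x a : E') = (mfderiv 𝓘(ℂ, E) 𝓘(ℂ, E') f x a : E') := by
  rw [(hasMFDerivAt_real_of_complex hf).mfderiv]
  rfl

section Ambient

variable {m : ℕ} {M : Type*} [TopologicalSpace M] [ChartedSpace (CE m) M]

/-- The tangent vector with coordinates `a` in the chart `e`. -/
def chartVec (e : OpenPartialHomeomorph M (CE m)) (z : CE m) :
    CE m →L[ℝ] TangentSpace 𝓘(ℝ, CE m) (e.symm z) :=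
  mfderiv 𝓘(ℝ, CE m) 𝓘(ℝ, CE m) e.symm z

theorem coeff_eq (omega : BilinField m M) (e : OpenPartialHomeomorph M (CE m)) (a b z : CE m) :
    coeff omega e a b z = omega (e.symm z) (chartVec e z a) (chartVec e z b) := rfl

variable {e : OpenPartialHomeomorph M (CE m)} {z : CE m}

theorem mdifferentiableAt_symm_complex [IsManifold 𝓘(ℂ, CE m) ∞ M]
    (he : e ∈ IsManifold.maximalAtlas 𝓘(ℂ, CE m) ∞ M) (hz : z ∈ e.target) :
    MDifferentiableAt 𝓘(ℂ, CE m) 𝓘(ℂ, CE m) e.symm z :=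
  (contMDiffAt_symm_of_mem_maximalAtlas he hz).mdifferentiableAt (by simp)

theorem mdifferentiableAt_symm_real [IsManifold 𝓘(ℂ, CE m) ∞ M]
    (he : e ∈ IsManifold.maximalAtlas 𝓘(ℂ, CE m) ∞ M) (hz : z ∈ e.target) :
    MDifferentiableAt 𝓘(ℝ, CE m) 𝓘(ℝ, CE m) e.symm z :=
  (hasMFDerivAt_real_of_complex (mdifferentiableAt_symm_complex he hz)).mdifferentiableAt

theorem mdifferentiableAt_real [IsManifold 𝓘(ℂ, CE m) ∞ M]
    (he : e ∈ IsManifold.maximalAtlas 𝓘(ℂ, CE m) ∞ M) {p : M} (hp : p ∈ e.source) :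
    MDifferentiableAt 𝓘(ℝ, CE m) 𝓘(ℝ, CE m) e p := by
  have := (contMDiffAt_of_mem_maximalAtlas he hp).mdifferentiableAt (by simp)
  exact (hasMFDerivAt_real_of_complex this).mdifferentiableAt

theorem chartVec_eq_complex [IsManifold 𝓘(ℂ, CE m) ∞ M]
    (he : e ∈ IsManifold.maximalAtlas 𝓘(ℂ, CE m) ∞ M) (hz : z ∈ e.target) (a : CE m) :
    (chartVec e z a : CE m) = (mfderiv 𝓘(ℂ, CE m) 𝓘(ℂ, CE m) e.symm z a : CE m) :=
  mfderiv_real_apply (mdifferentiableAt_symm_complex he hz) a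

theorem cplxStr_chartVec [IsManifold 𝓘(ℂ, CE m) ∞ M]
    (he : e ∈ IsManifold.maximalAtlas 𝓘(ℂ, CE m) ∞ M) (hz : z ∈ e.target) (a : CE m) :
    cplxStr (e.symm z) (chartVec e z a) = chartVec e z (Complex.I • a) := by
  have h1 := chartVec_eq_complex he hz a
  have h2 := chartVec_eq_complex he hz (Complex.I • a)
  let A : CE m →L[ℂ] CE m := mfderiv 𝓘(ℂ, CE m) 𝓘(ℂ, CE m) e.symm z
  have h3 : A (Complex.I • a) = Complex.I • A a := map_smul _ _ _
  exact (congrArg (fun v : CE m => (Complex.I • v : CE m)) h1).trans (h3.symm.trans h2.symm)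

/-- The coordinates of a tangent vector. -/
theorem exists_chartVec_eq [IsManifold 𝓘(ℂ, CE m) ∞ M]
    (he : e ∈ IsManifold.maximalAtlas 𝓘(ℂ, CE m) ∞ M) (hz : z ∈ e.target)
    (X : TangentSpace 𝓘(ℝ, CE m) (e.symm z)) : ∃ a, chartVec e z a = X := by
  have hp := e.map_target hz
  refine ⟨mfderiv 𝓘(ℝ, CE m) 𝓘(ℝ, CE m) e (e.symm z) X, ?_⟩
  have h0 : MDifferentiableAt 𝓘(ℝ, CE m) 𝓘(ℝ, CE m) e.symm (e (e.symm z)) := by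
    rw [e.right_inv hz]; exact mdifferentiableAt_symm_real he hz
  have h1 := mfderiv_comp (e.symm z) h0 (mdifferentiableAt_real he hp)
  have h2 : e.symm ∘ e =ᶠ[𝓝 (e.symm z)] id := by
    filter_upwards [e.open_source.mem_nhds hp] with q hq
    exact e.left_inv hq
  rw [h2.mfderiv_eq, mfderiv_id] at h1
  have h3 := DFunLike.congr_fun h1 X
  rw [e.right_inv hz] at h3
  exact h3.symm

theorem chartVec_injective [IsManifold 𝓘(ℂ, CE m) ∞ M]
    (he : e ∈ IsManifold.maximalAtlas 𝓘(ℂ, CE m) ∞ M) (hz : z ∈ e.target) :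
    Function.Injective (chartVec e z) := by
  refine mfderiv_injective_of_eventually_leftInverse (mdifferentiableAt_symm_real he hz)
    (mdifferentiableAt_real he (e.map_target hz)) ?_
  filter_upwards [e.open_target.mem_nhds hz] with w hw
  exact e.right_inv hw

/-- The derivative of a map into `M` in terms of its coordinates. -/
theorem mfderiv_eq_chartVec [IsManifold 𝓘(ℂ, CE m) ∞ M]
    (he : e ∈ IsManifold.maximalAtlas 𝓘(ℂ, CE m) ∞ M) {E : Type*} [NormedAddCommGroup E]
    [NormedSpace ℝ E] {τ : E → CE m} {τ' : E →L[ℝ] CE m} {y : E} (hτ : HasFDerivAt τ τ' y)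
    (hy : τ y ∈ e.target) {G : E → M} (hG : ∀ᶠ x in 𝓝 y, G x = e.symm (τ x)) (a : E) :
    MDifferentiableAt 𝓘(ℝ, E) 𝓘(ℝ, CE m) G y ∧
    (mfderiv 𝓘(ℝ, E) 𝓘(ℝ, CE m) G y a : CE m) = (chartVec e (τ y) (τ' a) : CE m) := by
  have h1 : G =ᶠ[𝓝 y] e.symm ∘ τ := hG
  have h2 := mdifferentiableAt_symm_real he hy
  have h3 : MDifferentiableAt 𝓘(ℝ, E) 𝓘(ℝ, CE m) τ y :=
    hτ.differentiableAt.mdifferentiableAt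
  refine ⟨(h2.comp y h3).congr_of_eventuallyEq h1, ?_⟩
  rw [h1.mfderiv_eq, mfderiv_comp y h2 h3, mfderiv_eq_fderiv, hτ.fderiv]
  rfl

/-- Smoothness of `ω` is given only for constant vectors in charts of the atlas. Along `G` the
arguments are expanded in a fixed basis, with coefficients that are smooth because `G` is. The
second part provides the differentiability of the induced metric. -/
theorem contDiffAt_omega_along [IsManifold 𝓘(ℂ, CE m) ∞ M] {omega : BilinField m M}
    (hω : IsKahlerForm omega) {E : Type*} [NormedAddCommGroup E]
    [NormedSpace ℝ E] {G : E → M} {U : Set E} (hU : IsOpen U)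
    (hG : ContMDiffOn 𝓘(ℝ, E) 𝓘(ℝ, CE m) ∞ G U) {y : E} (hy : y ∈ U) (a b : E) :
    ContDiffAt ℝ ∞ (fun y => omega (G y) (mfderiv 𝓘(ℝ, E) 𝓘(ℝ, CE m) G y a)
      (mfderiv 𝓘(ℝ, E) 𝓘(ℝ, CE m) G y b)) y ∧
    ContDiffAt ℝ ∞ (fun y => omega (G y) (mfderiv 𝓘(ℝ, E) 𝓘(ℝ, CE m) G y a)
      (cplxStr (G y) (mfderiv 𝓘(ℝ, E) 𝓘(ℝ, CE m) G y b))) y := by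
  have : IsManifold 𝓘(ℝ, CE m) ∞ M := isManifold_real
  set e := chartAt (CE m) (G y)
  have heR : e ∈ IsManifold.maximalAtlas 𝓘(ℝ, CE m) ∞ M := IsManifold.chart_mem_maximalAtlas _
  have he : e ∈ IsManifold.maximalAtlas 𝓘(ℂ, CE m) ∞ M := IsManifold.chart_mem_maximalAtlas _
  set W := U ∩ G ⁻¹' e.source
  have hW : IsOpen W := hG.continuousOn.isOpen_inter_preimage hU e.open_source
  have hyW : y ∈ W := ⟨hy, mem_chart_source (CE m) (G y)⟩
  set τ : E → CE m := e ∘ G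
  have hτ : ContDiffOn ℝ ∞ τ W := by
    rw [← contMDiffOn_iff_contDiffOn]
    exact (contMDiffOn_of_mem_maximalAtlas heR).comp (hG.mono Set.inter_subset_left) fun x hx => hx.2
  have hfd : ContDiffOn ℝ ∞ (fderiv ℝ τ) W := hτ.fderiv_of_isOpen hW (by simp)
  have hGW : ∀ x ∈ W, G x = e.symm (τ x) := fun x hx => (e.left_inv hx.2).symm
  have hτt : ∀ x ∈ W, τ x ∈ e.target := fun x hx => e.map_source hx.2
  have hder : ∀ x ∈ W, ∀ c, (mfderiv 𝓘(ℝ, E) 𝓘(ℝ, CE m) G x c : CE m) =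
      (chartVec e (τ x) (fderiv ℝ τ x c) : CE m) := fun x hx c =>
    (mfderiv_eq_chartVec he ((hτ.contDiffAt (hW.mem_nhds hx)).differentiableAt
      (by simp)).hasFDerivAt (hτt x hx)
      (by filter_upwards [hW.mem_nhds hx] with x hx using hGW x hx) c).2
  set B := Module.finBasis ℝ (CE m)
  have hexp : ∀ z (v w : CE m), coeff omega e v w z =
      ∑ k, ∑ l, B.repr v k * B.repr w l * coeff omega e (B k) (B l) z := by
    intro z v w
    conv_lhs => rw [coeff_eq, ← B.sum_repr v, ← B.sum_repr w]
    simp only [map_sum, map_smul, sum_apply, smul_apply,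
      smul_eq_mul, Finset.mul_sum, coeff_eq]
    rw [Finset.sum_comm]
    exact Finset.sum_congr rfl fun _ _ => Finset.sum_congr rfl fun _ _ => by ring
  have hrepr : ∀ k, ContDiff ℝ ∞ fun v : CE m => B.repr v k := fun k =>
    (LinearMap.toContinuousLinearMap (B.coord k)).contDiff
  have hmain : ∀ v w : E → CE m, ContDiffOn ℝ ∞ v W → ContDiffOn ℝ ∞ w W →
      ContDiffOn ℝ ∞ (fun x => coeff omega e (v x) (w x) (τ x)) W := by
    intro v w hv hw
    simp only [hexp _ (v _) (w _)]
    refine ContDiffOn.sum fun k _ => ContDiffOn.sum fun l _ => ?_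
    exact (((hrepr k).comp_contDiffOn hv).mul ((hrepr l).comp_contDiffOn hw)).mul
      ((hω.smooth e (chart_mem_atlas _ _) (B k) (B l)).comp hτ hτt)
  have hda : ∀ c : E, ContDiffOn ℝ ∞ (fun x => fderiv ℝ τ x c) W := fun c =>
    hfd.clm_apply contDiffOn_const
  have hcongr : ∀ x ∈ W, ∀ (p : M), p = G x → ∀ v w : CE m,
      (omega (e.symm (τ x)) v w : ℝ) = omega p v w := by
    intro x hx p hp v w
    rw [hp, hGW x hx]
  constructor
  · refine ContDiffAt.congr_of_eventuallyEq
      ((hmain _ _ (hda a) (hda b)).contDiffAt (hW.mem_nhds hyW)) ?_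
    filter_upwards [hW.mem_nhds hyW] with x hx
    rw [coeff_eq]
    refine (hcongr x hx (G x) rfl _ _).symm.trans ?_
    exact congrArg₂ (fun v w : CE m => (omega (e.symm (τ x)) v w : ℝ)) (hder x hx a) (hder x hx b)
  · refine ContDiffAt.congr_of_eventuallyEq
      ((hmain _ _ (hda a) ((hda b).const_smul Complex.I)).contDiffAt (hW.mem_nhds hyW)) ?_
    filter_upwards [hW.mem_nhds hyW] with x hx
    rw [coeff_eq]
    refine (hcongr x hx (G x) rfl _ _).symm.trans ?_
    refine congrArg₂ (fun v w : CE m => (omega (e.symm (τ x)) v w : ℝ)) (hder x hx a) ?_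
    have h1 := cplxStr_chartVec he (hτt x hx) (fderiv ℝ τ x b)
    refine Eq.trans ?_ h1
    exact congrArg (fun w : CE m => (Complex.I • w : CE m)) (hder x hx b)

theorem continuousOn_coeff [IsManifold 𝓘(ℂ, CE m) ∞ M] {omega : BilinField m M}
    (hω : IsKahlerForm omega) (he : e ∈ IsManifold.maximalAtlas 𝓘(ℂ, CE m) ∞ M) (a b : CE m) :
    ContinuousOn (coeff omega e a b) e.target := by
  have : IsManifold 𝓘(ℝ, CE m) ∞ M := isManifold_real
  intro z hz
  exact (contDiffAt_omega_along hω e.open_target (contMDiffOn_symm_of_mem_maximalAtlas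
    (mem_maximalAtlas_real he)) hz a b).1.continuousAt.continuousWithinAt

theorem topForm_apply_chartVec [IsManifold 𝓘(ℂ, CE m) ∞ M] (Ω : TopFormField m M)
    (he : e ∈ IsManifold.maximalAtlas 𝓘(ℂ, CE m) ∞ M) (hz : z ∈ e.target) (a : Fin m → CE m) :
    Ω (e.symm z) (fun i => chartVec e z (a i)) = topCoeff Ω e z * (Matrix.of a).det := by
  set D : (CE m) [⋀^Fin m]→ₗ[ℂ] ℂ := ((Ω (e.symm z)).compContinuousLinearMap
    (mfderiv 𝓘(ℂ, CE m) 𝓘(ℂ, CE m) e.symm z)).toAlternatingMap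
  have h1 : Ω (e.symm z) (fun i => chartVec e z (a i)) = D a := by
    change Ω (e.symm z) _ = Ω (e.symm z) _
    congr 1
    funext i
    exact chartVec_eq_complex he hz (a i)
  rw [h1, D.eq_smul_basis_det (Pi.basisFun ℂ (Fin m)), Pi.basisFun_det]
  have h2 : D (Pi.basisFun ℂ (Fin m)) = topCoeff Ω e z := by
    change Ω (e.symm z) _ = Ω (e.symm z) _
    congr 1
    funext i
    change mfderiv 𝓘(ℂ, CE m) 𝓘(ℂ, CE m) e.symm z (Pi.basisFun ℂ (Fin m) i) = _
    rw [Pi.basisFun_apply]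
  rw [h2]
  rfl

/-- Holomorphy of `Ω` is postulated in the atlas, while toric charts belong to the maximal atlas.
The two coefficients differ by the Jacobian determinant of the transition map; continuity is all
that the density arguments require. -/
theorem continuousOn_topCoeff [IsManifold 𝓘(ℂ, CE m) ∞ M] {Ω : TopFormField m M}
    (hΩ : IsHolomorphicForm Ω) (he : e ∈ IsManifold.maximalAtlas 𝓘(ℂ, CE m) ∞ M) :
    ContinuousOn (topCoeff Ω e) e.target := by
  intro z hz
  set e' := chartAt (CE m) (e.symm z)
  have he' : e' ∈ IsManifold.maximalAtlas 𝓘(ℂ, CE m) ∞ M := IsManifold.chart_mem_maximalAtlas _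
  set W := e.target ∩ e.symm ⁻¹' e'.source
  have hW : IsOpen W := e.isOpen_inter_preimage_symm e'.open_source
  have hzW : z ∈ W := ⟨hz, mem_chart_source (CE m) _⟩
  set τ : CE m → CE m := e' ∘ e.symm
  have hτ : ContDiffOn ℂ ∞ τ W := by
    rw [← contMDiffOn_iff_contDiffOn]
    exact (contMDiffOn_of_mem_maximalAtlas he').comp
      ((contMDiffOn_symm_of_mem_maximalAtlas he).mono Set.inter_subset_left) fun x hx => hx.2
  have hfd : ContinuousOn (fderiv ℂ τ) W := hτ.continuousOn_fderiv_of_isOpen hW (by simp)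
  have hformula : ∀ w ∈ W, topCoeff Ω e w =
      topCoeff Ω e' (τ w) * (Matrix.of fun i => fderiv ℂ τ w (Pi.single i 1)).det := by
    intro w hw
    have hτw : τ w ∈ e'.target := e'.map_source hw.2
    rw [← topForm_apply_chartVec Ω he' hτw]
    have h0 : e.symm w = e'.symm (τ w) := (e'.left_inv hw.2).symm
    have h1 : ∀ i : Fin m, (mfderiv 𝓘(ℂ, CE m) 𝓘(ℂ, CE m) e.symm w (Pi.single i 1 : CE m) : CE m) =
        (chartVec e' (τ w) (fderiv ℂ τ w (Pi.single i 1)) : CE m) := by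
      intro i
      have h2 : e.symm =ᶠ[𝓝 w] e'.symm ∘ τ := by
        filter_upwards [hW.mem_nhds hw] with x hx
        exact (e'.left_inv hx.2).symm
      have h3 : MDifferentiableAt 𝓘(ℂ, CE m) 𝓘(ℂ, CE m) τ w :=
        ((hτ.contDiffAt (hW.mem_nhds hw)).differentiableAt (by simp)).mdifferentiableAt
      rw [h2.mfderiv_eq, mfderiv_comp w (mdifferentiableAt_symm_complex he' hτw) h3,
        mfderiv_eq_fderiv, chartVec_eq_complex he' hτw]
      rfl
    have h4 : ∀ p, p = e.symm w → ∀ v : Fin m → CE m,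
        (Ω (e.symm w) v : ℂ) = Ω p v := by
      rintro p rfl v
      rfl
    rw [topCoeff]
    refine (h4 _ h0.symm _).trans ?_
    exact congrArg (fun v : Fin m → CE m => (Ω (e'.symm (τ w)) v : ℂ)) (funext h1)
  have hcont : ContinuousOn (fun w => topCoeff Ω e' (τ w) *
      (Matrix.of fun i => fderiv ℂ τ w (Pi.single i 1)).det) W := by
    refine ((hΩ e' (chart_mem_atlas _ _)).continuousOn.comp hτ.continuousOn
      fun w hw => e'.map_source hw.2).mul ?_
    refine (Continuous.matrix_det continuous_id).comp_continuousOn ?_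
    exact continuousOn_pi.mpr fun i => hfd.clm_apply continuousOn_const
  exact (((hcont.congr hformula).continuousAt (hW.mem_nhds hzW))).continuousWithinAt

end Ambient

/-! ### The torus action in toric charts. -/

section Toric

variable {m : ℕ} {M : Type*} [TopologicalSpace M] [ChartedSpace (CE m) M]
  [MulAction (Fin m → ℂˣ) M]

namespace ToricChart

variable {base : M} (C : ToricChart m base)

/-- The vector with coordinates `b` in the lattice basis of a toric chart. -/
def combo {R : Type*} [CommRing R] (b : Fin m → R) : Fin m → R := fun i => ∑ j, b j * (C.β j i : R)

/-- The coordinates of a vector in the lattice basis of a toric chart. -/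
def coords {R : Type*} [CommRing R] (v : Fin m → R) : Fin m → R :=
  fun j => ∑ i, v i * (((Matrix.of C.β)⁻¹ i j : ℤ) : R)

theorem combo_eq_vecMul {R : Type*} [CommRing R] (b : Fin m → R) :
    C.combo b = Matrix.vecMul b ((Matrix.of C.β).map (Int.cast : ℤ → R)) := rfl

theorem coords_eq_vecMul {R : Type*} [CommRing R] (b : Fin m → R) :
    C.coords b = Matrix.vecMul b ((Matrix.of C.β)⁻¹.map (Int.cast : ℤ → R)) := rfl

theorem combo_coords {R : Type*} [CommRing R] (v : Fin m → R) : C.combo (C.coords v) = v := by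
  rw [combo_eq_vecMul, coords_eq_vecMul, Matrix.vecMul_vecMul, ← Matrix.map_mul_intCast,
    Matrix.nonsing_inv_mul _ C.unimodular]
  simp

theorem coords_combo {R : Type*} [CommRing R] (v : Fin m → R) : C.coords (C.combo v) = v := by
  rw [combo_eq_vecMul, coords_eq_vecMul, Matrix.vecMul_vecMul, ← Matrix.map_mul_intCast,
    Matrix.mul_nonsing_inv _ C.unimodular]
  simp

theorem combo_ofReal (b : Fin m → ℝ) :
    C.combo (fun j => (b j : ℂ)) = fun i => ((C.combo b i : ℝ) : ℂ) := by
  funext i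
  simp [combo]

/-- The coordinates of an element of the Lie algebra of the torus. -/
def lieCoords (v : LieT m) : Fin m → ℝ := C.coords fun i => v i

theorem lieCoords_add (v w : LieT m) : C.lieCoords (v + w) = C.lieCoords v + C.lieCoords w :=
  Matrix.add_vecMul _ _ _

theorem lieCoords_smul (t : ℝ) (v : LieT m) : C.lieCoords (t • v) = t • C.lieCoords v :=
  Matrix.smul_vecMul _ _ _

theorem lieCoords_toLp_combo (b : Fin m → ℝ) : C.lieCoords (WithLp.toLp 2 (C.combo b)) = b :=
  C.coords_combo b

theorem sum_lieCoords_smul (v : LieT m) : v = ∑ j, C.lieCoords v j • intVec (C.β j) := by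
  ext i
  have := congrFun (C.combo_coords fun i => v i) i
  rw [← this]
  simp [combo, intVec, lieCoords]

theorem lieCoords_intVec (j : Fin m) : C.lieCoords (intVec (C.β j)) = Pi.single j 1 := by
  rw [← C.lieCoords_toLp_combo (Pi.single j (1 : ℝ))]
  congr 1
  ext i
  simp [combo, intVec, Pi.single_apply]

theorem contDiff_lieCoords {n : WithTop ℕ∞} (j : Fin m) :
    ContDiff ℝ n fun v : LieT m => C.lieCoords v j := by
  unfold lieCoords coords
  fun_prop

theorem mem_target {z : CE m} : z ∈ C.φ.target ↔ ∀ j, j ∉ C.k → z j ≠ 0 := by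
  rw [C.target_eq]
  rfl

theorem mem_target_of_imp {z w : CE m} (hz : z ∈ C.φ.target) (h : ∀ j, w j = 0 → z j = 0) :
    w ∈ C.φ.target :=
  C.mem_target.mpr fun j hj hw => C.mem_target.mp hz j hj (h j hw)

theorem exp_mul_mem {z : CE m} (hz : z ∈ C.φ.target) (b : CE m) :
    (fun j => Complex.exp (b j) * z j) ∈ C.φ.target :=
  C.mem_target_of_imp hz fun _ hj => by
    simpa [Complex.exp_ne_zero] using hj

/-- The monomial map relating the torus of the chart to the torus acting on `M` is linear on
logarithms, with matrix `β`. -/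
theorem expC_combo_smul {z : CE m} (hz : z ∈ C.φ.target) (b : CE m) :
    expC (C.combo b) • C.φ.symm z = C.φ.symm fun j => Complex.exp (b j) * z j := by
  have h := C.symm_smul (expC b) z hz
  have h1 : (fun i => ∏ j, expC b j ^ C.β j i) = expC (C.combo b) := by
    funext i
    ext
    simp only [Units.coe_prod, Units.val_zpow_eq_zpow_val, expC, Units.val_mk0, combo]
    rw [Complex.exp_sum]
    refine Finset.prod_congr rfl fun j _ => ?_
    rw [← Complex.exp_int_mul, mul_comm]
  rw [h1] at h
  exact h.symm

theorem symm_exp (b : CE m) :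
    C.φ.symm (fun j => Complex.exp (b j)) = expC (C.combo b) • base := by
  have h1 : (fun _ => 1 : CE m) ∈ C.φ.target := C.mem_target.mpr fun _ _ => one_ne_zero
  have := C.expC_combo_smul h1 b
  rw [C.symm_one] at this
  rw [this]
  simp

theorem exp_mem (b : CE m) : (fun j => Complex.exp (b j)) ∈ C.φ.target :=
  C.mem_target.mpr fun _ _ => Complex.exp_ne_zero _

theorem _root_.ToricCY.exists_exp {z : CE m} (hz : ∀ j, z j ≠ 0) : ∃ b : CE m, z = fun j => Complex.exp (b j) :=
  ⟨fun j => Complex.log (z j), funext fun j => (Complex.exp_log (hz j)).symm⟩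

/-- The element `exp(v)` of the torus in the coordinates of the chart. -/
def rot (v : LieT m) : CE m := fun j => Complex.exp (2 * Real.pi * Complex.I * C.lieCoords v j)

theorem expT_eq (v : LieT m) :
    expT v = expC (C.combo fun j => 2 * Real.pi * Complex.I * C.lieCoords v j) := by
  have h1 : (C.combo fun j => 2 * Real.pi * Complex.I * (C.lieCoords v j : ℂ)) =
      fun i => 2 * Real.pi * Complex.I * (v i : ℂ) := by
    have h2 := C.combo_ofReal (C.lieCoords v)
    funext i
    have h3 := congrFun h2 i
    have h4 : C.combo (C.lieCoords v) i = v i := congrFun (C.combo_coords fun i => v i) i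
    rw [h4] at h3
    rw [← h3]
    simp only [combo, Finset.mul_sum, mul_assoc]
  rw [h1]
  rfl

theorem rot_mul_mem {z : CE m} (hz : z ∈ C.φ.target) (v : LieT m) : C.rot v * z ∈ C.φ.target :=
  C.exp_mul_mem hz _

theorem expT_smul_symm {z : CE m} (hz : z ∈ C.φ.target) (v : LieT m) :
    expT v • C.φ.symm z = C.φ.symm (C.rot v * z) := by
  rw [C.expT_eq, C.expC_combo_smul hz]
  rfl

/-- The coordinates of the vector field generated by `v`. -/
def fund (v : LieT m) (z : CE m) : CE m :=
  fun j => 2 * Real.pi * Complex.I * C.lieCoords v j * z j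

theorem hasDerivAt_rot (v w : LieT m) (z : CE m) (t : ℝ) :
    HasDerivAt (fun t : ℝ => C.rot (w + t • v) * z) (C.fund v (C.rot (w + t • v) * z)) t := by
  refine hasDerivAt_pi.mpr fun j => ?_
  simp only [rot, fund, Pi.mul_apply, lieCoords_add, lieCoords_smul, Pi.add_apply, Pi.smul_apply,
    smul_eq_mul]
  have h1 : HasDerivAt (fun t : ℝ => 2 * Real.pi * Complex.I *
      (((C.lieCoords w j + t * C.lieCoords v j : ℝ)) : ℂ))
      (2 * Real.pi * Complex.I * C.lieCoords v j) t := by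
    have h2 : HasDerivAt (fun t : ℝ => C.lieCoords w j + t * C.lieCoords v j)
        (C.lieCoords v j) t := by
      simpa using ((hasDerivAt_id t).mul_const (C.lieCoords v j)).const_add (C.lieCoords w j)
    exact (h2.ofReal_comp).const_mul _
  have h3 := h1.cexp.mul_const (z j)
  convert! h3 using 1
  ring

theorem rot_zero : C.rot 0 = 1 := by
  have h : C.lieCoords 0 = 0 := Matrix.zero_vecMul _
  funext j
  simp [rot, h]

variable [IsManifold 𝓘(ℂ, CE m) ∞ M]

theorem fundVec_symm {z : CE m} (hz : z ∈ C.φ.target) (v : LieT m) :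
    fundVec v (C.φ.symm z) = chartVec C.φ z (C.fund v z) := by
  have h1 := C.hasDerivAt_rot v 0 z 0
  simp only [zero_smul, add_zero, zero_add, C.rot_zero, one_mul] at h1
  have h2 := (mfderiv_eq_chartVec (G := fun t : ℝ => expT (t • v) • C.φ.symm z) C.mem_maximalAtlas
    h1.hasFDerivAt (by simpa [C.rot_zero] using hz)
    (Filter.Eventually.of_forall fun t => C.expT_smul_symm hz _) (1 : ℝ)).2
  have h3 : C.rot ((0 : ℝ) • v) * z = z := by simp [C.rot_zero]
  rw [h3] at h2
  refine Eq.trans h2 ?_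
  simp

omit [IsManifold 𝓘(ℂ, CE m) ∞ M] in
/-- The action of the torus in a toric chart. -/
theorem eventually_expT_smul {p : M} (hp : p ∈ C.φ.source) (v : LieT m) :
    ∀ᶠ q in 𝓝 p, expT v • q = C.φ.symm (C.rot v * C.φ q) := by
  filter_upwards [C.φ.open_source.mem_nhds hp] with q hq
  rw [← C.expT_smul_symm (C.φ.map_source hq), C.φ.left_inv hq]

theorem mdifferentiableAt_expT_smul {p : M} (hp : p ∈ C.φ.source) (v : LieT m) :
    MDifferentiableAt 𝓘(ℝ, CE m) 𝓘(ℝ, CE m) (fun q : M => expT v • q) p := by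
  have h1 := mdifferentiableAt_symm_real C.mem_maximalAtlas
    (C.rot_mul_mem (C.φ.map_source hp) v)
  have h2 : DifferentiableAt ℝ (fun z : CE m => C.rot v * z) (C.φ p) := by fun_prop
  have h3 := h1.comp (C.φ p) h2.mdifferentiableAt
  exact (h3.comp p (mdifferentiableAt_real C.mem_maximalAtlas hp)).congr_of_eventuallyEq
    (C.eventually_expT_smul hp v)

theorem mfderiv_expT_smul {z : CE m} (hz : z ∈ C.φ.target) (v : LieT m) (a : CE m) :
    (mfderiv 𝓘(ℝ, CE m) 𝓘(ℝ, CE m) (fun q : M => expT v • q) (C.φ.symm z) (chartVec C.φ z a) : CE m)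
      = (chartVec C.φ (C.rot v * z) (C.rot v * a) : CE m) := by
  have h1 : HasFDerivAt (fun z : CE m => C.rot v * z)
      (ContinuousLinearMap.mul ℝ (CE m) (C.rot v)) z :=
    (ContinuousLinearMap.mul ℝ (CE m) (C.rot v)).hasFDerivAt
  have h2 := (mfderiv_eq_chartVec (G := fun w => expT v • C.φ.symm w) C.mem_maximalAtlas h1
    (C.rot_mul_mem hz v) (by
      filter_upwards [C.φ.open_target.mem_nhds hz] with w hw
      exact C.expT_smul_symm hw v) a).2
  have h3 := mfderiv_comp z (C.mdifferentiableAt_expT_smul (C.φ.map_target hz) v)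
    (mdifferentiableAt_symm_real C.mem_maximalAtlas hz)
  have h4 := DFunLike.congr_fun h3 a
  exact h4.symm.trans h2

/-- The points `z + ε 1_{j ∈ A, z_j = 0}`, which approach `z` as `ε → 0`. -/
def perturb (A : Set (Fin m)) (z : CE m) (ε : ℝ) : CE m :=
  open scoped Classical in fun j => z j + if j ∈ A ∧ z j = 0 then (ε : ℂ) else 0

end ToricChart

open ToricChart

theorem ToricChart.perturb_ne_zero {A : Set (Fin m)} {z : CE m} {ε : ℝ} (hε : ε ≠ 0) {j : Fin m}
    (hj : j ∈ A ∨ z j ≠ 0) : perturb A z ε j ≠ 0 := by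
  unfold perturb
  by_cases hz : z j = 0
  · simp [hz, hj.resolve_right (not_not.mpr hz), hε]
  · simp [hz]

theorem ToricChart.perturb_apply_of_notMem {A : Set (Fin m)} {z : CE m} {ε : ℝ} {j : Fin m}
    (hj : j ∉ A) : perturb A z ε j = z j := by
  simp [perturb, hj]

theorem ToricChart.perturb_real {A : Set (Fin m)} {z : CE m} {ε : ℝ} (hz : ∀ j, (z j).im = 0)
    (j : Fin m) : (perturb A z ε j).im = 0 := by
  unfold perturb
  split_ifs <;> simp [hz j]

theorem ToricChart.perturb_zero {A : Set (Fin m)} {z : CE m} : perturb A z 0 = z := by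
  funext j
  simp [perturb]

theorem ToricChart.continuous_perturb (A : Set (Fin m)) (z : CE m) : Continuous (perturb A z) := by
  refine continuous_pi fun j => ?_
  unfold perturb
  split_ifs <;> fun_prop

theorem ToricChart.perturb_mem {base : M} (C : ToricChart m base) {A : Set (Fin m)} {z : CE m}
    (hz : z ∈ C.φ.target) (ε : ℝ) : perturb A z ε ∈ C.φ.target := by
  refine C.mem_target.mpr fun j hj => ?_
  have := C.mem_target.mp hz j hj
  simp [perturb, this]

/-- A property which is closed under limits holds at `z` if it holds at the perturbations of `z`. -/
theorem ToricChart.of_perturb {base : M} (C : ToricChart m base) (A : Set (Fin m)) {z : CE m}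
    (hz : z ∈ C.φ.target) {Y : Type*} [TopologicalSpace Y] {f : CE m → Y} {S : Set Y}
    (hS : IsClosed S) (hf : ContinuousOn f C.φ.target)
    (h : ∀ ε : ℝ, ε ≠ 0 → f (perturb A z ε) ∈ S) : f z ∈ S := by
  have h1 : Filter.Tendsto (fun ε : ℝ => f (perturb A z ε)) (𝓝[≠] 0) (𝓝 (f z)) := by
    have h2 : ContinuousAt f (perturb A z 0) := by
      rw [perturb_zero]; exact hf.continuousAt (C.φ.open_target.mem_nhds hz)
    have h3 : ContinuousAt (fun ε : ℝ => f (perturb A z ε)) 0 :=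
      h2.comp (f := perturb A z) (continuous_perturb A z).continuousAt
    have h4 := h3.tendsto.mono_left (nhdsWithin_le_nhds (s := {0}ᶜ))
    rwa [perturb_zero] at h4
  exact hS.mem_of_tendsto h1 (by filter_upwards [self_mem_nhdsWithin] with ε hε using h ε hε)

end Toric

/-! ### Positivity and `J`-invariance in coordinates. -/

section Kahler

variable {m : ℕ} {M : Type*} [TopologicalSpace M] [ChartedSpace (CE m) M]

theorem omega_congr (omega : BilinField m M) {p q : M} (h : p = q) {v w v' w' : CE m}
    (hv : v = v') (hw : w = w') : (omega p v w : ℝ) = omega q v' w' := by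
  subst h hv hw
  rfl

theorem IsKahlerForm.swap {omega : BilinField m M} (hω : IsKahlerForm omega) (p : M)
    (X Y : TangentSpace 𝓘(ℝ, CE m) p) : omega p X Y = -omega p Y X := by
  have h := hω.alternating p (X + Y)
  rw [map_add, map_add, add_apply, add_apply, hω.alternating, hω.alternating] at h
  linarith

theorem coeff_smul_right (omega : BilinField m M) (e : OpenPartialHomeomorph M (CE m))
    (a b z : CE m) (t : ℝ) : coeff omega e a (t • b) z = t * coeff omega e a b z := by
  rw [coeff_eq, map_smul]
  exact map_smul _ _ _

variable [IsManifold 𝓘(ℂ, CE m) ∞ M] {omega : BilinField m M}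
  {e : OpenPartialHomeomorph M (CE m)} {z : CE m}

theorem coeff_I_I (hω : IsKahlerForm omega) (he : e ∈ IsManifold.maximalAtlas 𝓘(ℂ, CE m) ∞ M)
    (hz : z ∈ e.target) (a b : CE m) :
    coeff omega e (Complex.I • a) (Complex.I • b) z = coeff omega e a b z := by
  rw [coeff_eq, coeff_eq, ← cplxStr_chartVec he hz, ← cplxStr_chartVec he hz, hω.compatible]

theorem coeff_I_pos (hω : IsKahlerForm omega) (he : e ∈ IsManifold.maximalAtlas 𝓘(ℂ, CE m) ∞ M)
    (hz : z ∈ e.target) {a : CE m} (ha : a ≠ 0) :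
    0 < coeff omega e a (Complex.I • a) z := by
  rw [coeff_eq, ← cplxStr_chartVec he hz]
  refine hω.positive _ _ fun h => ha ?_
  exact chartVec_injective he hz (h.trans (map_zero _).symm)

end Kahler

/-! ### The moment map, the real form and stabilizers in toric charts. -/

section Toric

variable {m : ℕ} {M : Type*} [TopologicalSpace M] [ChartedSpace (CE m) M]
  [MulAction (Fin m → ℂˣ) M]

namespace ToricKahlerManifold

variable (X : ToricKahlerManifold m M)

/-- The derivative of a component of the moment map along a map into `M`. -/
theorem exists_hasFDerivAt_moment {E : Type*} [NormedAddCommGroup E] [NormedSpace ℝ E] {G : E → M}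
    {y : E} (hG : MDifferentiableAt 𝓘(ℝ, E) 𝓘(ℝ, CE m) G y) (v : LieT m) :
    ∃ A : E →L[ℝ] ℝ, HasFDerivAt (fun y => (inner ℝ (X.μ (G y)) v : ℝ)) A y ∧
      ∀ a, A a = X.omega (G y) (mfderiv 𝓘(ℝ, E) 𝓘(ℝ, CE m) G y a) (fundVec v (G y)) := by
  have h1 : MDifferentiableAt 𝓘(ℝ, CE m) 𝓘(ℝ, ℝ) (fun q : M => (inner ℝ (X.μ q) v : ℝ)) (G y) := by
    have h2 : MDifferentiableAt 𝓘(ℝ, CE m) 𝓘(ℝ, LieT m) X.μ (G y) :=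
      X.μ_smooth.mdifferentiableAt (by simp)
    have h3 : DifferentiableAt ℝ (fun w : LieT m => (inner ℝ w v : ℝ)) (X.μ (G y)) :=
      differentiableAt_id.inner ℝ (differentiableAt_const v)
    exact h3.mdifferentiableAt.comp (G y) h2
  have h4 := h1.comp y hG
  refine ⟨fderiv ℝ (fun y => (inner ℝ (X.μ (G y)) v : ℝ)) y,
    h4.differentiableAt.hasFDerivAt, fun a => ?_⟩
  have h5 := mfderiv_comp y h1 hG
  rw [mfderiv_eq_fderiv] at h5
  exact (DFunLike.congr_fun h5 a).trans (X.μ_moment v (G y) _)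

variable {X} [IsManifold 𝓘(ℂ, CE m) ∞ M] (C : ToricChart m X.base)

theorem exists_hasFDerivAt_moment_symm {z : CE m} (hz : z ∈ C.φ.target) (v : LieT m) :
    ∃ A : CE m →L[ℝ] ℝ, HasFDerivAt (fun z => (inner ℝ (X.μ (C.φ.symm z)) v : ℝ)) A z ∧
      ∀ a, A a = coeff X.omega C.φ a (C.fund v z) z := by
  obtain ⟨A, hA, hA2⟩ := X.exists_hasFDerivAt_moment
    (mdifferentiableAt_symm_real C.mem_maximalAtlas hz) v
  refine ⟨A, hA, fun a => ?_⟩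
  rw [hA2, coeff_eq, C.fundVec_symm hz]
  rfl

theorem hasDerivAt_moment {c : ℝ → CE m} {c' : CE m} {t : ℝ} (hc : HasDerivAt c c' t)
    (ht : c t ∈ C.φ.target) (v : LieT m) :
    HasDerivAt (fun t => (inner ℝ (X.μ (C.φ.symm (c t))) v : ℝ))
      (coeff X.omega C.φ c' (C.fund v (c t)) (c t)) t := by
  obtain ⟨A, hA, hA2⟩ := exists_hasFDerivAt_moment_symm C ht v
  rw [← hA2]
  exact hA.comp_hasDerivAt t hc

theorem continuousOn_moment (v : LieT m) :
    ContinuousOn (fun z => (inner ℝ (X.μ (C.φ.symm z)) v : ℝ)) C.φ.target := by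
  intro z hz
  obtain ⟨A, hA, _⟩ := exists_hasFDerivAt_moment_symm C hz v
  exact hA.continuousAt.continuousWithinAt

/-- Torus orbits are isotropic: `⟨μ, w⟩` is constant along `t ↦ exp(tv)·p`, and this coefficient is
its derivative. -/
theorem coeff_fund_fund {z : CE m} (hz : z ∈ C.φ.target) (v w : LieT m) :
    coeff X.omega C.φ (C.fund v z) (C.fund w z) z = 0 := by
  have h1 := C.hasDerivAt_rot v 0 z 0
  have h0 : C.rot (0 + (0 : ℝ) • v) * z = z := by simp [C.rot_zero]
  have h2 := hasDerivAt_moment C h1 (by rw [h0]; exact hz) w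
  rw [h0] at h2
  have h3 : (fun t : ℝ => (inner ℝ (X.μ (C.φ.symm (C.rot (0 + t • v) * z))) w : ℝ)) =
      fun _ => (inner ℝ (X.μ (C.φ.symm z)) w : ℝ) := by
    funext t
    rw [← C.expT_smul_symm hz, X.μ_invariant]
  rw [h3] at h2
  exact h2.unique (hasDerivAt_const _ _)

/-- The real part of `M` is isotropic. -/
theorem coeff_real_eq_zero {z : CE m} (hz : z ∈ C.φ.target) (hre : ∀ j, (z j).im = 0) {a b : CE m}
    (ha : ∀ j, (a j).im = 0) (hb : ∀ j, (b j).im = 0) : coeff X.omega C.φ a b z = 0 := by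
  -- Over the open orbit `i` times a real vector `a` is tangent to the torus orbit, generated by the
  -- element with coordinates `a_j / (2π z_j)`. Invariance of `ω` under `J` reduces the claim to
  -- isotropy of the orbits.
  have key : ∀ z ∈ C.φ.target, (∀ j, (z j).im = 0) → (∀ j, z j ≠ 0) →
      coeff X.omega C.φ a b z = 0 := by
    intro z hz hre hne
    have hex : ∀ a : CE m, (∀ j, (a j).im = 0) → ∃ v : LieT m, Complex.I • a = C.fund v z := by
      intro a ha
      refine ⟨WithLp.toLp 2 (C.combo fun j => (a j).re / (2 * Real.pi * (z j).re)), ?_⟩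
      funext j
      have hz' : z j = ((z j).re : ℂ) := by
        apply Complex.ext <;> simp [hre j]
      have ha' : a j = ((a j).re : ℂ) := by
        apply Complex.ext <;> simp [ha j]
      have hzr : ((z j).re : ℂ) ≠ 0 := hz' ▸ hne j
      have hpi : (Real.pi : ℂ) ≠ 0 := by exact_mod_cast Real.pi_ne_zero
      simp only [ToricChart.fund, C.lieCoords_toLp_combo, Pi.smul_apply, smul_eq_mul]
      rw [ha', hz']
      simp only [Complex.ofReal_re]
      push_cast
      field_simp
    obtain ⟨v, hv⟩ := hex a ha
    obtain ⟨w, hw⟩ := hex b hb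
    rw [← coeff_I_I X.isKahler C.mem_maximalAtlas hz, hv, hw]
    exact coeff_fund_fund C hz v w
  exact C.of_perturb Set.univ hz isClosed_singleton
    (continuousOn_coeff X.isKahler C.mem_maximalAtlas a b) fun ε hε =>
      key _ (C.perturb_mem hz ε) (ToricChart.perturb_real hre)
        fun j => ToricChart.perturb_ne_zero hε (Or.inl trivial)

omit [IsManifold 𝓘(ℂ, CE m) ∞ M] in
/-- The anti-holomorphic involution is complex conjugation in a toric chart. -/
theorem sigma_symm [T2Space M] {z : CE m} (hz : z ∈ C.φ.target) :
    X.σ (C.φ.symm z) = C.φ.symm fun j => starRingEnd ℂ (z j) := by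
  have hmem : ∀ z ∈ C.φ.target, (fun j => starRingEnd ℂ (z j)) ∈ C.φ.target := fun z hz =>
    C.mem_target_of_imp hz fun j hj => by simpa using hj
  -- On the open orbit the rule for `σ` conjugates logarithms, and the integral matrix `β` commutes
  -- with conjugation. The identity extends by continuity, the diagonal being closed since `M` is
  -- Hausdorff.
  have key : ∀ z : CE m, (∀ j, z j ≠ 0) →
      X.σ (C.φ.symm z) = C.φ.symm fun j => starRingEnd ℂ (z j) := by
    intro z hne
    obtain ⟨b, rfl⟩ := exists_exp hne
    have h1 : (fun j => starRingEnd ℂ (Complex.exp (b j))) =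
        fun j => Complex.exp (starRingEnd ℂ (b j)) := by
      funext j
      rw [Complex.exp_conj]
    rw [h1, C.symm_exp, C.symm_exp, X.σ_smul, X.σ_base]
    congr 1
    funext i
    ext
    simp only [Units.coe_star, expC, Units.val_mk0, ToricChart.combo]
    rw [Complex.star_def, ← Complex.exp_conj]
    congr 1
    simp
  have hcont : ContinuousOn (fun z => (X.σ (C.φ.symm z),
      C.φ.symm fun j => starRingEnd ℂ (z j))) C.φ.target := by
    refine (X.σ_smooth.continuous.comp_continuousOn C.φ.continuousOn_symm).prodMk ?_
    exact C.φ.continuousOn_symm.comp (by fun_prop) hmem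
  exact C.of_perturb Set.univ hz (isClosed_diagonal (X := M)) hcont fun ε hε =>
    key _ fun j => ToricChart.perturb_ne_zero hε (Or.inl trivial)

omit [IsManifold 𝓘(ℂ, CE m) ∞ M] in
theorem sigma_symm_eq_iff [T2Space M] {z : CE m} (hz : z ∈ C.φ.target) :
    X.σ (C.φ.symm z) = C.φ.symm z ↔ ∀ j, (z j).im = 0 := by
  rw [sigma_symm C hz]
  have hmem : (fun j => starRingEnd ℂ (z j)) ∈ C.φ.target :=
    C.mem_target_of_imp hz fun j hj => by simpa using hj
  rw [C.φ.symm.injOn.eq_iff hmem hz, funext_iff]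
  exact forall_congr' fun j => Complex.conj_eq_iff_im

/-! ### The facets of the moment polytope -/

omit [IsManifold 𝓘(ℂ, CE m) ∞ M] in
theorem fund_intVec (j : Fin m) (z : CE m) :
    C.fund (intVec (C.β j)) z = Pi.single j (2 * Real.pi * Complex.I * z j) := by
  funext i
  rw [ToricChart.fund, C.lieCoords_intVec]
  by_cases hij : i = j
  · subst hij; simp
  · simp [hij]

/-- The field of `β_j` vanishes on the divisor `z_j = 0`, so the differential of `⟨μ, β_j⟩` vanishes
there. The stratum where the other coordinates are nonzero is connected, and its limits give the
rest of the divisor. -/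
theorem moment_const_of_zero {z : CE m} (hz : z ∈ C.φ.target) {j : Fin m} (hj : z j = 0) :
    (inner ℝ (X.μ (C.φ.symm z)) (intVec (C.β j)) : ℝ) =
      inner ℝ (X.μ (C.φ.symm (Function.update (1 : CE m) j 0))) (intVec (C.β j)) := by
  have hjk : j ∈ C.k := by
    by_contra h
    exact C.mem_target.mp hz j h hj
  have key : ∀ z : CE m, z j = 0 → (∀ i, i ≠ j → z i ≠ 0) →
      (inner ℝ (X.μ (C.φ.symm z)) (intVec (C.β j)) : ℝ) =
      inner ℝ (X.μ (C.φ.symm (Function.update (1 : CE m) j 0))) (intVec (C.β j)) := by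
    intro z hj hne
    -- The path `t ↦ z^t` joins the reference point at `t = 0` to `z` at `t = 1` inside the stratum.
    set c : ℝ → CE m := fun t i => if i = j then 0 else Complex.exp (t * Complex.log (z i))
    set c' : ℝ → CE m := fun t i =>
      if i = j then 0 else Complex.exp (t * Complex.log (z i)) * (1 * Complex.log (z i))
    have hc : ∀ t, HasDerivAt c (c' t) t := by
      intro t
      refine hasDerivAt_pi.mpr fun i => ?_
      by_cases hij : i = j
      · simp only [c, c', hij, if_true]
        exact hasDerivAt_const _ _
      · simp only [c, c', hij, if_false]
        exact ((Complex.ofRealCLM.hasDerivAt (x := t)).mul_const _).cexp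
    have hct : ∀ t, c t ∈ C.φ.target := fun t => C.mem_target.mpr fun i hi h => by
      by_cases hij : i = j
      · exact hi (hij ▸ hjk)
      · simp only [c, hij, if_false] at h
        exact Complex.exp_ne_zero _ h
    have hd : ∀ t, HasDerivAt (fun t => (inner ℝ (X.μ (C.φ.symm (c t))) (intVec (C.β j)) : ℝ))
        0 t := by
      intro t
      have h1 := hasDerivAt_moment C (hc t) (hct t) (intVec (C.β j))
      have h2 : C.fund (intVec (C.β j)) (c t) = 0 := by
        rw [fund_intVec]
        simp [c]
      rwa [h2, coeff_eq, map_zero, map_zero] at h1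
    have h3 := is_const_of_deriv_eq_zero (fun t => (hd t).differentiableAt)
      (fun t => (hd t).deriv) 1 0
    have h4 : c 1 = z := by
      funext i
      by_cases hij : i = j
      · simp [c, hij, hj]
      · simp [c, hij, Complex.exp_log (hne i hij)]
    have h5 : c 0 = Function.update (1 : CE m) j 0 := by
      funext i
      by_cases hij : i = j
      · subst hij; simp [c]
      · simp [c, hij]
    rwa [h4, h5] at h3
  have hp := C.of_perturb {i | i ≠ j} hz (isClosed_singleton (x := (inner ℝ
    (X.μ (C.φ.symm (Function.update (1 : CE m) j 0))) (intVec (C.β j)) : ℝ)))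
    (continuousOn_moment C (intVec (C.β j))) fun ε hε => key _ (by
      rw [ToricChart.perturb_apply_of_notMem (by simp), hj]) fun i hi =>
        ToricChart.perturb_ne_zero hε (Or.inl hi)
  exact hp

/-- Shrink the `j`-th coordinate of `w` to zero linearly. Along this path the field of `β_j` is
`2πt` times `i` times the velocity, so `⟨μ, β_j⟩` has derivative `2πt · g(velocity, velocity) ≥ 0`;
its value at the zero end is that at `z`, by constancy on the divisor. -/
theorem moment_le_of_zero {z w : CE m} (hz : z ∈ C.φ.target) {j : Fin m} (hj : z j = 0)
    (hw : w ∈ C.φ.target) : (inner ℝ (X.μ (C.φ.symm z)) (intVec (C.β j)) : ℝ) ≤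
      inner ℝ (X.μ (C.φ.symm w)) (intVec (C.β j)) := by
  have hjk : j ∈ C.k := by
    by_contra h
    exact C.mem_target.mp hz j h hj
  set c : ℝ → CE m := fun t => Function.update w j (t * w j)
  have hct : ∀ t, c t ∈ C.φ.target := fun t => C.mem_target.mpr fun i hi => by
    have hij : i ≠ j := fun h => hi (h ▸ hjk)
    simp only [c, Function.update_of_ne hij]
    exact C.mem_target.mp hw i hi
  have hc : ∀ t, HasDerivAt c (Pi.single j (w j)) t := by
    intro t
    refine hasDerivAt_pi.mpr fun i => ?_
    by_cases hij : i = j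
    · subst hij
      simp only [c, Function.update_self, Pi.single_eq_same]
      simpa using (Complex.ofRealCLM.hasDerivAt (x := t)).mul_const (w i)
    · simp only [c, Function.update_of_ne hij, Pi.single_eq_of_ne hij]
      exact hasDerivAt_const _ _
  have hd := fun t => hasDerivAt_moment C (hc t) (hct t) (intVec (C.β j))
  have hmono : MonotoneOn (fun t => (inner ℝ (X.μ (C.φ.symm (c t))) (intVec (C.β j)) : ℝ))
      (Set.Icc 0 1) := by
    refine monotoneOn_of_deriv_nonneg (convex_Icc 0 1)
      (fun t _ => (hd t).continuousAt.continuousWithinAt)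
      (fun t _ => (hd t).differentiableAt.differentiableWithinAt) fun t ht => ?_
    rw [interior_Icc] at ht
    rw [(hd t).deriv]
    have h1 : C.fund (intVec (C.β j)) (c t) =
        (2 * Real.pi * t) • (Complex.I • (Pi.single j (w j) : CE m)) := by
      rw [fund_intVec]
      funext i
      by_cases hij : i = j
      · subst hij
        simp only [c, Function.update_self, Pi.single_eq_same, Pi.smul_apply, Complex.real_smul,
          smul_eq_mul]
        push_cast
        ring
      · simp [hij]
    rw [h1, coeff_smul_right]
    refine mul_nonneg (by have := ht.1; positivity) ?_
    by_cases h0 : (Pi.single j (w j) : CE m) = 0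
    · rw [h0, smul_zero, coeff_eq, map_zero, map_zero]
    · exact (coeff_I_pos X.isKahler C.mem_maximalAtlas (hct t) h0).le
  have h01 := hmono (Set.left_mem_Icc.mpr zero_le_one) (Set.right_mem_Icc.mpr zero_le_one)
    zero_le_one
  have hc1 : c 1 = w := by simp [c]
  have hc0 : c 0 j = 0 := by simp [c]
  rw [moment_const_of_zero C hz hj, ← moment_const_of_zero C (hct 0) hc0]
  simpa only [hc1] using h01

/-- Points of the open orbit lie in every toric chart, so the inequality inside `C` reaches all of
`M` by density. -/
theorem moment_min_of_zero {z : CE m} (hz : z ∈ C.φ.target) {j : Fin m} (hj : z j = 0) (q : M) :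
    (inner ℝ (X.μ (C.φ.symm z)) (intVec (C.β j)) : ℝ) ≤ inner ℝ (X.μ q) (intVec (C.β j)) := by
  obtain ⟨C', hq⟩ := X.exists_chart q
  have h := C'.of_perturb Set.univ (C'.φ.map_source hq) (isClosed_Ici (a := (inner ℝ
    (X.μ (C.φ.symm z)) (intVec (C.β j)) : ℝ))) (continuousOn_moment C' (intVec (C.β j)))
    fun ε hε => by
      obtain ⟨b, hb⟩ := exists_exp (z := ToricChart.perturb Set.univ (C'.φ q) ε) fun i =>
        ToricChart.perturb_ne_zero hε (Or.inl trivial)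
      rw [hb, Set.mem_Ici, C'.symm_exp, ← C.combo_coords (C'.combo b), ← C.symm_exp]
      exact moment_le_of_zero C hz hj (C.exp_mem _)
  rw [C'.φ.left_inv hq] at h
  exact h

/-- A duality argument. A direction orthogonal to the active normals can be followed a little way in
both senses inside the closed polytope, the inactive inequalities being strict and finite in number.
Since `⟨·, β_j⟩` is minimal at `y`, it vanishes on all such directions, so `β_j` lies in the double
orthogonal of `facetSpan`. The argument does not need the inequality of `β_j` itself to be an
equality at `y`. -/
theorem intVec_mem_facetSpan {z : CE m} (hz : z ∈ C.φ.target) {j : Fin m} (hj : z j = 0) :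
    intVec (C.β j) ∈ X.facetSpan (X.μ (C.φ.symm z)) := by
  set y := X.μ (C.φ.symm z)
  have hy : y ∈ closure (Set.range X.μ) := subset_closure ⟨_, rfl⟩
  have hmin : ∀ w ∈ closure (Set.range X.μ), (inner ℝ y (intVec (C.β j)) : ℝ) ≤
      inner ℝ w (intVec (C.β j)) := by
    have hcl : IsClosed {w : LieT m | (inner ℝ y (intVec (C.β j)) : ℝ) ≤
        inner ℝ w (intVec (C.β j))} := isClosed_le continuous_const (by fun_prop)
    refine fun w hw => closure_minimal ?_ hcl hw
    rintro _ ⟨q, rfl⟩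
    exact moment_min_of_zero C hz hj q
  have hnonneg : ∀ x ∈ (X.facetSpan y)ᗮ, 0 ≤ (inner ℝ x (intVec (C.β j)) : ℝ) := by
    intro x hx
    have hev : ∀ᶠ ε : ℝ in 𝓝[>] 0, y + ε • x ∈ closure (Set.range X.μ) := by
      simp only [X.closure_polytope, Set.mem_ofPred_eq]
      refine (Set.Finite.eventually_all X.rays_finite).mpr fun l hl => ?_
      rw [X.closure_polytope] at hy
      rcases (hy l hl).lt_or_eq with hlt | heq
      · have hc : ContinuousAt (fun ε : ℝ => (inner ℝ (y + ε • x) (intVec l) : ℝ)) 0 := by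
          fun_prop
        have h0 : X.κ l < (inner ℝ (y + (0 : ℝ) • x) (intVec l) : ℝ) := by simpa using hlt
        exact ((hc.eventually (lt_mem_nhds h0)).filter_mono nhdsWithin_le_nhds).mono
          fun _ h => h.le
      · refine Filter.Eventually.of_forall fun ε => ?_
        have hmem : intVec l ∈ X.facetSpan y := Submodule.subset_span ⟨l, ⟨hl, heq.symm⟩, rfl⟩
        have : (inner ℝ x (intVec l) : ℝ) = 0 := (Submodule.mem_orthogonal' _ x).mp hx _ hmem
        rw [inner_add_left, real_inner_smul_left, this, mul_zero, add_zero]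
        exact heq.le
    obtain ⟨ε, hε, hε0⟩ := (hev.and self_mem_nhdsWithin).exists
    have h1 := hmin _ hε
    rw [inner_add_left, real_inner_smul_left] at h1
    have h2 : 0 ≤ ε * (inner ℝ x (intVec (C.β j)) : ℝ) := by linarith
    exact nonneg_of_mul_nonneg_right h2 hε0
  rw [← Submodule.orthogonal_orthogonal (X.facetSpan y), Submodule.mem_orthogonal]
  intro x hx
  have h1 := hnonneg x hx
  have h2 := hnonneg (-x) (Submodule.neg_mem _ hx)
  rw [inner_neg_left] at h2
  linarith

/-- The stabilizer of a point is contained in the span of the normals of the facets through its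
image under the moment map. -/
theorem mem_facetSpan_of_fund_eq_zero {z : CE m} (hz : z ∈ C.φ.target) {v : LieT m}
    (hv : C.fund v z = 0) : v ∈ X.facetSpan (X.μ (C.φ.symm z)) := by
  rw [C.sum_lieCoords_smul v]
  refine Submodule.sum_mem _ fun j _ => ?_
  by_cases hj : z j = 0
  · exact Submodule.smul_mem _ _ (intVec_mem_facetSpan C hz hj)
  · have h1 := congrFun hv j
    have hpi : (Real.pi : ℂ) ≠ 0 := by exact_mod_cast Real.pi_ne_zero
    have h2 : C.lieCoords v j = 0 := by
      simpa [ToricChart.fund, hj, hpi] using h1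
    rw [h2, zero_smul]
    exact Submodule.zero_mem _

end ToricKahlerManifold

end Toric

/-! ### The holomorphic volume form in toric charts and the invariance of `ψ`. -/

section Toric

variable {m : ℕ} {M : Type*} [TopologicalSpace M] [ChartedSpace (CE m) M]

theorem topForm_congr (Ω : TopFormField m M) {p q : M} (h : p = q) {v w : Fin m → CE m}
    (hv : v = w) : (Ω p v : ℂ) = Ω q w := by
  subst h hv
  rfl

variable [MulAction (Fin m → ℂˣ) M]

/-- The determinant of the dual lattice basis of a toric chart. -/
def ToricChart.dualDet {base : M} (C : ToricChart m base) : ℂ :=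
  (((Matrix.of C.β)⁻¹.det : ℤ) : ℂ)

theorem ToricChart.dualDet_ne_zero {base : M} (C : ToricChart m base) : C.dualDet ≠ 0 := by
  have h : IsUnit (Matrix.of C.β)⁻¹.det := Matrix.isUnit_nonsing_inv_det _ C.unimodular
  exact Int.cast_ne_zero.mpr h.ne_zero

variable [IsManifold 𝓘(ℂ, CE m) ∞ M]

namespace ToricAlmostCalabiYau

variable {X : ToricAlmostCalabiYau m M} (C : ToricChart m X.base)

variable (X) in
/-- The pairing of `γ` with the lattice basis of a toric chart. -/
def weight (C : ToricChart m X.base) (j : Fin m) : ℤ := ∑ i, X.γ i * C.β j i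

/-- Chain rule for the substitution `z = exp(coords ζ)`, whose Jacobian is `∏ z_j` times `dualDet`.
On the open orbit the coefficient of `Ω` is thus a real constant times a Laurent monomial. -/
theorem topCoeff_exp (b : CE m) :
    topCoeff X.Ω C.φ (fun j => Complex.exp (b j)) * (∏ j, Complex.exp (b j)) * C.dualDet =
      Complex.exp (∑ j, (X.weight C j : ℂ) * b j) := by
  have hmem := C.exp_mem b
  have h1 := X.Ω_orbit (C.combo b) (fun i => Pi.single i 1)
  have hone : (Matrix.of fun i => (Pi.single i 1 : CE m)).det = 1 := by
    have h : (Matrix.of fun i => (Pi.single i 1 : CE m)) = 1 := by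
      ext i j
      simp [Matrix.one_apply, Pi.single_apply, eq_comm]
    rw [h, Matrix.det_one]
  rw [hone, mul_one] at h1
  have h2 : (∑ i, (X.γ i : ℂ) * C.combo b i) = ∑ j, (X.weight C j : ℂ) * b j := by
    simp only [ToricChart.combo, weight, Finset.mul_sum, Int.cast_sum, Finset.sum_mul, Int.cast_mul]
    rw [Finset.sum_comm]
    exact Finset.sum_congr rfl fun _ _ => Finset.sum_congr rfl fun _ _ => by ring
  rw [h2] at h1
  rw [← h1]
  set a : Fin m → CE m := fun i j =>
    Complex.exp (b j) * (((Matrix.of C.β)⁻¹ i j : ℤ) : ℂ)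
  have hdet : (Matrix.of a).det = (∏ j, Complex.exp (b j)) * C.dualDet := by
    rw [ToricChart.dualDet, Int.cast_det]
    exact Matrix.det_mul_row (fun j => Complex.exp (b j)) _
  rw [mul_assoc, ← hdet, ← topForm_apply_chartVec X.Ω C.mem_maximalAtlas hmem]
  refine topForm_congr X.Ω (C.symm_exp b) (funext fun i => ?_)
  have h3 : (fun ζ : CE m => expC ζ • X.base) =
      C.φ.symm ∘ fun ζ j => Complex.exp (C.coords ζ j) := by
    funext ζ
    rw [Function.comp_apply, C.symm_exp, C.combo_coords]
  have h4 : HasFDerivAt (fun (ζ : CE m) j => Complex.exp (C.coords ζ j))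
      (ContinuousLinearMap.pi fun j => Complex.exp (b j) • LinearMap.toContinuousLinearMap
        ((LinearMap.proj j).comp (Matrix.vecMulLinear
          ((Matrix.of C.β)⁻¹.map (Int.cast : ℤ → ℂ))))) (C.combo b) := by
    refine hasFDerivAt_pi.mpr fun j => ?_
    have h5 : HasFDerivAt (fun ζ : CE m => C.coords ζ j) (LinearMap.toContinuousLinearMap
        ((LinearMap.proj j).comp (Matrix.vecMulLinear
          ((Matrix.of C.β)⁻¹.map (Int.cast : ℤ → ℂ))))) (C.combo b) :=
      (LinearMap.toContinuousLinearMap ((LinearMap.proj j).comp (Matrix.vecMulLinear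
          ((Matrix.of C.β)⁻¹.map (Int.cast : ℤ → ℂ))))).hasFDerivAt
    have h6 := h5.cexp
    rwa [C.coords_combo] at h6
  have h0 : (fun j => Complex.exp (C.coords (C.combo b) j)) = fun j => Complex.exp (b j) := by
    rw [C.coords_combo]
  have h7 := mdifferentiableAt_symm_complex C.mem_maximalAtlas hmem
  rw [← h0] at h7
  have h8 := mfderiv_comp (C.combo b) h7 h4.differentiableAt.mdifferentiableAt
  rw [← h3, mfderiv_eq_fderiv, h4.fderiv] at h8
  rw [h8]
  refine (chartVec_eq_complex C.mem_maximalAtlas hmem _).trans ?_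
  rw [← h0]
  change mfderiv 𝓘(ℂ, CE m) 𝓘(ℂ, CE m) C.φ.symm _ (a i) =
    mfderiv 𝓘(ℂ, CE m) 𝓘(ℂ, CE m) C.φ.symm _ _
  congr 1
  funext j
  change _ = Complex.exp (b j) * Matrix.vecMul (Pi.single i 1)
    ((Matrix.of C.β)⁻¹.map (Int.cast : ℤ → ℂ)) j
  rw [Matrix.single_one_vecMul]
  rfl

theorem continuousOn_topCoeff_chart : ContinuousOn (topCoeff X.Ω C.φ) C.φ.target :=
  continuousOn_topCoeff X.Ω_holomorphic C.mem_maximalAtlas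

/-- Homogeneity is clear for the monomial on the open orbit; continuity carries it across the
divisors `z_j = 0`. -/
theorem topCoeff_exp_mul {z : CE m} (hz : z ∈ C.φ.target) (c : CE m) :
    topCoeff X.Ω C.φ (fun j => Complex.exp (c j) * z j) * ∏ j, Complex.exp (c j) =
      Complex.exp (∑ j, (X.weight C j : ℂ) * c j) * topCoeff X.Ω C.φ z := by
  have key : ∀ z : CE m, (∀ j, z j ≠ 0) →
      topCoeff X.Ω C.φ (fun j => Complex.exp (c j) * z j) * ∏ j, Complex.exp (c j) =
      Complex.exp (∑ j, (X.weight C j : ℂ) * c j) * topCoeff X.Ω C.φ z := by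
    intro z hne
    obtain ⟨b, rfl⟩ := exists_exp hne
    have h1 := topCoeff_exp C b
    have h2 := topCoeff_exp C (c + b)
    simp only [Pi.add_apply, Complex.exp_add, mul_add, Finset.sum_add_distrib,
      Finset.prod_mul_distrib] at h2
    rw [← h1] at h2
    have hp : (∏ j, Complex.exp (b j)) * C.dualDet ≠ 0 :=
      mul_ne_zero (Finset.prod_ne_zero_iff.mpr fun j _ => Complex.exp_ne_zero _) C.dualDet_ne_zero
    refine mul_right_cancel₀ hp ?_
    linear_combination h2
  have hcont : ContinuousOn (fun z =>
      (topCoeff X.Ω C.φ (fun j => Complex.exp (c j) * z j) * ∏ j, Complex.exp (c j),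
      Complex.exp (∑ j, (X.weight C j : ℂ) * c j) * topCoeff X.Ω C.φ z)) C.φ.target := by
    refine ContinuousOn.prodMk (ContinuousOn.mul ?_ continuousOn_const)
      (continuousOn_const.mul (continuousOn_topCoeff_chart C))
    exact (continuousOn_topCoeff_chart C).comp (by fun_prop) fun z hz => C.exp_mul_mem hz c
  exact C.of_perturb Set.univ hz (isClosed_diagonal (X := ℂ)) hcont fun ε hε =>
    key _ fun j => ToricChart.perturb_ne_zero hε (Or.inl trivial)

/-- `Ω` is real on the real part of `M`. -/
theorem topCoeff_real {z : CE m} (hz : z ∈ C.φ.target) (hre : ∀ j, (z j).im = 0) :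
    (topCoeff X.Ω C.φ z).im = 0 := by
  -- On the open orbit the coefficient is a monomial with integer exponents and a real constant, so
  -- conjugation fixes it at real points.
  have key : ∀ z : CE m, (∀ j, (z j).im = 0) → (∀ j, z j ≠ 0) →
      (topCoeff X.Ω C.φ z).im = 0 := by
    intro z hre hne
    obtain ⟨b, hb⟩ := exists_exp hne
    have h1 := topCoeff_exp C b
    rw [← hb] at h1
    have hbj : ∀ j, Complex.exp (b j) = z j := fun j => (congrFun hb j).symm
    rw [Complex.exp_sum] at h1
    have h2 : ∀ j, Complex.exp ((X.weight C j : ℂ) * b j) = z j ^ X.weight C j := fun j => by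
      rw [Complex.exp_int_mul, hbj]
    simp only [h2] at h1
    have h3 : ∀ j, starRingEnd ℂ (z j) = z j := fun j => Complex.conj_eq_iff_im.mpr (hre j)
    rw [← Complex.conj_eq_iff_im]
    have hp : (∏ j, z j) * C.dualDet ≠ 0 :=
      mul_ne_zero (Finset.prod_ne_zero_iff.mpr fun j _ => hne j) C.dualDet_ne_zero
    have h4 := congrArg (starRingEnd ℂ) h1
    simp only [map_mul, map_prod, map_zpow₀, h3, ToricChart.dualDet, map_intCast] at h4
    refine mul_right_cancel₀ hp ?_
    rw [ToricChart.dualDet] at h1 ⊢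
    rw [← mul_assoc, ← mul_assoc, h4, h1]
  have hcl : IsClosed {w : ℂ | w.im = 0} := isClosed_eq Complex.continuous_im continuous_const
  exact C.of_perturb Set.univ hz hcl (continuousOn_topCoeff_chart C) fun ε hε =>
    key _ (ToricChart.perturb_real hre) fun j => ToricChart.perturb_ne_zero hε (Or.inl trivial)

variable (X)

/-- The behaviour of `Ω` under the real torus. -/
theorem Ω_expT (v : LieT m) (p : M) (Y : Fin m → TangentSpace 𝓘(ℝ, CE m) p) :
    X.Ω (expT v • p)
      (fun i => mfderiv 𝓘(ℝ, CE m) 𝓘(ℝ, CE m) (fun q : M => expT v • q) p (Y i)) =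
    Complex.exp ((2 * Real.pi * inner ℝ (intVec X.γ) v : ℝ) * Complex.I) * X.Ω p Y := by
  obtain ⟨C, hp⟩ := X.exists_chart p
  obtain ⟨z, hz, rfl⟩ : ∃ z ∈ C.φ.target, p = C.φ.symm z :=
    ⟨C.φ p, C.φ.map_source hp, (C.φ.left_inv hp).symm⟩
  have hex : ∀ i, ∃ a, chartVec C.φ z a = Y i := fun i => exists_chartVec_eq C.mem_maximalAtlas hz _
  choose a ha using hex
  obtain rfl : (fun i => chartVec C.φ z (a i)) = Y := funext ha
  rw [topForm_apply_chartVec X.Ω C.mem_maximalAtlas hz]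
  have h1 : X.Ω (expT v • C.φ.symm z) (fun i => mfderiv 𝓘(ℝ, CE m) 𝓘(ℝ, CE m)
      (fun q : M => expT v • q) (C.φ.symm z) (chartVec C.φ z (a i))) =
      X.Ω (C.φ.symm (C.rot v * z)) (fun i => chartVec C.φ (C.rot v * z) (C.rot v * a i)) :=
    topForm_congr X.Ω (C.expT_smul_symm hz v) (funext fun i => C.mfderiv_expT_smul hz v (a i))
  rw [h1, topForm_apply_chartVec X.Ω C.mem_maximalAtlas (C.rot_mul_mem hz v)]
  have h2 : (Matrix.of fun i => C.rot v * a i).det = (∏ j, C.rot v j) * (Matrix.of a).det :=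
    Matrix.det_mul_row (C.rot v) (Matrix.of a)
  have h3 := topCoeff_exp_mul C hz fun j => 2 * Real.pi * Complex.I * C.lieCoords v j
  -- The pairing `⟨γ, v⟩` written in the lattice basis of the chart. The remaining phase, from
  -- rotating the `dz_j`, cancels against the determinant.
  have h4 : (∑ j, (X.weight C j : ℂ) * (2 * Real.pi * Complex.I * C.lieCoords v j)) =
      (2 * Real.pi * inner ℝ (intVec X.γ) v : ℝ) * Complex.I := by
    have h5 : (inner ℝ (intVec X.γ) v : ℝ) = ∑ j, (X.weight C j : ℝ) * C.lieCoords v j := by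
      have h6 : ∀ i, v i = ∑ j, C.lieCoords v j * (C.β j i : ℝ) := fun i =>
        (congrFun (C.combo_coords fun i => v i) i).symm
      simp only [PiLp.inner_apply, h6, weight, intVec, Int.cast_sum, Int.cast_mul, Finset.sum_mul]
      rw [Finset.sum_comm]
      refine Finset.sum_congr rfl fun i _ => ?_
      simp only [RCLike.inner_apply, conj_trivial, Finset.sum_mul]
      exact Finset.sum_congr rfl fun _ _ => by ring
    rw [h5]
    push_cast
    rw [Finset.mul_sum, Finset.sum_mul]
    exact Finset.sum_congr rfl fun _ _ => by ring
  rw [h4] at h3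
  have h3' : topCoeff X.Ω C.φ (C.rot v * z) * ∏ j, C.rot v j =
      Complex.exp ((2 * Real.pi * inner ℝ (intVec X.γ) v : ℝ) * Complex.I) *
        topCoeff X.Ω C.φ z := h3
  rw [h2, ← mul_assoc, h3', mul_assoc]

/-- The conformal potential is invariant under the real torus. -/
theorem potential_expT {ψ : M → ℝ} (hψ : IsConformalPotential X.omega X.Ω ψ) (v : LieT m) (p : M) :
    (m : ℝ) * ψ (expT v • p) = m * ψ p := by
  have hΩ : ((X.Ω p : (TangentSpace 𝓘(ℂ, CE m) p) [⋀^Fin m]→L[ℂ] ℂ).toAlternatingMap :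
      (CE m) [⋀^Fin m]→ₗ[ℂ] ℂ) ≠ 0 := by
    intro h
    apply X.Ω_ne_zero p
    ext Y
    exact congrArg (fun D : (CE m) [⋀^Fin m]→ₗ[ℂ] ℂ => D Y) h
  -- On a frame where `Ω ∧ Ω̄` is nonzero the defining equation forces `ω^m ≠ 0`, so `e^{2mψ}` can
  -- be isolated.
  obtain ⟨Y, hY⟩ := exists_topWedge_sum_ne_zero _ hΩ
  have hY' : topWedge X.Ω p Y ≠ 0 := by
    exact mul_ne_zero (one_div_ne_zero (pow_ne_zero _
      (Nat.cast_ne_zero.mpr m.factorial_ne_zero))) hY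
  set A := mfderiv 𝓘(ℝ, CE m) 𝓘(ℝ, CE m) (fun q : M => expT v • q) p
  have hnorm : Complex.exp ((2 * Real.pi * inner ℝ (intVec X.γ) v : ℝ) * Complex.I) *
      starRingEnd ℂ (Complex.exp ((2 * Real.pi * inner ℝ (intVec X.γ) v : ℝ) * Complex.I)) = 1 := by
    rw [Complex.mul_conj, Complex.normSq_eq_norm_sq, Complex.norm_exp_ofReal_mul_I]
    simp
  have hwedge : topWedge X.Ω (expT v • p) (fun i => A (Y i)) = topWedge X.Ω p Y := by
    unfold topWedge
    congr 1
    refine Finset.sum_congr rfl fun s _ => ?_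
    congr 1
    rw [X.Ω_expT v p fun k => Y (s ⟨k.val, by omega⟩),
      X.Ω_expT v p fun k => Y (s ⟨m + k.val, by omega⟩), map_mul]
    linear_combination ((X.Ω p) fun k => Y (s ⟨k.val, by omega⟩)) *
      (starRingEnd ℂ) ((X.Ω p) fun k => Y (s ⟨m + k.val, by omega⟩)) * hnorm
  have hpow : omegaPow X.omega (expT v • p) (fun i => A (Y i)) = omegaPow X.omega p Y := by
    unfold omegaPow
    congr 1
    refine Finset.sum_congr rfl fun s _ => ?_
    congr 1
    exact Finset.prod_congr rfl fun k _ => X.omega_invariant v p _ _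
  have h1 := hψ p Y
  have h2 := hψ (expT v • p) fun i => A (Y i)
  rw [hwedge, hpow, ← h1] at h2
  have h3 : omegaPow X.omega p Y ≠ 0 := by
    intro h0
    rw [h0, mul_zero, Complex.ofReal_zero] at h1
    have hI : (-1 : ℂ) ^ (m * (m - 1) / 2) * (Complex.I / 2) ^ m ≠ 0 := by
      refine mul_ne_zero (pow_ne_zero _ (by norm_num)) (pow_ne_zero _ ?_)
      simp
    exact mul_ne_zero hI hY' h1.symm
  -- Only `2mψ` is recovered: for `m = 0` the defining equation says nothing about `ψ`, whence the
  -- factor `m` in the claim.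
  have h4 := mul_right_cancel₀ h3 (Complex.ofReal_injective h2)
  have h5 := Real.exp_injective h4
  linarith

end ToricAlmostCalabiYau

end Toric

/-! ### The real slice as a submanifold. -/

section Toric

variable {m : ℕ} {M : Type*} [TopologicalSpace M] [ChartedSpace (CE m) M]
  [MulAction (Fin m → ℂˣ) M] {n : ℕ}

theorem ToricChart.fund_add {base : M} (C : ToricChart m base) (v w : LieT m) (z : CE m) :
    C.fund (v + w) z = C.fund v z + C.fund w z := by
  funext j
  simp only [ToricChart.fund, C.lieCoords_add, Pi.add_apply]
  push_cast
  ring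

theorem ToricChart.fund_smul {base : M} (C : ToricChart m base) (t : ℝ) (v : LieT m) (z : CE m) :
    C.fund (t • v) z = t • C.fund v z := by
  funext j
  simp only [ToricChart.fund, C.lieCoords_smul, Pi.smul_apply, smul_eq_mul, Complex.real_smul]
  push_cast
  ring

theorem ToricChart.fund_real {base : M} (C : ToricChart m base) {z : CE m}
    (hz : ∀ j, (z j).im = 0) (v : LieT m) (j : Fin m) : (Complex.I • C.fund v z) j =
      ((-(2 * Real.pi * C.lieCoords v j * (z j).re) : ℝ) : ℂ) := by
  have hz' : z j = ((z j).re : ℂ) := by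
    apply Complex.ext <;> simp [hz j]
  simp only [ToricChart.fund, Pi.smul_apply, smul_eq_mul]
  rw [hz']
  push_cast
  simp only [Complex.ofReal_re]
  linear_combination (2 * Real.pi * C.lieCoords v j * (z j).re : ℂ) * Complex.I_mul_I

theorem ToricChart.I_smul_fund_im {base : M} (C : ToricChart m base) {z : CE m}
    (hz : ∀ j, (z j).im = 0) (v : LieT m) (j : Fin m) : ((Complex.I • C.fund v z) j).im = 0 := by
  rw [C.fund_real hz, Complex.ofReal_im]

namespace ToricKahlerManifold

variable {X : ToricKahlerManifold m M} {ζ : Fin n → LieT m} {c : Fin n → ℝ}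

theorem moment_const_of_mem_realSlice {v : LieT m} (hv : v ∈ V ζ) {p q : M}
    (hp : p ∈ X.realSlice ζ c) (hq : q ∈ X.realSlice ζ c) :
    (inner ℝ (X.μ p) v : ℝ) = inner ℝ (X.μ q) v := by
  induction hv using Submodule.span_induction with
  | mem x hx =>
    obtain ⟨i, rfl⟩ := hx
    rw [hp.2 i, hq.2 i]
  | zero => simp
  | add x y _ _ hx hy => rw [inner_add_right, inner_add_right, hx, hy]
  | smul t x _ hx => rw [real_inner_smul_right, real_inner_smul_right, hx]

variable [IsManifold 𝓘(ℂ, CE m) ∞ M] (C : ToricChart m X.base)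

/-- Regularity takes effect here: the infinitesimal stabilizer lies in `facetSpan`, which meets
`V_ζ` only in zero. -/
theorem eq_zero_of_fund_eq_zero (hreg : ∀ y ∈ X.slicePolytope ζ c, X.IsRegularPoint ζ y) {z : CE m}
    (hz : z ∈ C.φ.target) (hS : C.φ.symm z ∈ X.realSlice ζ c) {v : LieT m} (hv : v ∈ V ζ)
    (h0 : C.fund v z = 0) : v = 0 := by
  have h1 : X.IsRegularPoint ζ (X.μ (C.φ.symm z)) := hreg _ ⟨⟨_, rfl⟩, hS.2⟩
  have h2 : v ∈ V ζ ⊓ X.facetSpan (X.μ (C.φ.symm z)) :=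
    ⟨hv, mem_facetSpan_of_fund_eq_zero C hz h0⟩
  rw [h1] at h2
  exact (Submodule.mem_bot ℝ).mp h2

/-- At a real point the vectors `J v_p` with `v ∈ V_ζ` are real, and `ω(J v_p, w_p) = -g(w_p, v_p)`
is negative definite on `V_ζ`. The resulting endomorphism of `ℝ^n` is injective, hence surjective.
-/
theorem exists_real_moment_eq (hζ : LinearIndependent ℝ ζ)
    (hreg : ∀ y ∈ X.slicePolytope ζ c, X.IsRegularPoint ζ y) {z : CE m}
    (hz : z ∈ C.φ.target) (hre : ∀ j, (z j).im = 0) (hS : C.φ.symm z ∈ X.realSlice ζ c)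
    (s : Fin n → ℝ) : ∃ a : CE m, (∀ j, (a j).im = 0) ∧
      ∀ i, coeff X.omega C.φ a (C.fund (ζ i) z) z = s i := by
  set comb : (Fin n → ℝ) →ₗ[ℝ] LieT m := Fintype.linearCombination ℝ ζ
  set A : (Fin n → ℝ) →ₗ[ℝ] CE m :=
    { toFun := fun t => Complex.I • C.fund (comb t) z
      map_add' := fun t t' => by rw [map_add, C.fund_add, smul_add]
      map_smul' := fun r t => by
        rw [map_smul, C.fund_smul, smul_comm]; rfl }
  set B : (Fin n → ℝ) →ₗ[ℝ] (Fin n → ℝ) :=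
    { toFun := fun t i => coeff X.omega C.φ (A t) (C.fund (ζ i) z) z
      map_add' := fun t t' => funext fun i => by
        simp only [coeff_eq, map_add, add_apply, Pi.add_apply]
      map_smul' := fun r t => funext fun i => by
        simp only [coeff_eq, map_smul, smul_apply, Pi.smul_apply, RingHom.id_apply] }
  have hB : ∀ t i, B t i = coeff X.omega C.φ (A t) (C.fund (ζ i) z) z := fun t i => rfl
  have hsum : ∀ (a : CE m) (t : Fin n → ℝ), coeff X.omega C.φ a (C.fund (comb t) z) z =
      ∑ i, t i * coeff X.omega C.φ a (C.fund (ζ i) z) z := by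
    intro a t
    set Lf : LieT m →ₗ[ℝ] ℝ :=
      { toFun := fun v => coeff X.omega C.φ a (C.fund v z) z
        map_add' := fun v w => by rw [C.fund_add, coeff_eq, map_add, map_add]; rfl
        map_smul' := fun r v => by rw [C.fund_smul, coeff_smul_right]; rfl }
    change Lf (comb t) = _
    simp only [comb, Fintype.linearCombination_apply, map_sum, map_smul, smul_eq_mul]
    rfl
  have hinj : Function.Injective B := by
    refine (injective_iff_map_eq_zero B).mpr fun t ht => ?_
    have h1 : coeff X.omega C.φ (A t) (C.fund (comb t) z) z = 0 := by
      rw [hsum]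
      exact Finset.sum_eq_zero fun i _ => by rw [← hB, ht, Pi.zero_apply, mul_zero]
    have h2 : C.fund (comb t) z = 0 := by
      by_contra hne
      have h3 := coeff_I_pos X.isKahler C.mem_maximalAtlas hz hne
      rw [coeff_eq, X.isKahler.swap, ← coeff_eq] at h3
      have h4 : coeff X.omega C.φ (Complex.I • C.fund (comb t) z) (C.fund (comb t) z) z = 0 := h1
      linarith
    have hmem : comb t ∈ V ζ := by
      rw [Fintype.linearCombination_apply]
      exact Submodule.sum_mem _ fun i _ =>
        Submodule.smul_mem _ _ (Submodule.subset_span ⟨i, rfl⟩)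
    have h5 := eq_zero_of_fund_eq_zero C hreg hz hS hmem h2
    rw [Fintype.linearCombination_apply] at h5
    exact funext (Fintype.linearIndependent_iff.mp hζ t h5)
  obtain ⟨t, ht⟩ := LinearMap.injective_iff_surjective.mp hinj s
  exact ⟨A t, fun j => C.I_smul_fund_im hre _ j, fun i => by rw [← hB, ht]⟩

/-- In a toric chart the slice is cut out by `Im z_j = 0` and `⟨μ, ζ_i⟩ = c_i`. The differentials
are independent: imaginary vectors realize any imaginary part, and real vectors then correct the
moments without disturbing it. -/
theorem exists_chartedSpace_realSlice [T2Space M] (hζ : LinearIndependent ℝ ζ)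
    (hreg : ∀ y ∈ X.slicePolytope ζ c, X.IsRegularPoint ζ y) :
    ∃ _ : ChartedSpace (EuclideanSpace ℝ (Fin (m - n))) (X.realSlice ζ c),
      IsManifold 𝓘(ℝ, EuclideanSpace ℝ (Fin (m - n))) ∞ (X.realSlice ζ c) ∧
      Manifold.IsSmoothEmbedding 𝓘(ℝ, EuclideanSpace ℝ (Fin (m - n))) 𝓘(ℝ, CE m) ∞
        (Subtype.val : X.realSlice ζ c → M) ∧
      ∀ (p : X.realSlice ζ c), ∀ y ∈ (chartAt (EuclideanSpace ℝ (Fin (m - n))) p).target,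
        Function.Injective (mfderiv 𝓘(ℝ, EuclideanSpace ℝ (Fin (m - n))) 𝓘(ℝ, CE m)
          (fun y => ((chartAt (EuclideanSpace ℝ (Fin (m - n))) p).symm y : M)) y) := by
  -- The bound `n ≤ m` obtained next makes the truncated difference `m - n` a true one, so that `2m
  -- = (m - n) + (m + n)`.
  have : IsManifold 𝓘(ℝ, CE m) ∞ M := isManifold_real
  have hnm : n ≤ m := by simpa using hζ.fintype_card_le_finrank
  refine exists_chartedSpace_of_levelSet (F := (Fin m → ℝ) × (Fin n → ℝ)) ?_ ?_
  · rw [Module.finrank_prod, Module.finrank_pi_fintype]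
    simp [Complex.finrank_real_complex]
    omega
  intro p hp
  obtain ⟨C, hpC⟩ := X.exists_chart p
  have hφ := mem_maximalAtlas_real C.mem_maximalAtlas
  set z := C.φ p
  have hz : z ∈ C.φ.target := C.φ.map_source hpC
  have hzp : C.φ.symm z = p := C.φ.left_inv hpC
  have hiff : ∀ q ∈ C.φ.source, X.σ q = q ↔ ∀ j, (C.φ q j).im = 0 := by
    intro q hq
    have := sigma_symm_eq_iff C (C.φ.map_source hq)
    rwa [C.φ.left_inv hq] at this
  have hre : ∀ j, (z j).im = 0 := (hiff p hpC).mp hp.1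
  set Φ : M → (Fin m → ℝ) × (Fin n → ℝ) :=
    fun q => (fun j => (C.φ q j).im, fun i => inner ℝ (X.μ q) (ζ i) - c i)
  have hΦ : ContMDiffOn 𝓘(ℝ, CE m) 𝓘(ℝ, (Fin m → ℝ) × (Fin n → ℝ)) ∞ Φ C.φ.source := by
    have h1 : ContDiff ℝ ∞ fun w : CE m × LieT m =>
        ((fun j => (w.1 j).im, fun i => inner ℝ w.2 (ζ i) - c i) :
          (Fin m → ℝ) × (Fin n → ℝ)) := by
      refine ContDiff.prodMk (contDiff_pi.mpr fun j => ?_) (contDiff_pi.mpr fun i => ?_)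
      · exact Complex.imCLM.contDiff.comp ((contDiff_apply ℝ ℂ j).comp contDiff_fst)
      · exact (contDiff_snd.inner ℝ contDiff_const).sub contDiff_const
    exact h1.contMDiff.comp_contMDiffOn ((contMDiffOn_of_mem_maximalAtlas hφ).prodMk_space
      X.μ_smooth.contMDiffOn)
  refine ⟨C.φ.source, C.φ.open_source, hpC, Φ, hΦ, ?_, ?_⟩
  · have hA := fun i => exists_hasFDerivAt_moment_symm C hz (ζ i)
    choose A hA hA2 using hA
    have hd : HasFDerivAt (fun w : CE m =>
        ((fun j => (w j).im, fun i => inner ℝ (X.μ (C.φ.symm w)) (ζ i) - c i) :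
          (Fin m → ℝ) × (Fin n → ℝ)))
        ((ContinuousLinearMap.pi fun j =>
          Complex.imCLM.comp (ContinuousLinearMap.proj (R := ℝ) (φ := fun _ : Fin m => ℂ) j)).prod (ContinuousLinearMap.pi A)) z := by
      refine HasFDerivAt.prodMk (hasFDerivAt_pi.mpr fun j => ?_) (hasFDerivAt_pi.mpr fun i => ?_)
      · exact (Complex.imCLM.comp
          (ContinuousLinearMap.proj (R := ℝ) (φ := fun _ : Fin m => ℂ) j)).hasFDerivAt
      · exact (hA i).sub_const (c i)
    have hev : (Φ ∘ C.φ.symm) =ᶠ[𝓝 z] fun w : CE m =>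
        ((fun j => (w j).im, fun i => inner ℝ (X.μ (C.φ.symm w)) (ζ i) - c i) :
          (Fin m → ℝ) × (Fin n → ℝ)) := by
      filter_upwards [C.φ.open_target.mem_nhds hz] with w hw
      simp only [Φ, Function.comp_apply, C.φ.right_inv hw]
    have hΦd : MDifferentiableAt 𝓘(ℝ, CE m) 𝓘(ℝ, (Fin m → ℝ) × (Fin n → ℝ)) Φ (C.φ.symm z) := by
      rw [hzp]
      exact (hΦ.contMDiffAt (C.φ.open_source.mem_nhds hpC)).mdifferentiableAt (by simp)
    have hcomp := mfderiv_comp z hΦd (mdifferentiableAt_symm_real C.mem_maximalAtlas hz)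
    rw [mfderiv_eq_fderiv, hev.fderiv_eq, hd.fderiv] at hcomp
    have hS : C.φ.symm z ∈ X.realSlice ζ c := by rw [hzp]; exact hp
    rw [← hzp]
    rintro ⟨r, s⟩
    set a₀ : CE m := fun j => Complex.I * (r j : ℂ)
    obtain ⟨a, ha, ha2⟩ := exists_real_moment_eq C hζ hreg hz hre hS fun i => s i - A i a₀
    refine ⟨chartVec C.φ z (a + a₀), ?_⟩
    refine (DFunLike.congr_fun hcomp (a + a₀)).symm.trans ?_
    refine Prod.ext (funext fun j => ?_) (funext fun i => ?_)
    · change ((a + a₀) j).im = r j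
      simp [a₀, ha j]
    · change A i (a + a₀) = s i
      rw [map_add, hA2, ha2]
      ring
  · intro q hq
    rw [realSlice, Set.mem_ofPred_eq, hiff q hq, Prod.ext_iff]
    simp only [Φ, funext_iff, Prod.fst_zero, Prod.snd_zero, Pi.zero_apply, sub_eq_zero]

end ToricKahlerManifold

end Toric

section Bilinear

variable {m : ℕ} {M : Type*} [TopologicalSpace M] [ChartedSpace (CE m) M]

theorem coeff_add_left (omega : BilinField m M) (e : OpenPartialHomeomorph M (CE m))
    (a a' b z : CE m) : coeff omega e (a + a') b z = coeff omega e a b z + coeff omega e a' b z := by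
  simp only [coeff_eq, map_add, add_apply]

theorem coeff_add_right (omega : BilinField m M) (e : OpenPartialHomeomorph M (CE m))
    (a b b' z : CE m) : coeff omega e a (b + b') z = coeff omega e a b z + coeff omega e a b' z := by
  simp only [coeff_eq, map_add]

theorem coeff_neg_right (omega : BilinField m M) (e : OpenPartialHomeomorph M (CE m))
    (a b z : CE m) : coeff omega e a (-b) z = -coeff omega e a b z := by
  simp only [coeff_eq, map_neg]

end Bilinear

/-! ### Linear algebra of the tangent frame at a real point. -/

section Toric

variable {m : ℕ} {M : Type*} [TopologicalSpace M] [ChartedSpace (CE m) M]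
  [MulAction (Fin m → ℂˣ) M] {n : ℕ} {E₁ : Type*} [NormedAddCommGroup E₁] [NormedSpace ℝ E₁]

theorem ToricChart.coeff_rot {X : ToricKahlerManifold m M} [IsManifold 𝓘(ℂ, CE m) ∞ M]
    (C : ToricChart m X.base) {z : CE m} (hz : z ∈ C.φ.target) (v : LieT m) (a b : CE m) :
    coeff X.omega C.φ (C.rot v * a) (C.rot v * b) (C.rot v * z) = coeff X.omega C.φ a b z := by
  rw [coeff_eq, coeff_eq]
  refine Eq.trans ?_ (X.omega_invariant v _ _ _)
  exact (omega_congr X.omega (C.expT_smul_symm hz v) (C.mfderiv_expT_smul hz v a)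
    (C.mfderiv_expT_smul hz v b)).symm

/-- The data at a point of the real slice: the coordinates `z` of the point in a toric chart and
the derivative `r` of a parametrization of the real slice. -/
structure IsSliceFrame (X : ToricKahlerManifold m M) (C : ToricChart m X.base) (ζ : Fin n → LieT m)
    (z : CE m) (r : E₁ →L[ℝ] CE m) : Prop where
  mem : z ∈ C.φ.target
  real : ∀ j, (z j).im = 0
  real_frame : ∀ a j, (r a j).im = 0
  injective : Function.Injective r
  moment : ∀ a, ∀ v ∈ V ζ, coeff X.omega C.φ (r a) (C.fund v z) z = 0
  regular : ∀ v ∈ V ζ, C.fund v z = 0 → v = 0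

/-- The derivative of `(x, v) ↦ exp(v) · x` at `v = 0` in a toric chart. -/
def ToricChart.frame {base : M} (C : ToricChart m base) (ζ : Fin n → LieT m) (z : CE m)
    (r : E₁ →L[ℝ] CE m) : (E₁ × V ζ) →ₗ[ℝ] CE m where
  toFun a := r a.1 + C.fund (a.2 : LieT m) z
  map_add' a b := by
    simp only [Prod.fst_add, Prod.snd_add, map_add, Submodule.coe_add, C.fund_add]
    abel
  map_smul' t a := by
    simp only [Prod.smul_fst, Prod.smul_snd, map_smul, Submodule.coe_smul, C.fund_smul, smul_add,
      RingHom.id_apply]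

theorem ToricChart.frame_apply {base : M} (C : ToricChart m base) (ζ : Fin n → LieT m) (z : CE m)
    (r : E₁ →L[ℝ] CE m) (a : E₁ × V ζ) : C.frame ζ z r a = r a.1 + C.fund (a.2 : LieT m) z := rfl

namespace IsSliceFrame

variable [IsManifold 𝓘(ℂ, CE m) ∞ M]
variable {X : ToricKahlerManifold m M} {C : ToricChart m X.base} {ζ : Fin n → LieT m} {z : CE m}
  {r : E₁ →L[ℝ] CE m} (h : IsSliceFrame X C ζ z r)

include h

/-- Real vectors pair to zero with one another, orbit vectors likewise, and a mixed pairing is the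
derivative along the slice of a moment component that is constant there. -/
theorem coeff_frame (a b : E₁ × V ζ) :
    coeff X.omega C.φ (C.frame ζ z r a) (C.frame ζ z r b) z = 0 := by
  have h1 : coeff X.omega C.φ (C.fund (a.2 : LieT m) z) (r b.1) z = 0 := by
    rw [coeff_eq, X.isKahler.swap, ← coeff_eq, h.moment _ _ a.2.2, neg_zero]
  simp only [C.frame_apply, coeff_add_left, coeff_add_right, h1, h.moment _ _ b.2.2,
    ToricKahlerManifold.coeff_real_eq_zero C h.mem h.real (h.real_frame a.1) (h.real_frame b.1),
    ToricKahlerManifold.coeff_fund_fund C h.mem, add_zero]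

/-- Since `J` makes orbit directions real, a mixed term of the metric is `ω` of two real vectors and
vanishes. -/
theorem coeff_frame_I (a b : E₁ × V ζ) :
    coeff X.omega C.φ (C.frame ζ z r a) (Complex.I • C.frame ζ z r b) z =
      coeff X.omega C.φ (r a.1) (Complex.I • r b.1) z +
        coeff X.omega C.φ (C.fund (a.2 : LieT m) z) (Complex.I • C.fund (b.2 : LieT m) z) z := by
  have h1 : ∀ (a : E₁) (v : V ζ),
      coeff X.omega C.φ (r a) (Complex.I • C.fund (v : LieT m) z) z = 0 := fun a v =>
    ToricKahlerManifold.coeff_real_eq_zero C h.mem h.real (h.real_frame a)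
      (C.I_smul_fund_im h.real v)
  have h2 : coeff X.omega C.φ (C.fund (a.2 : LieT m) z) (Complex.I • r b.1) z = 0 := by
    rw [← coeff_I_I X.isKahler C.mem_maximalAtlas h.mem, smul_smul, Complex.I_mul_I, neg_one_smul,
      coeff_neg_right, coeff_eq, X.isKahler.swap, ← coeff_eq, h1, neg_zero, neg_zero]
  simp only [C.frame_apply, smul_add, coeff_add_left, coeff_add_right, h1, h2, zero_add, add_zero]

theorem coeff_I_nonneg (a : CE m) : 0 ≤ coeff X.omega C.φ a (Complex.I • a) z := by
  by_cases ha : a = 0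
  · rw [ha, smul_zero, coeff_eq, map_zero, map_zero]
  · exact (coeff_I_pos X.isKahler C.mem_maximalAtlas h.mem ha).le

theorem eq_zero_of_coeff_I {a : CE m} (ha : coeff X.omega C.φ a (Complex.I • a) z = 0) : a = 0 := by
  by_contra hne
  exact (coeff_I_pos X.isKahler C.mem_maximalAtlas h.mem hne).ne' ha

/-- The squared norm is the sum of the squared norms of the two components, so a kernel vector has
both equal to zero. -/
theorem frame_injective : Function.Injective (C.frame ζ z r) := by
  refine (injective_iff_map_eq_zero _).mpr fun a ha => ?_
  have h1 := h.coeff_frame_I a a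
  rw [ha, smul_zero, coeff_eq, map_zero, map_zero] at h1
  have h2 := h.coeff_I_nonneg (r a.1)
  have h3 := h.coeff_I_nonneg (C.fund (a.2 : LieT m) z)
  have h4 : r a.1 = 0 := h.eq_zero_of_coeff_I (by linarith)
  have h5 : C.fund (a.2 : LieT m) z = 0 := h.eq_zero_of_coeff_I (by linarith)
  refine Prod.ext (h.injective (h4.trans (map_zero r).symm)) (Subtype.ext ?_)
  exact h.regular _ a.2.2 h5

/-- Lagrangian subspaces are totally real: if `S + iT = 0` with `S`, `T` in the image, then `g(T, T)
= ω(T, iT) = -ω(T, S) = 0`. -/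
theorem det_frame_ne_zero {w : Fin m → E₁ × V ζ} (hw : LinearIndependent ℝ w) :
    (Matrix.of fun i => C.frame ζ z r (w i)).det ≠ 0 := by
  intro h0
  obtain ⟨k, hk, hk0⟩ := Matrix.exists_vecMul_eq_zero_iff.mpr h0
  set S := ∑ i, (k i).re • w i
  set T := ∑ i, (k i).im • w i
  have h1 : C.frame ζ z r S + Complex.I • C.frame ζ z r T = 0 := by
    rw [← hk0]
    funext j
    simp only [S, T, map_sum, map_smul, Pi.add_apply, Pi.smul_apply, Finset.sum_apply,
      Finset.smul_sum, Matrix.vecMul, dotProduct, Matrix.of_apply, ← Finset.sum_add_distrib,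
      smul_eq_mul, Complex.real_smul]
    refine Finset.sum_congr rfl fun i _ => ?_
    conv_rhs => rw [← Complex.re_add_im (k i)]
    ring
  have hT : T = 0 := by
    have h2 : coeff X.omega C.φ (C.frame ζ z r T) (Complex.I • C.frame ζ z r T) z = 0 := by
      rw [eq_neg_of_add_eq_zero_right h1, coeff_neg_right, h.coeff_frame, neg_zero]
    exact h.frame_injective ((h.eq_zero_of_coeff_I h2).trans (map_zero _).symm)
  have hS : S = 0 := by
    rw [hT, map_zero, smul_zero, add_zero] at h1
    exact h.frame_injective (h1.trans (map_zero _).symm)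
  refine hk (funext fun i => Complex.ext ?_ ?_)
  · exact Fintype.linearIndependent_iff.mp hw _ hS i
  · exact Fintype.linearIndependent_iff.mp hw _ hT i

omit [IsManifold 𝓘(ℂ, CE m) ∞ M] in
-- For a basis adapted to the product, the frame consists of real vectors and `n` imaginary ones.
-- Top-degree forms are determined by their value on one basis, so the phase `i^n` modulo sign holds
-- for every tuple.
theorem exists_det_frame_eq [FiniteDimensional ℝ E₁] (hζ : LinearIndependent ℝ ζ)
    (hdim : Module.finrank ℝ E₁ + n = m) (w : Fin m → E₁ × V ζ) :
    ∃ ρ : ℝ, (Matrix.of fun i => C.frame ζ z r (w i)).det = ρ * Complex.I ^ n := by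
  set e : Fin (Module.finrank ℝ E₁) ⊕ Fin n ≃ Fin m := finSumFinEquiv.trans (finCongr hdim)
  set b : Module.Basis (Fin m) ℝ (E₁ × V ζ) :=
    ((Module.finBasis ℝ E₁).prod (Module.Basis.span hζ)).reindex e
  set D : (E₁ × V ζ) [⋀^Fin m]→ₗ[ℝ] ℂ :=
    { ((Matrix.detRowAlternating (n := Fin m) (R := ℂ)).toMultilinearMap.restrictScalars
        ℝ).compLinearMap fun _ => C.frame ζ z r with
      map_eq_zero_of_eq' := fun v i j hv hij =>
        (Matrix.detRowAlternating (n := Fin m) (R := ℂ)).map_eq_zero_of_eq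
          (fun i => C.frame ζ z r (v i)) (congrArg (C.frame ζ z r) hv) hij }
  have hD : ∀ w, D w = (Matrix.of fun i => C.frame ζ z r (w i)).det := fun w => rfl
  have hb : ∃ ρ : ℝ, D b = ρ * Complex.I ^ n := by
    -- Each orbit vector is `-i` times the real vector got by multiplying it by `i`. Extracting
    -- these scalars leaves the determinant of a real matrix and `(-i)^n = (-1)^n i^n`.
    set k : Fin m → ℂ := fun i => Sum.elim (fun _ => 1) (fun _ => -Complex.I) (e.symm i)
    set q : Fin m → CE m := fun i =>
      Sum.elim (fun _ => C.frame ζ z r (b i)) (fun _ => Complex.I • C.frame ζ z r (b i)) (e.symm i)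
    have hq : ∀ i j, (q i j).im = 0 := by
      intro i j
      obtain ⟨s, rfl⟩ := e.surjective i
      rcases s with s | s
      · have : C.fund (0 : LieT m) z = 0 := by simpa using C.fund_smul 0 (0 : LieT m) z
        simp [q, b, C.frame_apply, h.real_frame, this]
      · have h1 := C.I_smul_fund_im h.real (Module.Basis.span hζ s : LieT m) j
        simpa [q, b, C.frame_apply] using h1
    have hkq : ∀ i, C.frame ζ z r (b i) = k i • q i := by
      intro i
      obtain ⟨s, rfl⟩ := e.surjective i
      rcases s with s | s
      · simp [k, q]
      · simp [k, q, smul_smul]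
    have h1 : D b = (∏ i, k i) * (Matrix.of q).det := by
      rw [hD]
      simp only [hkq]
      exact (Matrix.detRowAlternating (n := Fin m) (R := ℂ)).map_smul_univ k q
    have h2 : ∏ i, k i = (-Complex.I) ^ n := by
      rw [← e.prod_comp]
      simp [k]
    have h3 : (Matrix.of q).det = (((Matrix.of fun i j => (q i j).re).det : ℝ) : ℂ) := by
      have h4 : Matrix.of q = (Complex.ofRealHom).mapMatrix (Matrix.of fun i j => (q i j).re) := by
        ext i j
        exact Complex.ext (by simp) (by simp [hq i j])
      rw [h4, ← RingHom.map_det]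
      rfl
    refine ⟨(-1) ^ n * (Matrix.of fun i j => (q i j).re).det, ?_⟩
    rw [h1, h2, h3, neg_pow]
    push_cast
    ring
  obtain ⟨ρ, hρ⟩ := hb
  have hI : (-Complex.I) ^ n * Complex.I ^ n = 1 := by
    rw [← mul_pow]; simp
  -- The imaginary part of `(-i)^n D` is a real form of top degree that vanishes on the basis `b`,
  -- hence everywhere.
  set f : (E₁ × V ζ) [⋀^Fin m]→ₗ[ℝ] ℝ := (Complex.imLm.comp
    (LinearMap.mulLeft ℝ ((-Complex.I) ^ n))).compAlternatingMap D
  have hf : ∀ w, f w = ((-Complex.I) ^ n * D w).im := fun w => rfl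
  have hf0 : f w = 0 := by
    rw [f.eq_smul_basis_det b, AlternatingMap.smul_apply, hf, hρ]
    have : ((-Complex.I) ^ n * (ρ * Complex.I ^ n)).im = 0 := by
      rw [mul_left_comm, hI, mul_one, Complex.ofReal_im]
    rw [this, zero_smul]
  rw [hf] at hf0
  refine ⟨((-Complex.I) ^ n * D w).re, ?_⟩
  have h5 : (((-Complex.I) ^ n * D w).re : ℂ) = (-Complex.I) ^ n * D w :=
    Complex.ext (by simp) (by rw [hf0, Complex.ofReal_im])
  rw [h5, ← hD]
  linear_combination (-D w) * hI

end IsSliceFrame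

end Toric

/-! ### The orbit map and its differential. -/

section Toric

variable {m : ℕ} {M : Type*} [TopologicalSpace M] [ChartedSpace (CE m) M]
  [MulAction (Fin m → ℂˣ) M] {n : ℕ} {E₁ : Type*} [NormedAddCommGroup E₁] [NormedSpace ℝ E₁]

/-- `ι` parametrizes an open subset of the real slice. -/
structure IsSliceParam (X : ToricKahlerManifold m M) (ζ : Fin n → LieT m) (c : Fin n → ℝ)
    (ι : E₁ → M) (U : Set E₁) : Prop where
  isOpen : IsOpen U
  contMDiffOn : ContMDiffOn 𝓘(ℝ, E₁) 𝓘(ℝ, CE m) ∞ ι U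
  mapsTo : ∀ y ∈ U, ι y ∈ X.realSlice ζ c
  injective : ∀ y ∈ U, Function.Injective (mfderiv 𝓘(ℝ, E₁) 𝓘(ℝ, CE m) ι y)

/-- The map `(x, v) ↦ exp(v) · ι(x)`. -/
def orbitMap (ζ : Fin n → LieT m) (ι : E₁ → M) (y : E₁ × V ζ) : M :=
  expT (y.2 : LieT m) • ι y.1

omit [NormedAddCommGroup E₁] [NormedSpace ℝ E₁] in
theorem ToricChart.orbitMap_eq {base : M} (C : ToricChart m base) {ζ : Fin n → LieT m} {ι : E₁ → M}
    {y : E₁ × V ζ} (hy : ι y.1 ∈ C.φ.source) :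
    orbitMap ζ ι y = C.φ.symm (C.rot (y.2 : LieT m) * C.φ (ι y.1)) := by
  rw [← C.expT_smul_symm (C.φ.map_source hy), C.φ.left_inv hy, orbitMap]

/-- Differentiating the rotation reproduces it, times the coordinates of the generating field; it
factors out of the whole differential. All dependence on `v` is thereby carried by the torus action.
-/
theorem ToricChart.hasFDerivAt_rot_mul [FiniteDimensional ℝ E₁] {base : M} (C : ToricChart m base)
    (ζ : Fin n → LieT m) {g : E₁ → CE m} {g' : E₁ →L[ℝ] CE m} {y : E₁ × V ζ}
    (hg : HasFDerivAt g g' y.1) :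
    HasFDerivAt (fun y : E₁ × V ζ => C.rot (y.2 : LieT m) * g y.1)
      ((ContinuousLinearMap.mul ℝ (CE m) (C.rot (y.2 : LieT m))).comp
        (LinearMap.toContinuousLinearMap (C.frame ζ (g y.1) g'))) y := by
  refine hasFDerivAt_pi'.mpr fun j => ?_
  set l : (E₁ × V ζ) →L[ℝ] ℝ := LinearMap.toContinuousLinearMap
    { toFun := fun a : E₁ × V ζ => C.lieCoords (a.2 : LieT m) j
      map_add' := fun a b => by
        simp only [Prod.snd_add, Submodule.coe_add, C.lieCoords_add, Pi.add_apply]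
      map_smul' := fun t a => by
        simp only [Prod.smul_snd, Submodule.coe_smul, C.lieCoords_smul, Pi.smul_apply,
          RingHom.id_apply] }
  have h1 : HasFDerivAt (fun y : E₁ × V ζ => 2 * Real.pi * Complex.I * (l y : ℂ))
      ((2 * Real.pi * Complex.I) • Complex.ofRealCLM.comp l) y :=
    (Complex.ofRealCLM.hasFDerivAt.comp y l.hasFDerivAt).const_mul _
  have h2 : HasFDerivAt (fun y : E₁ × V ζ => g y.1 j)
      ((ContinuousLinearMap.proj (R := ℝ) (φ := fun _ : Fin m => ℂ) j).comp
        (g'.comp (ContinuousLinearMap.fst ℝ E₁ (V ζ)))) y :=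
    (ContinuousLinearMap.proj (R := ℝ) (φ := fun _ : Fin m => ℂ) j).hasFDerivAt.comp y
      (hg.comp y hasFDerivAt_fst)
  refine (h1.cexp.mul h2).congr_fderiv ?_
  refine ContinuousLinearMap.ext fun a => ?_
  change Complex.exp _ • g' a.1 j + g y.1 j • (Complex.exp _ • ((2 * Real.pi * Complex.I) •
    ((C.lieCoords (a.2 : LieT m) j : ℝ) : ℂ))) = Complex.exp _ * (g' a.1 j +
      2 * Real.pi * Complex.I * C.lieCoords (a.2 : LieT m) j * g y.1 j)
  simp only [smul_eq_mul]
  change Complex.exp (2 * Real.pi * Complex.I * (C.lieCoords (y.2 : LieT m) j : ℂ)) * _ + _ *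
    (Complex.exp (2 * Real.pi * Complex.I * (C.lieCoords (y.2 : LieT m) j : ℂ)) * _) = _
  ring

theorem ToricChart.contDiff_rot {base : M} (C : ToricChart m base)
    (ζ : Fin n → LieT m) : ContDiff ℝ ∞ fun v : V ζ => C.rot (v : LieT m) := by
  refine contDiff_pi.mpr fun j => ?_
  have h1 : ContDiff ℝ ∞ fun v : V ζ => C.lieCoords (v : LieT m) j :=
    (C.contDiff_lieCoords j).comp (V ζ).subtypeL.contDiff
  exact (contDiff_const.mul (Complex.ofRealCLM.contDiff.comp h1)).cexp

namespace IsSliceParam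

variable [IsManifold 𝓘(ℂ, CE m) ∞ M]
variable {X : ToricKahlerManifold m M} {ζ : Fin n → LieT m} {c : Fin n → ℝ} {ι : E₁ → M}
  {U : Set E₁} (h : IsSliceParam X ζ c ι U)

include h

omit [IsManifold 𝓘(ℂ, CE m) ∞ M] in
theorem eventually_mem (C : ToricChart m X.base) {y : E₁} (hy : y ∈ U) (hC : ι y ∈ C.φ.source) :
    ∀ᶠ x in 𝓝 y, x ∈ U ∧ ι x ∈ C.φ.source :=
  Filter.Eventually.and (h.isOpen.mem_nhds hy) ((h.contMDiffOn.continuousOn.continuousAt (h.isOpen.mem_nhds hy))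
    (C.φ.open_source.mem_nhds hC))

theorem contDiffAt_coord (C : ToricChart m X.base) {y : E₁} (hy : y ∈ U)
    (hC : ι y ∈ C.φ.source) : ContDiffAt ℝ ∞ (C.φ ∘ ι) y := by
  have : IsManifold 𝓘(ℝ, CE m) ∞ M := isManifold_real
  rw [← contMDiffAt_iff_contDiffAt]
  exact (contMDiffAt_of_mem_maximalAtlas (mem_maximalAtlas_real C.mem_maximalAtlas) hC).comp y
    (h.contMDiffOn.contMDiffAt (h.isOpen.mem_nhds hy))

theorem contMDiffOn_orbitMap :
    ContMDiffOn 𝓘(ℝ, E₁ × V ζ) 𝓘(ℝ, CE m) ∞ (orbitMap ζ ι) (U ×ˢ Set.univ) := by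
  have : IsManifold 𝓘(ℝ, CE m) ∞ M := isManifold_real
  rintro y ⟨hy, -⟩
  obtain ⟨C, hC⟩ := X.exists_chart (ι y.1)
  have h1 : ContDiffAt ℝ ∞ (fun y : E₁ × V ζ => C.rot (y.2 : LieT m) * (C.φ ∘ ι) y.1) y :=
    ((C.contDiff_rot ζ).comp contDiff_snd).contDiffAt.mul
      (ContDiffAt.comp (g := C.φ ∘ ι) y (h.contDiffAt_coord C hy hC) contDiffAt_fst)
  have h2 := (contMDiffAt_symm_of_mem_maximalAtlas (mem_maximalAtlas_real C.mem_maximalAtlas)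
    (C.rot_mul_mem (C.φ.map_source hC) (y.2 : LieT m))).comp y h1.contMDiffAt
  refine (h2.congr_of_eventuallyEq ?_).contMDiffWithinAt
  filter_upwards [continuous_fst.continuousAt.eventually (h.eventually_mem C hy hC)] with x hx
  exact C.orbitMap_eq hx.2

variable [T2Space M]

/-- The identities satisfied on the slice are differentiated: `Im z_j = 0` makes the frame real, and
constancy of `⟨μ, v⟩` for `v ∈ V_ζ` gives the moment condition. -/
theorem isSliceFrame (hreg : ∀ y ∈ X.slicePolytope ζ c, X.IsRegularPoint ζ y)
    (C : ToricChart m X.base) {y : E₁} (hy : y ∈ U) (hC : ι y ∈ C.φ.source) :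
    IsSliceFrame X C ζ (C.φ (ι y)) (fderiv ℝ (C.φ ∘ ι) y) := by
  have hz := C.φ.map_source hC
  have hd : HasFDerivAt (C.φ ∘ ι) (fderiv ℝ (C.φ ∘ ι) y) y :=
    ((h.contDiffAt_coord C hy hC).differentiableAt (by simp)).hasFDerivAt
  have hev := h.eventually_mem C hy hC
  have hre : ∀ x, x ∈ U ∧ ι x ∈ C.φ.source → ∀ j, (C.φ (ι x) j).im = 0 := by
    intro x hx
    refine (ToricKahlerManifold.sigma_symm_eq_iff C (C.φ.map_source hx.2)).mp ?_
    rw [C.φ.left_inv hx.2]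
    exact (h.mapsTo x hx.1).1
  have hι : ∀ᶠ x in 𝓝 y, ι x = C.φ.symm ((C.φ ∘ ι) x) := by
    filter_upwards [hev] with x hx
    exact (C.φ.left_inv hx.2).symm
  have hder := mfderiv_eq_chartVec C.mem_maximalAtlas hd hz hι
  refine ⟨hz, hre y ⟨hy, hC⟩, fun a j => ?_, fun a b hab => ?_, fun a v hv => ?_, fun v hv h0 => ?_⟩
  · have h1 : HasFDerivAt (fun x => ((C.φ ∘ ι) x j).im) ((Complex.imCLM.comp
        (ContinuousLinearMap.proj (R := ℝ) (φ := fun _ : Fin m => ℂ) j)).comp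
          (fderiv ℝ (C.φ ∘ ι) y)) y :=
      (Complex.imCLM.comp (ContinuousLinearMap.proj (R := ℝ)
        (φ := fun _ : Fin m => ℂ) j)).hasFDerivAt.comp y hd
    have h2 : HasFDerivAt (fun x => ((C.φ ∘ ι) x j).im) (0 : E₁ →L[ℝ] ℝ) y := by
      refine (hasFDerivAt_const (0 : ℝ) y).congr_of_eventuallyEq ?_
      filter_upwards [hev] with x hx
      exact hre x hx j
    exact DFunLike.congr_fun (h1.unique h2) a
  · refine h.injective y hy ?_
    exact (hder a).2.trans ((congrArg (chartVec C.φ (C.φ (ι y))) hab).trans (hder b).2.symm)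
  · obtain ⟨A, hA, hA2⟩ := X.exists_hasFDerivAt_moment (hder a).1 v
    have h2 : HasFDerivAt (fun x => (inner ℝ (X.μ (ι x)) v : ℝ)) (0 : E₁ →L[ℝ] ℝ) y := by
      refine (hasFDerivAt_const (inner ℝ (X.μ (ι y)) v : ℝ) y).congr_of_eventuallyEq ?_
      filter_upwards [h.isOpen.mem_nhds hy] with x hx
      exact ToricKahlerManifold.moment_const_of_mem_realSlice hv (h.mapsTo x hx) (h.mapsTo y hy)
    rw [coeff_eq, ← C.fundVec_symm hz]
    have h3 := (hA2 a).symm.trans (DFunLike.congr_fun (hA.unique h2) a)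
    refine Eq.trans ?_ h3
    refine omega_congr X.omega (C.φ.left_inv hC) (hder a).2.symm ?_
    rw [C.φ.left_inv hC]
  · refine ToricKahlerManifold.eq_zero_of_fund_eq_zero C hreg hz ?_ hv h0
    rw [C.φ.left_inv hC]
    exact h.mapsTo y hy

/-- The differential of the orbit map in a toric chart. -/
theorem exists_isSliceFrame [FiniteDimensional ℝ E₁]
    (hreg : ∀ y ∈ X.slicePolytope ζ c, X.IsRegularPoint ζ y) {y : E₁} (hy : y ∈ U) :
    ∃ (C : ToricChart m X.base) (z : CE m) (r : E₁ →L[ℝ] CE m), IsSliceFrame X C ζ z r ∧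
      C.φ.symm z = ι y ∧ ∀ (v : V ζ) (a : E₁ × V ζ),
        (mfderiv 𝓘(ℝ, E₁ × V ζ) 𝓘(ℝ, CE m) (orbitMap ζ ι) (y, v) a : CE m) =
          (chartVec C.φ (C.rot (v : LieT m) * z) (C.rot (v : LieT m) * C.frame ζ z r a) : CE m) := by
  obtain ⟨C, hC⟩ := X.exists_chart (ι y)
  refine ⟨C, C.φ (ι y), _, h.isSliceFrame hreg C hy hC, C.φ.left_inv hC, fun v a => ?_⟩
  have hd : HasFDerivAt (C.φ ∘ ι) (fderiv ℝ (C.φ ∘ ι) y) y :=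
    ((h.contDiffAt_coord C hy hC).differentiableAt (by simp)).hasFDerivAt
  refine (mfderiv_eq_chartVec C.mem_maximalAtlas
    (C.hasFDerivAt_rot_mul ζ (y := (y, v)) hd) (C.rot_mul_mem (C.φ.map_source hC) _) ?_ a).2
  filter_upwards [continuous_fst.continuousAt.eventually (h.eventually_mem C hy hC)] with x hx
  exact C.orbitMap_eq hx.2

end IsSliceParam

end Toric

/-! ### Pullback of `ω`, induced metric and phase of the orbit map. -/

section Toric

variable {m : ℕ} {M : Type*} [TopologicalSpace M] [ChartedSpace (CE m) M]
  [MulAction (Fin m → ℂˣ) M] {n : ℕ} {E₁ : Type*} [NormedAddCommGroup E₁] [NormedSpace ℝ E₁]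

theorem IsSliceFrame.orbitMap_eq {X : ToricKahlerManifold m M} {C : ToricChart m X.base}
    {ζ : Fin n → LieT m} {z : CE m} {r : E₁ →L[ℝ] CE m} (h : IsSliceFrame X C ζ z r) {ι : E₁ → M}
    {y : E₁} (hz : C.φ.symm z = ι y) (v : V ζ) :
    orbitMap ζ ι (y, v) = C.φ.symm (C.rot (v : LieT m) * z) := by
  rw [← C.expT_smul_symm h.mem, hz, orbitMap]

theorem IsSliceFrame.exists_isBlockPositive [IsManifold 𝓘(ℂ, CE m) ∞ M]
    {X : ToricKahlerManifold m M} {C : ToricChart m X.base} {ζ : Fin n → LieT m} {z : CE m}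
    {r : E₁ →L[ℝ] CE m} (h : IsSliceFrame X C ζ z r) :
    ∃ β : (E₁ × V ζ) →ₗ[ℝ] (E₁ × V ζ) →ₗ[ℝ] ℝ, IsBlockPositive β ∧ ∀ a b,
      β a b = coeff X.omega C.φ (C.frame ζ z r a) (Complex.I • C.frame ζ z r b) z := by
  refine ⟨LinearMap.mk₂ ℝ
    (fun a b => coeff X.omega C.φ (C.frame ζ z r a) (Complex.I • C.frame ζ z r b) z)
    (fun a a' b => by rw [map_add, coeff_add_left])
    (fun t a b => by simp only [map_smul, coeff_eq, smul_apply, smul_eq_mul])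
    (fun a b b' => by rw [map_add, smul_add, coeff_add_right])
    (fun t a b => by rw [map_smul, smul_comm, coeff_smul_right, smul_eq_mul]), ?_,
    fun a b => rfl⟩
  have h0 : C.fund (0 : LieT m) z = 0 := by simpa using C.fund_smul 0 (0 : LieT m) z
  refine ⟨fun a ha => ?_, fun a v => (h.coeff_frame_I (a, 0) (0, v)).trans ?_,
    fun a v => (h.coeff_frame_I (0, v) (a, 0)).trans ?_⟩
  · exact coeff_I_pos X.isKahler C.mem_maximalAtlas h.mem
      fun h1 => ha (h.frame_injective (h1.trans (map_zero _).symm))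
  · simp [h0, coeff_eq]
  · simp [h0, coeff_eq]

namespace IsSliceParam

variable [IsManifold 𝓘(ℂ, CE m) ∞ M] [T2Space M] [FiniteDimensional ℝ E₁]

section Kahler

variable {X : ToricKahlerManifold m M} {ζ : Fin n → LieT m} {c : Fin n → ℝ} {ι : E₁ → M}
  {U : Set E₁} (h : IsSliceParam X ζ c ι U)
  (hreg : ∀ y ∈ X.slicePolytope ζ c, X.IsRegularPoint ζ y)

include h hreg

theorem omega_orbitMap {y : E₁} (hy : y ∈ U) (v : V ζ) (a b : E₁ × V ζ) :
    X.omega (orbitMap ζ ι (y, v)) (mfderiv 𝓘(ℝ, E₁ × V ζ) 𝓘(ℝ, CE m) (orbitMap ζ ι) (y, v) a)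
      (mfderiv 𝓘(ℝ, E₁ × V ζ) 𝓘(ℝ, CE m) (orbitMap ζ ι) (y, v) b) = 0 := by
  obtain ⟨C, z, r, hf, hz, hd⟩ := h.exists_isSliceFrame hreg hy
  exact (omega_congr X.omega (hf.orbitMap_eq hz v) (hd v a) (hd v b)).trans
    ((C.coeff_rot hf.mem v _ _).trans (hf.coeff_frame a b))

theorem injective_mfderiv_orbitMap {y : E₁} (hy : y ∈ U) (v : V ζ) :
    Function.Injective (mfderiv 𝓘(ℝ, E₁ × V ζ) 𝓘(ℝ, CE m) (orbitMap ζ ι) (y, v)) := by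
  obtain ⟨C, z, r, hf, hz, hd⟩ := h.exists_isSliceFrame hreg hy
  intro a b hab
  have h1 := chartVec_injective C.mem_maximalAtlas (C.rot_mul_mem hf.mem v)
    ((hd v a).symm.trans (Eq.trans hab (hd v b)))
  refine hf.frame_injective (funext fun j => ?_)
  exact mul_left_cancel₀ (Complex.exp_ne_zero _) (congrFun h1 j)

/-- `β` is chosen before `v`: the torus preserves `ω` and `J`, so the metric at `(y, v)` is the one
at `(y, 0)`. -/
theorem exists_kahlerMetric_orbitMap {y : E₁} (hy : y ∈ U) :
    ∃ β : (E₁ × V ζ) →ₗ[ℝ] (E₁ × V ζ) →ₗ[ℝ] ℝ, IsBlockPositive β ∧ ∀ (v : V ζ) (a b : E₁ × V ζ),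
      kahlerMetric X.omega (orbitMap ζ ι (y, v))
        (mfderiv 𝓘(ℝ, E₁ × V ζ) 𝓘(ℝ, CE m) (orbitMap ζ ι) (y, v) a)
        (mfderiv 𝓘(ℝ, E₁ × V ζ) 𝓘(ℝ, CE m) (orbitMap ζ ι) (y, v) b) = β a b := by
  obtain ⟨C, z, r, hf, hz, hd⟩ := h.exists_isSliceFrame hreg hy
  obtain ⟨β, hβ, hβ'⟩ := hf.exists_isBlockPositive
  refine ⟨β, hβ, fun v a b => ?_⟩
  rw [hβ', ← C.coeff_rot hf.mem (v : LieT m)]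
  refine omega_congr X.omega (hf.orbitMap_eq hz v) (hd v a) ?_
  rw [mul_smul_comm]
  exact (congrArg (fun w : CE m => (Complex.I • w : CE m)) (hd v b)).trans
    (cplxStr_chartVec C.mem_maximalAtlas (C.rot_mul_mem hf.mem v) _)

end Kahler

variable {X : ToricAlmostCalabiYau m M} {ζ : Fin n → LieT m} {c : Fin n → ℝ} {ι : E₁ → M}
  {U : Set E₁} (h : IsSliceParam X.toToricKahlerManifold ζ c ι U)
  (hreg : ∀ y ∈ X.slicePolytope ζ c, X.IsRegularPoint ζ y)

include h hreg

/-- The torus element contributes `e^{2πi⟨γ, v⟩}` and the `n` orbit directions contribute `i^n`. The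
other factors, the coefficient of `Ω` at a real point among them, are real, and their sign is
invisible modulo `π`. -/
theorem arg_orbitMap (hζ : LinearIndependent ℝ ζ) (hdim : Module.finrank ℝ E₁ + n = m) {y : E₁}
    (hy : y ∈ U) (v : V ζ) {w : Fin m → E₁ × V ζ} (hw : LinearIndependent ℝ w) :
    X.Ω (orbitMap ζ ι (y, v))
        (fun i => mfderiv 𝓘(ℝ, E₁ × V ζ) 𝓘(ℝ, CE m) (orbitMap ζ ι) (y, v) (w i)) ≠ 0 ∧
      ((X.Ω (orbitMap ζ ι (y, v)) (fun i => mfderiv 𝓘(ℝ, E₁ × V ζ) 𝓘(ℝ, CE m)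
        (orbitMap ζ ι) (y, v) (w i))).arg : AddCircle Real.pi) =
      ((2 * Real.pi * inner ℝ (intVec X.γ) (v : LieT m) + Real.pi / 2 * n : ℝ) :
        AddCircle Real.pi) := by
  obtain ⟨C, z, r, hf, hz, hd⟩ := h.exists_isSliceFrame hreg hy
  have h1 : X.Ω (orbitMap ζ ι (y, v))
      (fun i => mfderiv 𝓘(ℝ, E₁ × V ζ) 𝓘(ℝ, CE m) (orbitMap ζ ι) (y, v) (w i)) =
      Complex.exp ((2 * Real.pi * inner ℝ (intVec X.γ) (v : LieT m) : ℝ) * Complex.I) *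
        (topCoeff X.Ω C.φ z * (Matrix.of fun i => C.frame ζ z r (w i)).det) := by
    rw [← topForm_apply_chartVec X.Ω C.mem_maximalAtlas hf.mem, ← X.Ω_expT]
    refine topForm_congr X.Ω (by rw [hz, orbitMap]) (funext fun i => ?_)
    exact (hd v (w i)).trans (C.mfderiv_expT_smul hf.mem v _).symm
  have hdet := hf.det_frame_ne_zero hw
  obtain ⟨ρ, hρ⟩ := hf.exists_det_frame_eq hζ hdim w
  have htop : topCoeff X.Ω C.φ z ≠ 0 := by
    intro h0
    refine X.Ω_ne_zero (C.φ.symm z) (ContinuousAlternatingMap.ext fun Y => ?_)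
    choose a ha using fun i => exists_chartVec_eq C.mem_maximalAtlas hf.mem (Y i)
    have h2 := topForm_apply_chartVec X.Ω C.mem_maximalAtlas hf.mem a
    rw [h0, zero_mul] at h2
    refine Eq.trans (topForm_congr X.Ω rfl (funext fun i => (ha i).symm)) h2
  have hW : X.Ω (orbitMap ζ ι (y, v)) (fun i => mfderiv 𝓘(ℝ, E₁ × V ζ) 𝓘(ℝ, CE m)
      (orbitMap ζ ι) (y, v) (w i)) ≠ 0 := by
    rw [h1]
    exact mul_ne_zero (Complex.exp_ne_zero _) (mul_ne_zero htop hdet)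
  refine ⟨hW, coe_arg_eq_of_eq_mul_exp hW (r := (topCoeff X.Ω C.φ z).re * ρ) ?_⟩
  have hre : topCoeff X.Ω C.φ z = ((topCoeff X.Ω C.φ z).re : ℂ) :=
    Complex.ext (by simp) (by simp [ToricAlmostCalabiYau.topCoeff_real C hf.mem hf.real])
  have hI : Complex.exp ((Real.pi / 2 * n : ℝ) * Complex.I) = Complex.I ^ n := by
    conv_rhs => rw [← Complex.exp_pi_div_two_mul_I, ← Complex.exp_nat_mul]
    congr 1
    push_cast
    ring
  rw [h1, hρ, Complex.ofReal_add, add_mul, Complex.exp_add, hI, hre]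
  push_cast
  simp only [Complex.ofReal_re]
  ring

end IsSliceParam

end Toric

/-! ### Passage from parametrizations to the product manifold. -/

section Toric

variable {m : ℕ} {M : Type*} [TopologicalSpace M] [ChartedSpace (CE m) M]
  [MulAction (Fin m → ℂˣ) M] {n : ℕ}

/-- The model space of the real slice. -/
abbrev SliceE (m n : ℕ) : Type := EuclideanSpace ℝ (Fin (m - n))

/-- The parametrization of the real slice by a preferred chart. -/
def sliceParam {S : Set M} [ChartedSpace (SliceE m n) S] (p : S) (y : SliceE m n) : M :=
  ((chartAt (SliceE m n) p).symm y : M)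

/-- `F` is given by `(p, v) ↦ exp(v) · p` in the charts of `T`. -/
def IsOrbitMap {X : ToricKahlerManifold m M} {ζ : Fin n → LieT m} {c : Fin n → ℝ} {T : Type*}
    [TopologicalSpace T] [ChartedSpace (V ζ) T] (F : X.realSlice ζ c × T → M) : Prop :=
  ∀ (p : X.realSlice ζ c) (t : T), ∀ v ∈ (chartAt (V ζ) t).target,
    F (p, (chartAt (V ζ) t).symm v) = expT (v : LieT m) • (p : M)

/-- The charts of the real slice are smooth parametrizations. -/
structure IsSmoothSlice (X : ToricKahlerManifold m M) (ζ : Fin n → LieT m) (c : Fin n → ℝ)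
    [ChartedSpace (SliceE m n) (X.realSlice ζ c)] : Prop where
  contMDiff : ContMDiff 𝓘(ℝ, SliceE m n) 𝓘(ℝ, CE m) ∞ (Subtype.val : X.realSlice ζ c → M)
  injective : ∀ (p : X.realSlice ζ c), ∀ y ∈ (chartAt (SliceE m n) p).target,
    Function.Injective (mfderiv 𝓘(ℝ, SliceE m n) 𝓘(ℝ, CE m) (sliceParam (m := m) (n := n) p) y)

section Kahler

variable {X : ToricKahlerManifold m M} {ζ : Fin n → LieT m} {c : Fin n → ℝ}
  [ChartedSpace (SliceE m n) (X.realSlice ζ c)]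

theorem IsSmoothSlice.isSliceParam [IsManifold 𝓘(ℝ, SliceE m n) ∞ (X.realSlice ζ c)]
    (hS : IsSmoothSlice X ζ c) (p : X.realSlice ζ c) :
    IsSliceParam X ζ c (sliceParam (n := n) p) (chartAt (SliceE m n) p).target where
  isOpen := (chartAt (SliceE m n) p).open_target
  contMDiffOn := hS.contMDiff.comp_contMDiffOn contMDiffOn_chart_symm
  mapsTo y _ := ((chartAt (SliceE m n) p).symm y).2
  injective := hS.injective p

variable {T : Type*} [TopologicalSpace T] [ChartedSpace (V ζ) T]

theorem fst_mem_of_mem_target {x : X.realSlice ζ c × T} {y : SliceE m n × V ζ}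
    (hy : y ∈ (extChartAt (modelL ζ) x).target) : y.1 ∈ (chartAt (SliceE m n) x.1).target := by
  rw [extChartAt_prod] at hy
  simp only [mfld_simps] at hy
  exact hy.1

theorem IsSmoothSlice.contMDiffAt_orbitMap [IsManifold 𝓘(ℂ, CE m) ∞ M]
    [IsManifold 𝓘(ℝ, SliceE m n) ∞ (X.realSlice ζ c)] (hS : IsSmoothSlice X ζ c)
    (x : X.realSlice ζ c × T) {y : SliceE m n × V ζ}
    (hy : y ∈ (extChartAt (modelL ζ) x).target) :
    ContMDiffAt 𝓘(ℝ, SliceE m n × V ζ) 𝓘(ℝ, CE m) ∞ (orbitMap ζ (sliceParam (n := n) x.1)) y := by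
  have h := hS.isSliceParam x.1
  exact h.contMDiffOn_orbitMap.contMDiffAt ((h.isOpen.prod isOpen_univ).mem_nhds
    ⟨fst_mem_of_mem_target hy, Set.mem_univ _⟩)

namespace IsOrbitMap

variable {F : X.realSlice ζ c × T → M} (hF : IsOrbitMap F)

include hF

theorem apply_extChartAt_symm (x : X.realSlice ζ c × T) {y : SliceE m n × V ζ}
    (hy : y ∈ (extChartAt (modelL ζ) x).target) :
    F ((extChartAt (modelL ζ) x).symm y) = orbitMap ζ (sliceParam (n := n) x.1) y := by
  rw [extChartAt_prod] at hy ⊢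
  simp only [mfld_simps] at hy ⊢
  exact hF _ _ _ hy.2

variable [IsManifold 𝓘(ℂ, CE m) ∞ M] [IsManifold 𝓘(ℝ, SliceE m n) ∞ (X.realSlice ζ c)]
  (hS : IsSmoothSlice X ζ c)

include hS

theorem contMDiff : ContMDiff (modelL ζ) 𝓘(ℝ, CE m) ∞ F := by
  intro x
  have h1 := (hS.contMDiffAt_orbitMap x (mem_extChartAt_target x)).comp x
    (contMDiffAt_extChartAt (I := modelL ζ) (n := ∞) (x := x))
  refine h1.congr_of_eventuallyEq ?_
  filter_upwards [extChartAt_source_mem_nhds (I := modelL ζ) x] with x' hx'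
  rw [Function.comp_apply, ← hF.apply_extChartAt_symm x ((extChartAt (modelL ζ) x).map_source hx'),
    (extChartAt (modelL ζ) x).left_inv hx']

/-- The form of the differential needed for the Laplacian: the chart at `x` is fixed while the point
`y` varies over its target, as in `gram`. -/
theorem mfderiv_extChartAt_symm [IsManifold 𝓘(ℝ, V ζ) ∞ T] (x : X.realSlice ζ c × T) {y : SliceE m n × V ζ}
    (hy : y ∈ (extChartAt (modelL ζ) x).target) (a : SliceE m n × V ζ) :
    (mfderiv (modelL ζ) 𝓘(ℝ, CE m) F ((extChartAt (modelL ζ) x).symm y)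
      (mfderiv 𝓘(ℝ, SliceE m n × V ζ) (modelL ζ) (extChartAt (modelL ζ) x).symm y a) : CE m) =
    (mfderiv 𝓘(ℝ, SliceE m n × V ζ) 𝓘(ℝ, CE m) (orbitMap ζ (sliceParam (n := n) x.1)) y a :
      CE m) := by
  have h1 : MDifferentiableAt 𝓘(ℝ, SliceE m n × V ζ) (modelL ζ) (extChartAt (modelL ζ) x).symm y :=
    ((contMDiffOn_extChartAt_symm (n := ∞) x).contMDiffAt
      ((isOpen_extChartAt_target x).mem_nhds hy)).mdifferentiableAt (by simp)
  have h2 := mfderiv_comp y ((hF.contMDiff hS).mdifferentiable (by simp) _) h1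
  have h3 : F ∘ (extChartAt (modelL ζ) x).symm =ᶠ[𝓝 y] orbitMap ζ (sliceParam (n := n) x.1) := by
    filter_upwards [(isOpen_extChartAt_target x).mem_nhds hy] with y' hy'
    exact hF.apply_extChartAt_symm x hy'
  rw [h3.mfderiv_eq] at h2
  exact (DFunLike.congr_fun h2 a).symm

theorem mfderiv_eq (x : X.realSlice ζ c × T) (a : TangentSpace (modelL ζ) x) :
    (mfderiv (modelL ζ) 𝓘(ℝ, CE m) F x a : CE m) =
    (mfderiv 𝓘(ℝ, SliceE m n × V ζ) 𝓘(ℝ, CE m) (orbitMap ζ (sliceParam (n := n) x.1))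
      (extChartAt (modelL ζ) x x) (mfderiv (modelL ζ) 𝓘(ℝ, SliceE m n × V ζ)
        (extChartAt (modelL ζ) x) x a) : CE m) := by
  have h1 : MDifferentiableAt (modelL ζ) 𝓘(ℝ, SliceE m n × V ζ) (extChartAt (modelL ζ) x) x :=
    (contMDiffAt_extChartAt (n := ∞)).mdifferentiableAt (by simp)
  have h2 := mfderiv_comp x ((hS.contMDiffAt_orbitMap x
    (mem_extChartAt_target x)).mdifferentiableAt (by simp)) h1
  have h3 : F =ᶠ[𝓝 x] orbitMap ζ (sliceParam (n := n) x.1) ∘ extChartAt (modelL ζ) x := by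
    filter_upwards [extChartAt_source_mem_nhds (I := modelL ζ) x] with x' hx'
    rw [Function.comp_apply,
      ← hF.apply_extChartAt_symm x ((extChartAt (modelL ζ) x).map_source hx'),
      (extChartAt (modelL ζ) x).left_inv hx']
  rw [h3.mfderiv_eq, h2]
  rfl

end IsOrbitMap

end Kahler

end Toric

/-! ### Lagrangian immersion, Lagrangian angle and stationarity. -/

section Toric

variable {m : ℕ} {M : Type*} [TopologicalSpace M] [ChartedSpace (CE m) M]
  [MulAction (Fin m → ℂˣ) M] {n : ℕ} [IsManifold 𝓘(ℂ, CE m) ∞ M] [T2Space M]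

theorem finrank_slice_prod {ζ : Fin n → LieT m} (hζ : LinearIndependent ℝ ζ) :
    Module.finrank ℝ (SliceE m n) + n = m ∧ Module.finrank ℝ (SliceE m n × V ζ) = m := by
  have hnm : n ≤ m := by simpa using hζ.fintype_card_le_finrank
  have h1 : Module.finrank ℝ (V ζ) = n := by simpa using finrank_span_eq_card hζ
  rw [Module.finrank_prod, h1, finrank_euclideanSpace_fin]
  omega

omit [IsManifold 𝓘(ℂ, CE m) ∞ M] [T2Space M] in
theorem injective_mfderiv_extChartAt {X : ToricKahlerManifold m M} {ζ : Fin n → LieT m}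
    {c : Fin n → ℝ} [ChartedSpace (SliceE m n) (X.realSlice ζ c)] {T : Type*} [TopologicalSpace T]
    [ChartedSpace (V ζ) T] [IsManifold 𝓘(ℝ, SliceE m n) ∞ (X.realSlice ζ c)]
    [IsManifold 𝓘(ℝ, V ζ) ∞ T] (x : X.realSlice ζ c × T) :
    Function.Injective (mfderiv (modelL ζ) 𝓘(ℝ, SliceE m n × V ζ) (extChartAt (modelL ζ) x) x) := by
  have h1 : IsManifold (modelL ζ) ∞ (X.realSlice ζ c × T) := inferInstance
  have h2 : IsManifold (modelL ζ) 1 (X.realSlice ζ c × T) := IsManifold.of_le (n := ∞) (by simp)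
  exact (isInvertible_mfderiv_extChartAt (mem_extChartAt_source x)).injective

namespace IsOrbitMap

section Kahler

variable {X : ToricKahlerManifold m M} {ζ : Fin n → LieT m} {c : Fin n → ℝ}
  [ChartedSpace (SliceE m n) (X.realSlice ζ c)] {T : Type*} [TopologicalSpace T]
  [ChartedSpace (V ζ) T] {F : X.realSlice ζ c × T → M} (hF : IsOrbitMap F)
  [IsManifold 𝓘(ℝ, SliceE m n) ∞ (X.realSlice ζ c)]
  [IsManifold 𝓘(ℝ, V ζ) ∞ T] (hS : IsSmoothSlice X ζ c)
  (hreg : ∀ y ∈ X.slicePolytope ζ c, X.IsRegularPoint ζ y) (hζ : LinearIndependent ℝ ζ)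

include hF hS hreg hζ

theorem isLagrangianImmersion : IsLagrangianImmersion (modelL ζ) X.omega F where
  immersion := by
    have : IsManifold 𝓘(ℝ, CE m) ∞ M := isManifold_real
    -- The complement has real dimension `2m - m = m`, so the Lie algebra can model it.
    refine Manifold.IsImmersionOfComplement.isImmersion (F := LieT m) fun x =>
      isImmersionAtOfComplement_of_injective ?_ (hF.contMDiff hS) x fun a b hab => ?_
    · rw [(finrank_slice_prod hζ).2, Module.finrank_pi_fintype]
      simp [Complex.finrank_real_complex]
      ring
    · have h1 := (hS.isSliceParam x.1).injective_mfderiv_orbitMap hreg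
        (fst_mem_of_mem_target (mem_extChartAt_target x)) (extChartAt (modelL ζ) x x).2
      have h2 := h1 ((hF.mfderiv_eq hS x a).symm.trans (Eq.trans hab (hF.mfderiv_eq hS x b)))
      exact injective_mfderiv_extChartAt x h2
  finrank_eq := (finrank_slice_prod hζ).2
  pullback_eq_zero x a b := by
    refine (omega_congr X.omega ?_ (hF.mfderiv_eq hS x a) (hF.mfderiv_eq hS x b)).trans
      ((hS.isSliceParam x.1).omega_orbitMap hreg
        (fst_mem_of_mem_target (mem_extChartAt_target x)) (extChartAt (modelL ζ) x x).2 _ _)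
    rw [← hF.apply_extChartAt_symm x (mem_extChartAt_target x), extChartAt_to_inv x]

end Kahler

variable {X : ToricAlmostCalabiYau m M} {ζ : Fin n → LieT m} {c : Fin n → ℝ}
  [ChartedSpace (SliceE m n) (X.realSlice ζ c)] {T : Type*} [TopologicalSpace T]
  [ChartedSpace (V ζ) T] {F : X.realSlice ζ c × T → M} (hF : IsOrbitMap F)
  [IsManifold 𝓘(ℝ, SliceE m n) ∞ (X.realSlice ζ c)]
  [IsManifold 𝓘(ℝ, V ζ) ∞ T] (hS : IsSmoothSlice X.toToricKahlerManifold ζ c)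
  (hreg : ∀ y ∈ X.slicePolytope ζ c, X.IsRegularPoint ζ y) (hζ : LinearIndependent ℝ ζ)
  {θ : X.realSlice ζ c × T → AddCircle Real.pi}
  (hθ : ∀ (p : X.realSlice ζ c) (t : T), ∀ v ∈ (chartAt (V ζ) t).target,
    θ (p, (chartAt (V ζ) t).symm v) = ((2 * Real.pi * inner ℝ (intVec X.γ) (v : LieT m)
      + Real.pi / 2 * n : ℝ) : AddCircle Real.pi))

include hθ in
omit [IsManifold 𝓘(ℂ, CE m) ∞ M] [T2Space M] [IsManifold 𝓘(ℝ, SliceE m n) ∞ (X.realSlice ζ c)]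
  [IsManifold 𝓘(ℝ, V ζ) ∞ T] in
theorem angle_eq (x : X.realSlice ζ c × T) {x' : X.realSlice ζ c × T}
    (hx' : x' ∈ (extChartAt (modelL ζ) x).source) :
    θ x' = ((2 * Real.pi * inner ℝ (intVec X.γ) ((extChartAt (modelL ζ) x x').2 : LieT m)
      + Real.pi / 2 * n : ℝ) : AddCircle Real.pi) := by
  have h1 := (extChartAt (modelL ζ) x).map_source hx'
  conv_lhs => rw [← (extChartAt (modelL ζ) x).left_inv hx']
  rw [extChartAt_prod] at h1 ⊢
  simp only [mfld_simps] at h1 ⊢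
  exact hθ _ _ _ h1.2

include hF hS hreg hθ

include hζ in

theorem isLagrangianAngle : IsLagrangianAngle (modelL ζ) X.Ω F θ := by
  intro x b
  set w : Fin m → SliceE m n × V ζ := fun i =>
    mfderiv (modelL ζ) 𝓘(ℝ, SliceE m n × V ζ) (extChartAt (modelL ζ) x) x (b i)
  have hw : LinearIndependent ℝ w :=
    b.linearIndependent.map' _ (LinearMap.ker_eq_bot.mpr (injective_mfderiv_extChartAt x))
  have h1 := (hS.isSliceParam x.1).arg_orbitMap hreg hζ (finrank_slice_prod hζ).1
    (fst_mem_of_mem_target (mem_extChartAt_target x)) (extChartAt (modelL ζ) x x).2 hw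
  have h2 : X.Ω (F x) (fun i => mfderiv (modelL ζ) 𝓘(ℝ, CE m) F x (b i)) = _ :=
    topForm_congr X.Ω (q := orbitMap ζ (sliceParam (n := n) x.1) (extChartAt (modelL ζ) x x))
      (by rw [← hF.apply_extChartAt_symm x (mem_extChartAt_target x), extChartAt_to_inv x])
      (funext fun i => hF.mfderiv_eq hS x (b i))
  rw [h2, angle_eq hθ x (mem_extChartAt_source x)]
  exact ⟨h1.1, h1.2.symm⟩

theorem isWeightedHamiltonianStationary {ψ : M → ℝ}
    (hψ : IsConformalPotential X.omega X.Ω ψ) :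
    IsWeightedHamiltonianStationary (modelL ζ) X.omega ψ F θ := by
  intro x
  set ι := sliceParam (m := m) (n := n) x.1
  set U := (chartAt (SliceE m n) x.1).target
  have hι : IsSliceParam X.toToricKahlerManifold ζ c ι U := hS.isSliceParam x.1
  -- The slope of the local lift of the angle, which is affine in the second chart coordinate and
  -- constant in the first.
  set l : V ζ →L[ℝ] ℝ := (2 * Real.pi) • ((innerSL ℝ (intVec X.γ)).comp (V ζ).subtypeL)
  have hl : ∀ v : V ζ, l v = 2 * Real.pi * inner ℝ (intVec X.γ) (v : LieT m) := fun v => rfl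
  refine ⟨(extChartAt (modelL ζ) x).source, extChartAt_source_mem_nhds x,
    fun x' => l (extChartAt (modelL ζ) x x').2 + Real.pi / 2 * n, ?_, fun x' hx' => ?_, ?_⟩
  · have h1 : ContDiff ℝ ∞ fun y : SliceE m n × V ζ => l y.2 + Real.pi / 2 * n :=
      (l.contDiff.comp contDiff_snd).add contDiff_const
    have h2 : ContMDiffOn (modelL ζ) 𝓘(ℝ, SliceE m n × V ζ) ∞ (extChartAt (modelL ζ) x)
        (extChartAt (modelL ζ) x).source := by
      rw [extChartAt_source]; exact contMDiffOn_extChartAt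
    exact h1.contMDiff.comp_contMDiffOn h2
  · rw [angle_eq hθ x hx']
    rfl
  · have hβ := fun y (hy : y ∈ U) => hι.exists_kahlerMetric_orbitMap hreg hy
    choose! β hβ hβ' using hβ
    have hmem := fun y (hy : y ∈ (extChartAt (modelL ζ) x).target) => fst_mem_of_mem_target hy
    refine weightedLaplacian_eq_zero (isOpen_extChartAt_target x) (mem_extChartAt_target x)
      (fun y => β y.1) (fun y hy a b => ?_) (fun y hy => hβ _ (hmem y hy))
      (fun y _ y' _ h a b => by rw [h]) (fun a b => ?_) (l := l) (c := Real.pi / 2 * n)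
      (fun y hy => ?_) (fun y hy y' hy' h => ?_)
    · rw [← hβ' y.1 (hmem y hy) y.2]
      exact omega_congr X.omega (hF.apply_extChartAt_symm x hy)
        (hF.mfderiv_extChartAt_symm hS x hy a) (congrArg (fun w : CE m => (Complex.I • w : CE m))
          (hF.mfderiv_extChartAt_symm hS x hy b))
    · have h1 := (contDiffAt_omega_along X.isKahler (hι.isOpen.prod isOpen_univ)
        hι.contMDiffOn_orbitMap (y := extChartAt (modelL ζ) x x)
        ⟨hmem _ (mem_extChartAt_target x), Set.mem_univ _⟩ a b).2
      refine (h1.differentiableAt (by simp)).congr_of_eventuallyEq ?_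
      filter_upwards [(isOpen_extChartAt_target x).mem_nhds (mem_extChartAt_target x)] with y hy
      exact (hβ' y.1 (hmem y hy) y.2 a b).symm
    · rw [(extChartAt (modelL ζ) x).right_inv hy]
    · rw [hF.apply_extChartAt_symm x hy, hF.apply_extChartAt_symm x hy', orbitMap, orbitMap, neg_mul,
        neg_mul, X.potential_expT hψ, X.potential_expT hψ, h]

end IsOrbitMap

end Toric

/-! ### The two choices of the second factor: the ball and the torus `T_ζ`. -/

section Toric

variable {m : ℕ} {M : Type*} [TopologicalSpace M] [ChartedSpace (CE m) M]
  [MulAction (Fin m → ℂˣ) M] {n : ℕ}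

section Ball

variable {X : ToricKahlerManifold m M} {ζ : Fin n → LieT m} {c : Fin n → ℝ}

theorem coe_chartAt_symm_opens {E : Type*} [NormedAddCommGroup E] (U : TopologicalSpace.Opens E)
    (t : U) {v : E} (hv : v ∈ (chartAt E t).target) : ((chartAt E t).symm v : E) = v := by
  rw [TopologicalSpace.Opens.chartAt_eq, chartAt_self_eq] at hv ⊢
  have h1 := (OpenPartialHomeomorph.refl E).subtypeRestr_symm_apply ⟨t⟩ hv
  exact h1

theorem isOrbitMap_mapU (U : TopologicalSpace.Opens (V ζ)) : IsOrbitMap (mapU X ζ c U) := by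
  intro p t v hv
  rw [mapU, coe_chartAt_symm_opens U t hv]

/-- Charts of `T_ζ` are local inverses of the quotient map, so in them `mapT` has the same formula
as on `V_ζ`. -/
theorem chartAt_symm_torus (t : Torus ζ) (v : V ζ) :
    (chartAt (V ζ) t).symm v = QuotientAddGroup.mk v := by
  change ((isLocalHomeomorph_mk ζ).localInverseAt _).symm v = _
  rw [(isLocalHomeomorph_mk ζ).localInverseAt_symm]

theorem mapT_mk (p : X.realSlice ζ c) (v : V ζ) :
    mapT X ζ c (p, QuotientAddGroup.mk v) = expT (v : LieT m) • (p : M) := rfl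

theorem isOrbitMap_mapT : IsOrbitMap (mapT X ζ c) := by
  intro p t v hv
  rw [chartAt_symm_torus, mapT_mk]

theorem mapT_mk_add (p : X.realSlice ζ c) (t : Torus ζ) (w : V ζ) :
    mapT X ζ c (p, (QuotientAddGroup.mk w : Torus ζ) + t) =
      expT (w : LieT m) • mapT X ζ c (p, t) := by
  obtain ⟨v, rfl⟩ := QuotientAddGroup.mk_surjective t
  rw [← QuotientAddGroup.mk_add, mapT_mk, mapT_mk, Submodule.coe_add, expT_add, mul_smul]

end Ball

/-- The linear form `2π⟨γ, v⟩` modulo `π`, on the torus `T_ζ`. -/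
def torusAngle (γ : Fin m → ℤ) (ζ : Fin n → LieT m) : Torus ζ →+ AddCircle Real.pi :=
  QuotientAddGroup.lift (lattice ζ)
    { toFun := fun v => ((2 * Real.pi * inner ℝ (intVec γ) (v : LieT m) : ℝ) : AddCircle Real.pi)
      map_zero' := by simp
      map_add' := fun v w => by
        rw [Submodule.coe_add, inner_add_right, mul_add, AddCircle.coe_add] } (by
    rintro v ⟨a, ha⟩
    have ha' : intVec a = (v : LieT m) := ha
    change ((2 * Real.pi * inner ℝ (intVec γ) (v : LieT m) : ℝ) : AddCircle Real.pi) = 0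
    rw [← ha', AddCircle.coe_eq_zero_iff]
    -- For integral `a` the number `2π⟨γ, a⟩` consists of `2⟨γ, a⟩` periods of length `π`.
    refine ⟨2 * ∑ i, γ i * a i, ?_⟩
    simp only [intVec, PiLp.inner_apply, zsmul_eq_mul, RCLike.inner_apply, conj_trivial]
    push_cast
    simp only [mul_comm ((a _ : ℤ) : ℝ)]
    ring)

end Toric

end ToricCY

end

/-! ### The main theorem. -/

theorem mainTheorem1 {m : ℕ} {M : Type*} [TopologicalSpace M] [T2Space M]
    [ChartedSpace (ToricCY.CE m) M] [IsManifold 𝓘(ℂ, ToricCY.CE m) ∞ M]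
    [MulAction (Fin m → ℂˣ) M] (X : ToricCY.ToricAlmostCalabiYau m M)
    (ψ : M → ℝ) (hψ : ToricCY.IsConformalPotential X.omega X.Ω ψ)
    {n : ℕ} (ζ : Fin n → ToricCY.LieT m) (hζ : LinearIndependent ℝ ζ) (c : Fin n → ℝ)
    (hreg : ∀ y ∈ X.slicePolytope ζ c, X.IsRegularPoint ζ y) :
    -- `M^σ_{ζ,c}` is an embedded submanifold of dimension `m - n`
    ∃ _ : ChartedSpace (EuclideanSpace ℝ (Fin (m - n))) (X.realSlice ζ c),
      IsManifold 𝓘(ℝ, EuclideanSpace ℝ (Fin (m - n))) ∞ (X.realSlice ζ c) ∧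
      Manifold.IsSmoothEmbedding 𝓘(ℝ, EuclideanSpace ℝ (Fin (m - n))) 𝓘(ℝ, ToricCY.CE m) ∞
        (Subtype.val : X.realSlice ζ c → M) ∧
      -- the generic case `L = M^σ_{ζ,c} × U`, with `U` the open ball of radius `r` in `V_ζ`
      (∀ r : ℝ, 0 < r →
        ToricCY.IsLagrangianImmersion (ToricCY.modelL ζ) X.omega
          (ToricCY.mapU X.toToricKahlerManifold ζ c (ToricCY.ballU ζ r)) ∧
        ∃ θ : X.realSlice ζ c × ToricCY.ballU ζ r → AddCircle Real.pi,
          ToricCY.IsLagrangianAngle (ToricCY.modelL ζ) X.Ω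
            (ToricCY.mapU X.toToricKahlerManifold ζ c (ToricCY.ballU ζ r)) θ ∧
          (∀ (p : X.realSlice ζ c) (v : ToricCY.ballU ζ r), θ (p, v) =
            ((2 * Real.pi * inner ℝ (ToricCY.intVec X.γ) ((v : ToricCY.V ζ) : ToricCY.LieT m)
              + Real.pi / 2 * n : ℝ) : AddCircle Real.pi)) ∧
          ToricCY.IsWeightedHamiltonianStationary (ToricCY.modelL ζ) X.omega ψ
            (ToricCY.mapU X.toToricKahlerManifold ζ c (ToricCY.ballU ζ r)) θ) ∧
      -- the special case `L = M^σ_{ζ,c} × T_ζ`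
      (ToricCY.SpecialCondition ζ →
        ToricCY.IsLagrangianImmersion (ToricCY.modelL ζ) X.omega
          (ToricCY.mapT X.toToricKahlerManifold ζ c) ∧
        (∃ θ : X.realSlice ζ c × ToricCY.Torus ζ → AddCircle Real.pi,
          ToricCY.IsLagrangianAngle (ToricCY.modelL ζ) X.Ω
            (ToricCY.mapT X.toToricKahlerManifold ζ c) θ ∧
          (∀ (p : X.realSlice ζ c) (v : ToricCY.V ζ),
            θ (p, (QuotientAddGroup.mk v : ToricCY.Torus ζ)) =
              ((2 * Real.pi * inner ℝ (ToricCY.intVec X.γ) (v : ToricCY.LieT m)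
                + Real.pi / 2 * n : ℝ) : AddCircle Real.pi)) ∧
          ToricCY.IsWeightedHamiltonianStationary (ToricCY.modelL ζ) X.omega ψ
            (ToricCY.mapT X.toToricKahlerManifold ζ c) θ) ∧
        -- `F` is `T_ζ`-invariant
        (∀ (p : X.realSlice ζ c) (t : ToricCY.Torus ζ) (w : ToricCY.V ζ),
          ToricCY.mapT X.toToricKahlerManifold ζ c
              (p, (QuotientAddGroup.mk w : ToricCY.Torus ζ) + t) =
            ToricCY.expT (w : ToricCY.LieT m) •
              ToricCY.mapT X.toToricKahlerManifold ζ c (p, t))) := by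
  obtain ⟨_, h1, h2, h3⟩ :=
    ToricCY.ToricKahlerManifold.exists_chartedSpace_realSlice (c := c) hζ hreg
  have hS : ToricCY.IsSmoothSlice X.toToricKahlerManifold ζ c := ⟨h2.contMDiff, h3⟩
  refine ⟨_, h1, h2, fun r _ => ?_, fun _ => ?_⟩
  · have hF := ToricCY.isOrbitMap_mapU (X := X.toToricKahlerManifold) (c := c)
      (ToricCY.ballU ζ r)
    obtain ⟨θ, hθ⟩ : ∃ θ : X.realSlice ζ c × ToricCY.ballU ζ r → AddCircle Real.pi,
        ∀ p v, θ (p, v) =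
          ((2 * Real.pi * inner ℝ (ToricCY.intVec X.γ) ((v : ToricCY.V ζ) : ToricCY.LieT m)
            + Real.pi / 2 * n : ℝ) : AddCircle Real.pi) :=
      ⟨fun q => ((2 * Real.pi *
        inner ℝ (ToricCY.intVec X.γ) ((q.2 : ToricCY.V ζ) : ToricCY.LieT m)
          + Real.pi / 2 * n : ℝ) : AddCircle Real.pi), fun _ _ => rfl⟩
    have hθ' : ∀ (p : X.realSlice ζ c) (t : ToricCY.ballU ζ r),
        ∀ v ∈ (chartAt (ToricCY.V ζ) t).target, θ (p, (chartAt (ToricCY.V ζ) t).symm v) =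
          ((2 * Real.pi * inner ℝ (ToricCY.intVec X.γ) (v : ToricCY.LieT m)
            + Real.pi / 2 * n : ℝ) : AddCircle Real.pi) := fun p t v hv => by
      rw [hθ, ToricCY.coe_chartAt_symm_opens _ t hv]
    exact ⟨hF.isLagrangianImmersion hS hreg hζ, θ, hF.isLagrangianAngle hS hreg hζ hθ', hθ,
      hF.isWeightedHamiltonianStationary hS hreg hθ' hψ⟩
  · have hF := ToricCY.isOrbitMap_mapT (X := X.toToricKahlerManifold) (ζ := ζ) (c := c)
    obtain ⟨θ, hθ⟩ : ∃ θ : X.realSlice ζ c × ToricCY.Torus ζ → AddCircle Real.pi,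
        ∀ p (v : ToricCY.V ζ), θ (p, (QuotientAddGroup.mk v : ToricCY.Torus ζ)) =
          ((2 * Real.pi * inner ℝ (ToricCY.intVec X.γ) (v : ToricCY.LieT m)
            + Real.pi / 2 * n : ℝ) : AddCircle Real.pi) :=
      -- Only the linear part has to descend to the quotient, as a homomorphism; the constant `πn/2`
      -- is added afterwards.
      ⟨fun q => ToricCY.torusAngle X.γ ζ q.2 + ((Real.pi / 2 * n : ℝ) : AddCircle Real.pi),
        fun p v => by rw [AddCircle.coe_add]; rfl⟩
    have hθ' : ∀ (p : X.realSlice ζ c) (t : ToricCY.Torus ζ),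
        ∀ v ∈ (chartAt (ToricCY.V ζ) t).target, θ (p, (chartAt (ToricCY.V ζ) t).symm v) =
          ((2 * Real.pi * inner ℝ (ToricCY.intVec X.γ) (v : ToricCY.LieT m)
            + Real.pi / 2 * n : ℝ) : AddCircle Real.pi) := fun p t v _ => by
      rw [ToricCY.chartAt_symm_torus, hθ]
    exact ⟨hF.isLagrangianImmersion hS hreg hζ, ⟨θ, hF.isLagrangianAngle hS hreg hζ hθ', hθ,
      hF.isWeightedHamiltonianStationary hS hreg hθ' hψ⟩, ToricCY.mapT_mk_add⟩
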